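/- Let $G$ be a finite-dimensional Lie group with Lie algebra $\mathfrak g$, $S^1=\mathbb R/2\pi\mathbb Z$, and let $\mathcal L$ be the free loop group $LG=C^\infty(S^1,G)$ or the based loop group $\Omega G=\{\gamma\in LG:\gamma(0)=1\}$. Let $\pi:\mathsf Q\to M$ be a smooth principal $\mathcal L$-bundle over a smooth finite-dimensional manifold (Hausdorff, paracompact). Write $\mathcal A_{\mathsf Q}$ for the space of connections on $\mathsf Q$ and $\mathcal H_{\mathsf Q}$ for the space of Higgs fields, i.e. smooth maps $\Phi:\mathsf Q\to L\mathfrak g$ with $\Phi(q\gamma)=\mathrm{ad}(\gamma^{-1})\Phi(q)+\gamma^{-1}\partial\gamma$ for $\gamma\in\mathcal L$, where $\partial$ is differentiation in the $S^1$ direction. A smooth path $\gamma:[0,1]\to\mathcal A_{\mathsf Q}\times\mathcal H_{\mathsf Q}$, $t\mapsto(\mathsf A_t,\Phi_t)$, is a family that depends smoothly on $t$ and the point of $\mathsf Q$ jointly (equivalently, a connection on $\mathsf Q\times[0,1]$ annihilating $\partial_t$ together with a Higgs field on $\mathsf Q\times[0,1]$). For an integer $k\ge1$ and an invariant polynomial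 $f$ of degree $k$ on $\mathfrak g$ (a symmetric $k$-linear map $\mathfrak g^k\to\mathbb R$ invariant under the adjoint action of $G$), the string potential of $\gamma$ is the form of degree $2k-2$ on $\mathsf Q$ $$S_f(\gamma)=k\int_0^1\int_{S^1}\Big((k-1)\,f\big(\mathsf B_t,\underbrace{\mathsf F_t,\dots,\mathsf F_t}_{k-2},\nabla_t\Phi\big)+f\big(\underbrace{\mathsf F_t,\dots,\mathsf F_t}_{k-1},\varphi_t\big)\Big)\,d\theta\,dt ,$$ where $\mathsf F_t=d\mathsf A_t+\tfrac12[\mathsf A_t,\mathsf A_t]$, $\nabla_t\Phi=d\Phi_t+[\mathsf A_t,\Phi_t]-\partial\mathsf A_t$, $\mathsf B_t=\tfrac{d}{dt}\mathsf A_t$, $\varphi_t=\tfrac{d}{dt}\Phi_t$; the first term is absent when $k=1$, and wedge products of $p$- and $q$-forms are normalised by $\tfrac1{p!\,q!}$. Then: 1. For every such $f$ and every smooth path $\gamma$, the form $S_f(\gamma)$ is the pullback of a unique smooth form on $M$, also denoted $S_f(\gamma)\in\Omega^{2k-2}(M)$. 2. If $\gamma_0,\gamma_1:[0,1]\to\mathcal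 A_{\mathsf Q}\times\mathcal H_{\mathsf Q}$ are smooth paths with the same endpoints, then $S_f(\gamma_1)-S_f(\gamma_0)\in\Omega^{2k-2}(M)$ is exact on $M$ (for $k=1$: it vanishes). 3. Any two elements of $\mathcal A_{\mathsf Q}\times\mathcal H_{\mathsf Q}$ are joined by a smooth path. For a family $(f_i)_{i\in I}$ of invariant polynomials of positive degrees, call $(\mathsf A_0,\Phi_0)$ and $(\mathsf A_1,\Phi_1)$ equivalent if there is a smooth path $\gamma$ from the first to the second such that $S_{f_i}(\gamma)$ is exact on $M$ for all $i\in I$. Then, for every smooth path $\gamma$ from $(\mathsf A_0,\Phi_0)$ to $(\mathsf A_1,\Phi_1)$, these two pairs are equivalent if and only if $S_{f_i}(\gamma)$ is exact for all $i\in I$; and this is an equivalence relation on $\mathcal A_{\mathsf Q}\times\mathcal H_{\mathsf Q}$ (whose classes are the string data). -/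

import Mathlib

open scoped Manifold ContDiff

noncomputable section

/-- `ℝⁿ`, the domain of plots. -/
abbrev Cartesian (n : ℕ) : Type := EuclideanSpace ℝ (Fin n)

/-! ### Lie groups, loop groups and invariant polynomials

`G` is a Lie group modelled on the finite dimensional space `E`. Its Lie algebra
`𝔤 = T₁G = GroupLieAlgebra 𝓘(ℝ, E) G` has `E` as underlying vector space. -/

section LieGroupData

variable (E : Type*) [NormedAddCommGroup E] [NormedSpace ℝ E]
  (G : Type*) [TopologicalSpace G] [ChartedSpace E G] [Group G]

/-- The Lie bracket of the Lie algebra of `G` (through left invariant vector fields). -/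
def lieBr (ξ η : E) : E :=
  (⁅(show GroupLieAlgebra 𝓘(ℝ, E) G from ξ), (show GroupLieAlgebra 𝓘(ℝ, E) G from η)⁆ :
    GroupLieAlgebra 𝓘(ℝ, E) G)

variable {G} in
/-- The adjoint action of `g` on `𝔤`: the derivative at `1` of `h ↦ g h g⁻¹`. -/
def Ad (g : G) : E →L[ℝ] E :=
  mfderiv 𝓘(ℝ, E) 𝓘(ℝ, E) (fun h : G => g * h * g⁻¹) (1 : G)

variable {G} in
/-- The logarithmic derivative `(γ⁻¹ ∂γ)(θ) ∈ 𝔤` of a curve in `G`. -/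
def logDerivative (γ : ℝ → G) (θ : ℝ) : E :=
  mfderiv 𝓘(ℝ, ℝ) 𝓘(ℝ, E) (fun s : ℝ => (γ θ)⁻¹ * γ s) θ (1 : ℝ)

/-- The loop group of `G`, with `S¹ = ℝ / 2πℤ`: the smooth `2π`-periodic maps `ℝ → G` that take
the value `1` at the points of `B`. The free loop group `LG` is `B = ∅` and the based loop
group `ΩG` is `B = {0}`. -/
@[ext] structure LoopGroup (B : Set ℝ) where
  toFun : ℝ → G
  smooth : ContMDiff 𝓘(ℝ, ℝ) 𝓘(ℝ, E) ∞ toFun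
  periodic : Function.Periodic toFun (2 * Real.pi)
  based : ∀ θ ∈ B, toFun θ = 1

/-- The group operations of the loop group are pointwise. -/
instance LoopGroup.instGroup [LieGroup 𝓘(ℝ, E) ∞ G] (B : Set ℝ) : Group (LoopGroup E G B) where
  mul a b :=
    { toFun := fun θ => a.toFun θ * b.toFun θ
      smooth := a.smooth.mul b.smooth
      periodic := fun θ => by simp only [a.periodic θ, b.periodic θ]
      based := fun θ h => by simp [a.based θ h, b.based θ h] }
  one :=
    { toFun := fun _ => 1
      smooth := contMDiff_const
      periodic := fun _ => rfl
      based := fun _ _ => rfl }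
  inv a :=
    { toFun := fun θ => (a.toFun θ)⁻¹
      smooth := a.smooth.inv
      periodic := fun θ => by simp only [a.periodic θ]
      based := fun θ h => by simp [a.based θ h] }
  mul_assoc a b c := LoopGroup.ext (funext fun _ => mul_assoc _ _ _)
  one_mul a := LoopGroup.ext (funext fun _ => one_mul _)
  mul_one a := LoopGroup.ext (funext fun _ => mul_one _)
  inv_mul_cancel a := LoopGroup.ext (funext fun _ => inv_mul_cancel _)

@[simp] theorem LoopGroup.mul_toFun [LieGroup 𝓘(ℝ, E) ∞ G] {B : Set ℝ} (a b : LoopGroup E G B)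
    (θ : ℝ) : (a * b).toFun θ = a.toFun θ * b.toFun θ := rfl

/-- An invariant polynomial of degree `k` on `𝔤`: a symmetric multilinear map `𝔤 × ⋯ × 𝔤 → ℝ` in
`k` variables that is invariant under the adjoint action (continuity is automatic, since `𝔤` is
finite dimensional). -/
structure InvariantPolynomial (k : ℕ) where
  toMap : ContinuousMultilinearMap ℝ (fun _ : Fin k => E) ℝ
  symmetric : ∀ (σ : Equiv.Perm (Fin k)) (v : Fin k → E), toMap (fun i => v (σ i)) = toMap v
  invariant : ∀ (g : G) (v : Fin k → E), toMap (fun i => Ad E g (v i)) = toMap v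

end LieGroupData

/-! ### Loop group bundles -/

/-- A smooth principal bundle `π : Q → M` for the loop group `𝓛 = LoopGroup E G B` over an
`m`-dimensional manifold `M`: a right `𝓛`-space with `𝓛`-equivariant local trivialisations
`q ↦ (π q, coord i q) ∈ U i × 𝓛` over an open cover, any two of which differ by a smooth transition
function `U i ∩ U j → 𝓛` (a map from a manifold to the loop group is smooth when it is smooth
jointly in the point and in the loop parameter `θ`). -/
structure LoopBundle (m : ℕ) (M : Type*) [TopologicalSpace M] [ChartedSpace (Cartesian m) M]
    (E : Type*) [NormedAddCommGroup E] [NormedSpace ℝ E]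
    (G : Type*) [TopologicalSpace G] [ChartedSpace E G] [Group G] [LieGroup 𝓘(ℝ, E) ∞ G]
    (B : Set ℝ) where
  Total : Type*
  proj : Total → M
  act : Total → LoopGroup E G B → Total
  act_one : ∀ q, act q 1 = q
  act_mul : ∀ q γ δ, act (act q γ) δ = act q (γ * δ)
  proj_act : ∀ q γ, proj (act q γ) = proj q
  Index : Type*
  U : Index → Set M
  isOpen_U : ∀ i, IsOpen (U i)
  cover : ∀ x, ∃ i, x ∈ U i
  coord : Index → Total → LoopGroup E G B
  coord_act : ∀ i q γ, proj q ∈ U i → coord i (act q γ) = coord i q * γ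
  bijective : ∀ i, ∀ x ∈ U i, ∀ γ, ∃! q, proj q = x ∧ coord i q = γ
  transition : Index → Index → M → LoopGroup E G B
  coord_transition : ∀ i j q, proj q ∈ U i → proj q ∈ U j →
    coord i q = transition i j (proj q) * coord j q
  smooth_transition : ∀ i j, ContMDiffOn ((𝓡 m).prod 𝓘(ℝ, ℝ)) 𝓘(ℝ, E) ∞
    (fun z : M × ℝ => (transition i j z.1).toFun z.2) ((U i ∩ U j) ×ˢ Set.univ)

namespace LoopBundle

variable {m : ℕ} {M : Type*} [TopologicalSpace M] [ChartedSpace (Cartesian m) M]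
  {E : Type*} [NormedAddCommGroup E] [NormedSpace ℝ E]
  {G : Type*} [TopologicalSpace G] [ChartedSpace E G] [Group G] [LieGroup 𝓘(ℝ, E) ∞ G]
  {B : Set ℝ} (P : LoopBundle m M E G B)

/-- Smoothness on `u ⊆ ℝⁿ` of a map into the total space: the composite with the projection is
smooth, and so is the loop group component in each local trivialisation. -/
def SmoothOn {n : ℕ} (u : Set (Cartesian n)) (p : Cartesian n → P.Total) : Prop :=
  ContMDiffOn (𝓡 n) (𝓡 m) ∞ (fun x => P.proj (p x)) u ∧
  ∀ i, ContMDiffOn ((𝓡 n).prod 𝓘(ℝ, ℝ)) 𝓘(ℝ, E) ∞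
    (fun z : Cartesian n × ℝ => (P.coord i (p z.1)).toFun z.2)
    ((u ∩ (fun x => P.proj (p x)) ⁻¹' P.U i) ×ˢ Set.univ)

/-- The smooth structure of the total space `Q`, given by its plots, the smooth maps `ℝⁿ → Q`.
It is the smooth structure for which the local trivialisations `π⁻¹(U i) ≃ U i × 𝓛` are
diffeomorphisms. -/
instance : DiffeologicalSpace P.Total := DiffeologicalSpace.ofCorePlotsOn
  { isPlotOn := fun {n u} _ p => P.SmoothOn u p
    isPlotOn_congr := by
      have key : ∀ {n : ℕ} {u : Set (Cartesian n)} {p q : Cartesian n → P.Total},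
          Set.EqOn p q u → P.SmoothOn u p → P.SmoothOn u q := by
        intro n u p q h hp
        refine ⟨hp.1.congr fun x hx => by simp only [h hx], fun i => ?_⟩
        refine ((hp.2 i).mono ?_).congr ?_
        · rintro ⟨x, θ⟩ ⟨⟨hx, hx'⟩, -⟩
          refine ⟨⟨hx, ?_⟩, trivial⟩
          simpa [h hx] using hx'
        · rintro ⟨x, θ⟩ ⟨⟨hx, hx'⟩, -⟩
          simp only [h hx]
      intro n u hu p q h
      exact ⟨key h, key h.symm⟩
    isPlot_const := by
      intro n q
      refine ⟨contMDiffOn_const, fun i => ?_⟩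
      exact ((P.coord i q).smooth.comp contMDiff_snd).contMDiffOn
    isPlotOn_reparam := by
      intro n k u v hu hv p f h hp hf
      have hf' : ContMDiffOn (𝓡 k) (𝓡 n) ∞ f v := hf.contMDiffOn
      refine ⟨hp.1.comp hf' h, fun i => ?_⟩
      have hF : ContMDiffOn ((𝓡 k).prod 𝓘(ℝ, ℝ)) ((𝓡 n).prod 𝓘(ℝ, ℝ)) ∞
          (fun z : Cartesian k × ℝ => (f z.1, z.2))
          ((v ∩ (fun x => P.proj ((p ∘ f) x)) ⁻¹' P.U i) ×ˢ Set.univ) :=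
        (hf'.comp contMDiff_fst.contMDiffOn (fun z hz => hz.1.1)).prodMk
          contMDiff_snd.contMDiffOn
      exact (hp.2 i).comp hF (fun z hz => ⟨⟨h hz.1.1, hz.1.2⟩, trivial⟩)
    locality := by
      intro n u hu p hp
      refine ⟨fun x hx => ?_, fun i z hz => ?_⟩
      · obtain ⟨v, hv, hxv, h⟩ := hp x hx
        exact ((h.1 x hxv).contMDiffAt (hv.mem_nhds hxv)).contMDiffWithinAt
      · obtain ⟨v, hv, hxv, h⟩ := hp z.1 hz.1.1
        refine ((h.2 i) z ⟨⟨hxv, hz.1.2⟩, trivial⟩).mono_of_mem_nhdsWithin ?_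
        have hmem : {w : Cartesian n × ℝ | w.1 ∈ v} ∈ nhds z :=
          (hv.preimage continuous_fst).mem_nhds hxv
        filter_upwards [mem_nhdsWithin_of_mem_nhds hmem, self_mem_nhdsWithin] with w hw hw'
        exact ⟨⟨hw, hw'.1.2⟩, trivial⟩ }

open Diffeology

theorem isPlot_iff {n : ℕ} {p : Cartesian n → P.Total} : IsPlot p ↔ P.SmoothOn Set.univ p :=
  Iff.rfl

/-- Smoothness of a map `ℝⁿ → 𝓛`. -/
def SmoothLoops {n : ℕ} (c : Cartesian n → LoopGroup E G B) : Prop :=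
  ContMDiff ((𝓡 n).prod 𝓘(ℝ, ℝ)) 𝓘(ℝ, E) ∞ (fun z : Cartesian n × ℝ => (c z.1).toFun z.2)

theorem isPlot_act {n : ℕ} {p : Cartesian n → P.Total} (hp : IsPlot p)
    {c : Cartesian n → LoopGroup E G B} (hc : SmoothLoops c) :
    IsPlot (fun x => P.act (p x) (c x)) := by
  have hp' := P.isPlot_iff.1 hp
  refine P.isPlot_iff.2 ⟨by simpa only [P.proj_act] using hp'.1, fun i => ?_⟩
  simp only [P.proj_act]
  refine ((hp'.2 i).mul hc.contMDiffOn).congr fun z hz => ?_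
  rw [P.coord_act i _ _ hz.1.2]
  rfl

/-! ### Connections and Higgs fields -/

/-- A connection on the loop group bundle `Q`: a smooth `Lie(𝓛)`-valued `1`-form on `Q` that is
equivariant and reproduces the generators of the fundamental vector fields. The form is given by
its pullbacks to plots `p : ℝⁿ → Q`: `form p _ x θ v` is the value at `θ ∈ S¹` of
`A_{p x}(dp_x v) ∈ Lie(𝓛)`. Here `Lie(𝓛)` consists of the smooth `2π`-periodic maps `ℝ → 𝔤` that
vanish on `B`. -/
@[ext] structure Connection where
  form : ∀ {n : ℕ} (p : Cartesian n → P.Total), IsPlot p →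
    Cartesian n → ℝ → (Cartesian n →L[ℝ] E)
  smooth : ∀ {n : ℕ} (p : Cartesian n → P.Total) (hp : IsPlot p),
    ContDiff ℝ ∞ (fun z : Cartesian n × ℝ => form p hp z.1 z.2)
  periodic : ∀ {n : ℕ} (p : Cartesian n → P.Total) (hp : IsPlot p) (x : Cartesian n),
    Function.Periodic (form p hp x) (2 * Real.pi)
  based : ∀ {n : ℕ} (p : Cartesian n → P.Total) (hp : IsPlot p) (x : Cartesian n),
    ∀ θ ∈ B, form p hp x θ = 0
  /-- compatibility with pullback along smooth maps, `(p ∘ h)^* A = h^* (p^* A)` -/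
  reparam : ∀ {n k : ℕ} (p : Cartesian n → P.Total) (hp : IsPlot p)
    (h : Cartesian k → Cartesian n) (hh : ContDiff ℝ ∞ h) (y : Cartesian k) (θ : ℝ),
    form (p ∘ h) (isPlot_reparam hp hh) y θ = (form p hp (h y) θ).comp (fderiv ℝ h y)
  /-- equivariance, `R_γ^* A = ad(γ⁻¹) A` -/
  equivariant : ∀ {n : ℕ} (p : Cartesian n → P.Total) (hp : IsPlot p) (γ : LoopGroup E G B)
    (x : Cartesian n) (θ : ℝ),
    form (fun y => P.act (p y) γ)
        (P.isPlot_act hp (c := fun _ => γ) (γ.smooth.comp contMDiff_snd)) x θ =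
      (Ad E (γ.toFun θ)⁻¹).comp (form p hp x θ)
  /-- if `c` is smooth with `c(0) = 1`, then `A` maps the velocity at `0` of `q · c` to that
  of `c` -/
  fundamental : ∀ {n : ℕ} (q : P.Total) (c : Cartesian n → LoopGroup E G B) (hc : SmoothLoops c),
    c 0 = 1 → ∀ (θ : ℝ) (v : Cartesian n),
    form (fun y => P.act q (c y)) (P.isPlot_act (p := fun _ => q) isPlot_const hc) 0 θ v =
      (mfderiv (𝓡 n) 𝓘(ℝ, E) (fun y => (c y).toFun θ) 0 v : E)

/-- A Higgs field on the loop group bundle `Q`: a smooth map `Φ : Q → L𝔤` (for based loops as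
well, its values are free loops) with `Φ(qγ) = ad(γ⁻¹) Φ(q) + γ⁻¹ ∂γ`. -/
@[ext] structure HiggsField where
  toFun : P.Total → ℝ → E
  smooth : ∀ {n : ℕ} (p : Cartesian n → P.Total), IsPlot p →
    ContDiff ℝ ∞ (fun z : Cartesian n × ℝ => toFun (p z.1) z.2)
  periodic : ∀ q, Function.Periodic (toFun q) (2 * Real.pi)
  twisted : ∀ (q : P.Total) (γ : LoopGroup E G B) (θ : ℝ),
    toFun (P.act q γ) θ = Ad E (γ.toFun θ)⁻¹ (toFun q θ) + logDerivative E γ.toFun θ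

variable {P}

/-- The curvature `F = dA + ½ [A, A]`, at `θ ∈ S¹`, on the plot `p`, at the point `x` and the
vectors `v`, `w`. -/
def Connection.curvature (A : P.Connection) {n : ℕ} (p : Cartesian n → P.Total) (hp : IsPlot p)
    (x : Cartesian n) (θ : ℝ) (v w : Cartesian n) : E :=
  fderiv ℝ (fun y => A.form p hp y θ) x v w - fderiv ℝ (fun y => A.form p hp y θ) x w v
    + lieBr E G (A.form p hp x θ v) (A.form p hp x θ w)

/-- The Higgs field covariant derivative `∇Φ = dΦ + [A, Φ] - ∂A`, with `∂` the derivative in the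
direction of `S¹`, at `θ ∈ S¹`, on the plot `p`, at the point `x` and the vector `v`. -/
def HiggsField.covDeriv (Φ : P.HiggsField) (A : P.Connection) {n : ℕ}
    (p : Cartesian n → P.Total) (hp : IsPlot p) (x : Cartesian n) (θ : ℝ) (v : Cartesian n) : E :=
  fderiv ℝ (fun y => Φ.toFun (p y) θ) x v + lieBr E G (A.form p hp x θ v) (Φ.toFun (p x) θ)
    - deriv (fun s => A.form p hp x s v) θ

variable (P) in
/-- A smooth path `[0,1] → 𝒜_Q × ℋ_Q`, that is, a family of connections and Higgs fields that is
jointly smooth in the time and in the variables of each plot. (This is the same as a connection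
on `Q × [0,1]` that annihilates `∂_t` and a Higgs field on `Q × [0,1]`.) Only the values at times
in `[0,1]` matter. -/
structure SmoothPath where
  conn : ℝ → P.Connection
  higgs : ℝ → P.HiggsField
  smooth_conn : ∀ {n : ℕ} (p : Cartesian n → P.Total) (hp : IsPlot p),
    ContDiffOn ℝ ∞ (fun z : ℝ × Cartesian n × ℝ => (conn z.1).form p hp z.2.1 z.2.2)
      (Set.Icc 0 1 ×ˢ Set.univ)
  smooth_higgs : ∀ {n : ℕ} (p : Cartesian n → P.Total), IsPlot p →
    ContDiffOn ℝ ∞ (fun z : ℝ × Cartesian n × ℝ => (higgs z.1).toFun (p z.2.1) z.2.2)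
      (Set.Icc 0 1 ×ˢ Set.univ)

/-- The time derivative `B_t` of the connections along a path. -/
def SmoothPath.connDot (γ : P.SmoothPath) {n : ℕ} (p : Cartesian n → P.Total) (hp : IsPlot p)
    (t : ℝ) (x : Cartesian n) (θ : ℝ) : Cartesian n →L[ℝ] E :=
  derivWithin (fun s => (γ.conn s).form p hp x θ) (Set.Icc 0 1) t

/-- The time derivative `φ_t` of the Higgs fields along a path. -/
def SmoothPath.higgsDot (γ : P.SmoothPath) (t : ℝ) (q : P.Total) (θ : ℝ) : E :=
  derivWithin (fun s => (γ.higgs s).toFun q θ) (Set.Icc 0 1) t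

end LoopBundle

/-! ### The string potential -/

section Wedge

variable {E : Type*} [NormedAddCommGroup E] [NormedSpace ℝ E]
  {G : Type*} [TopologicalSpace G] [ChartedSpace E G] [Group G] {V : Type*}

/-- `f(F, …, F, φ)`, with `j` entries `F`, for a `𝔤`-valued `2`-form `F` and `φ ∈ 𝔤`, evaluated at
`2j` vectors; the wedge product of a `p`-form and a `q`-form is normalised with the factor
`1 / (p! q!)`. -/
def wedgeHiggsDot (j : ℕ) (f : InvariantPolynomial E G (j + 1)) (F : V → V → E) (φ : E)
    (v : Fin (2 * j) → V) : ℝ :=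
  (1 / 2 ^ j : ℝ) * ∑ σ : Equiv.Perm (Fin (2 * j)), ((Equiv.Perm.sign σ : ℤ) : ℝ) *
    f.toMap (Fin.snoc (α := fun _ => E)
      (fun i : Fin j => F (v (σ ⟨2 * i, by omega⟩)) (v (σ ⟨2 * i + 1, by omega⟩))) φ)

/-- `f(β, F, …, F, ψ)`, with `j - 1` entries `F`, for `𝔤`-valued `1`-forms `β`, `ψ` and a
`𝔤`-valued `2`-form `F`, evaluated at `2j` vectors (for `j = 0` there is no such term). -/
def wedgeConnDot : (j : ℕ) → (f : InvariantPolynomial E G (j + 1)) → (β : V → E) →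
    (F : V → V → E) → (ψ : V → E) → (v : Fin (2 * j) → V) → ℝ
  | 0, _, _, _, _, _ => 0
  | j + 1, f, β, F, ψ, v =>
    (1 / 2 ^ j : ℝ) * ∑ σ : Equiv.Perm (Fin (2 * (j + 1))), ((Equiv.Perm.sign σ : ℤ) : ℝ) *
      f.toMap (Fin.cons (α := fun _ => E) (β (v (σ ⟨0, by omega⟩)))
        (Fin.snoc (α := fun _ => E)
          (fun i : Fin j => F (v (σ ⟨2 * i + 1, by omega⟩)) (v (σ ⟨2 * i + 2, by omega⟩)))
          (ψ (v (σ ⟨2 * j + 1, by omega⟩)))))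

end Wedge

/-- A smooth differential `d`-form on the manifold `M`: its pullback under the inverse of each
chart is smooth. -/
@[ext] structure DiffForm (m : ℕ) (M : Type*) [TopologicalSpace M]
    [ChartedSpace (Cartesian m) M] (d : ℕ) where
  toFun : ∀ x : M, TangentSpace (𝓡 m) x [⋀^Fin d]→L[ℝ] ℝ
  smooth : ∀ x₀ : M, ContDiffOn ℝ ∞
    (fun y : Cartesian m =>
      ((toFun ((chartAt (Cartesian m) x₀).symm y)).compContinuousLinearMap
        (mfderiv (𝓡 m) (𝓡 m) (chartAt (Cartesian m) x₀).symm y) :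
        Cartesian m [⋀^Fin d]→L[ℝ] ℝ))
    (chartAt (Cartesian m) x₀).target

namespace DiffForm

variable {m : ℕ} {M : Type*} [TopologicalSpace M] [ChartedSpace (Cartesian m) M] {d : ℕ}

/-- The pullback `h^* ρ` to `ℝⁿ`. -/
def pullback (ρ : DiffForm m M d) {n : ℕ} (h : Cartesian n → M) (y : Cartesian n) :
    Cartesian n [⋀^Fin d]→L[ℝ] ℝ :=
  (ρ.toFun (h y)).compContinuousLinearMap (mfderiv (𝓡 n) (𝓡 m) h y)

instance : Zero (DiffForm m M d) where
  zero :=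
    { toFun := fun _ => 0
      smooth := fun _ => contDiffOn_const (c := (0 : Cartesian m [⋀^Fin d]→L[ℝ] ℝ)) }

instance : Sub (DiffForm m M d) where
  sub ρ η :=
    { toFun := fun x => ρ.toFun x - η.toFun x
      smooth := fun x₀ => (ρ.smooth x₀).sub (η.smooth x₀) }

/-- `ρ = dη`, expressed in every chart. -/
def IsExteriorDerivative (ρ : DiffForm m M (d + 1)) (η : DiffForm m M d) : Prop :=
  ∀ x₀ : M, ∀ y ∈ (chartAt (Cartesian m) x₀).target,
    ρ.pullback (chartAt (Cartesian m) x₀).symm y =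
      extDeriv (η.pullback (chartAt (Cartesian m) x₀).symm) y

/-- Exactness: a form of positive degree is exact if it is the exterior derivative of a smooth
form, and a `0`-form is exact only if it vanishes. -/
def IsExact : {d : ℕ} → DiffForm m M d → Prop
  | 0, ρ => ρ = 0
  | _ + 1, ρ => ∃ η, ρ.IsExteriorDerivative η

end DiffForm

namespace LoopBundle

open Diffeology

variable {m : ℕ} {M : Type*} [TopologicalSpace M] [ChartedSpace (Cartesian m) M]
  {E : Type*} [NormedAddCommGroup E] [NormedSpace ℝ E]
  {G : Type*} [TopologicalSpace G] [ChartedSpace E G] [Group G] [LieGroup 𝓘(ℝ, E) ∞ G]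
  {B : Set ℝ} {P : LoopBundle m M E G B}

namespace SmoothPath

/-- The string potential of a path `γ` and an invariant polynomial `f` of degree `k = j + 1`, the
form on `Q` of degree `2k - 2 = 2j`
`S_f(γ) = k ∫₀¹ ∫_{S¹} ((k-1) f(B_t, F_t, …, F_t, ∇Φ_t) + f(F_t, …, F_t, φ_t)) dθ dt`,
on the plot `p`, at the point `x` and the vectors `v`. -/
def stringPotential (γ : P.SmoothPath) {j : ℕ} (f : InvariantPolynomial E G (j + 1))
    {n : ℕ} (p : Cartesian n → P.Total) (hp : IsPlot p) (x : Cartesian n)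
    (v : Fin (2 * j) → Cartesian n) : ℝ :=
  ((j : ℝ) + 1) * ∫ t in (0 : ℝ)..1, ∫ θ in (0 : ℝ)..(2 * Real.pi),
    ((j : ℝ) * wedgeConnDot j f (fun w => γ.connDot p hp t x θ w)
        ((γ.conn t).curvature p hp x θ) ((γ.higgs t).covDeriv (γ.conn t) p hp x θ) v
      + wedgeHiggsDot j f ((γ.conn t).curvature p hp x θ) (γ.higgsDot t (p x) θ) v)

/-- The form `ρ` on `M` is the string potential of `γ`: its pullback `π^* ρ` to the total space
`Q` is `S_f(γ)`. -/
def IsStringPotential (γ : P.SmoothPath) {j : ℕ} (f : InvariantPolynomial E G (j + 1))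
    (ρ : DiffForm m M (2 * j)) : Prop :=
  ∀ {n : ℕ} (p : Cartesian n → P.Total) (hp : IsPlot p) (x : Cartesian n)
    (v : Fin (2 * j) → Cartesian n),
    ρ.pullback (fun y => P.proj (p y)) x v = γ.stringPotential f p hp x v

/-- The string potential of `γ`, as a form on `M`, is exact. -/
def HasExactPotential (γ : P.SmoothPath) {j : ℕ} (f : InvariantPolynomial E G (j + 1)) : Prop :=
  ∃ ρ : DiffForm m M (2 * j), γ.IsStringPotential f ρ ∧ ρ.IsExact

/-- The path `γ` goes from the pair `a` to the pair `b`. -/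
def Joins (γ : P.SmoothPath) (a b : P.Connection × P.HiggsField) : Prop :=
  (γ.conn 0, γ.higgs 0) = a ∧ (γ.conn 1, γ.higgs 1) = b

end SmoothPath

/-- The string potential equivalence relation for a family `f` of invariant polynomials (of
positive degrees): two pairs of a connection and a Higgs field are equivalent if they are joined by
a smooth path all of whose string potentials are exact. An equivalence class is a string datum. -/
def StringEquivalent {ι : Type*} (f : ι → Σ j : ℕ, InvariantPolynomial E G (j + 1))
    (a b : P.Connection × P.HiggsField) : Prop :=
  ∃ γ : P.SmoothPath, γ.Joins a b ∧ ∀ i, γ.HasExactPotential (f i).2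

end LoopBundle

end

/-! The proof turns loop group geometry on `Q` into Chern–Weil theory for `G` on finite-dimensional
spaces (the caloron correspondence), plot by plot. For a plot `p`, a smooth family of pairs `(A, Φ)`
defines the `𝔤`-valued 1-form `a = A + Φ dθ` on `ℝ` times the parameters and the domain of `p`
(`loopForm`). Replacing `p` by `p · c`, with `c` a smooth family of loops, replaces `a` by `ad(c⁻¹)
a + c⁻¹ dc` for the `G`-valued function `c(x)(θ)` (`loopForm_act`): the two axioms of a connection
give the part along the plot, the twisted law of the Higgs field gives the `dθ` part.

Let `K` be the curvature of `a`. The form `f(K, …, K)` is closed by the Bianchi identity and the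
infinitesimal invariance of `f` (`extDeriv_cwForm`). It is natural (`curv_pull`) and gauge invariant
(`curv_gaugeTransform`). Its integral over a period in `θ` is again closed, since the boundary terms
at `0` and `2π` agree. For a one-parameter family a further integration over `t` gives the string
potential up to a constant, because `K(∂_t, ·) = B`, `K(·, ∂_θ) = ∇Φ` and `K(∂_t, ∂_θ) = φ`
(`altSum_polyTensor_eq_wedge`, `stringForm_apply`). So `S_f(γ)` is natural in the plot and unchanged
by loops. Charts of `M` lift locally to plots, and two plots over the same map differ locally by
loops, whence such a form descends to `M` (`BasicForm.descend`).

Everything else follows from one triangle relation. Pairs form an affine space, so paths `γ₁` from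
`a` to `b`, `γ₂` from `b` to `c` and `δ` from `a` to `c` are three sides of a smooth square whose
fourth side is constant at `a`. Stokes' theorem for the closed form on this square shows that `S(δ)
- S(γ₁) - S(γ₂)` is the differential of a basic form, or zero in degree `0` (`isExact_triangle`). A
constant path has potential zero, so suitable triangles give independence of the path, symmetry and
transitivity.

A path is smooth only on `[0,1]`; reparametrising it by `Real.smoothTransition` extends it to all
times without changing its potential. The facts needed about `G` (the Maurer–Cartan equation, the
derivative of `Ad`, the Jacobi identity) are read off from Taylor coefficients of the product in the
chart at `1`. -/

open Filter Topology

set_option linter.unusedSectionVars false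
set_option linter.unusedVariables false

noncomputable section

/-! ### Alternating sums and the insertion of a vector -/

section Alternation

variable {W : Type*}

/-- The alternating sum of a function of `d` vectors over all permutations. -/
def altSum {d : ℕ} (T : (Fin d → W) → ℝ) (v : Fin d → W) : ℝ :=
  ∑ σ : Equiv.Perm (Fin d), ((Equiv.Perm.sign σ : ℤ) : ℝ) * T (fun i => v (σ i))

theorem altSum_smul {d : ℕ} (c : ℝ) (T : (Fin d → W) → ℝ) (v : Fin d → W) :
    altSum (fun w => c * T w) v = c * altSum T v := by
  simp only [altSum, Finset.mul_sum]
  exact Finset.sum_congr rfl fun σ _ => by ring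

theorem altSum_neg {d : ℕ} (T : (Fin d → W) → ℝ) (v : Fin d → W) :
    altSum (fun w => - T w) v = - altSum T v := by
  simpa using altSum_smul (-1) T v

theorem altSum_sum {d : ℕ} {ι : Type*} (s : Finset ι) (T : ι → (Fin d → W) → ℝ) (v : Fin d → W) :
    altSum (fun w => ∑ i ∈ s, T i w) v = ∑ i ∈ s, altSum (T i) v := by
  simp only [altSum, Finset.mul_sum]
  rw [Finset.sum_comm]

theorem altSum_add {d : ℕ} (S T : (Fin d → W) → ℝ) (v : Fin d → W) :
    altSum (fun w => S w + T w) v = altSum S v + altSum T v := by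
  simp only [altSum, mul_add, Finset.sum_add_distrib]

theorem sign_mul_sign_cast {d : ℕ} (σ : Equiv.Perm (Fin d)) :
    ((Equiv.Perm.sign σ : ℤ) : ℝ) * ((Equiv.Perm.sign σ : ℤ) : ℝ) = 1 := by
  rcases Int.units_eq_one_or (Equiv.Perm.sign σ) with h | h <;> simp [h]

theorem altSum_comp_perm {d : ℕ} (τ : Equiv.Perm (Fin d)) (T : (Fin d → W) → ℝ) (v : Fin d → W) :
    altSum (fun w => T (fun i => w (τ i))) v = ((Equiv.Perm.sign τ : ℤ) : ℝ) * altSum T v := by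
  simp only [altSum, Finset.mul_sum]
  refine Fintype.sum_equiv (Equiv.mulRight τ) _ _ fun σ => ?_
  simp only [Equiv.coe_mulRight, Equiv.Perm.coe_mul, Function.comp_apply, Equiv.Perm.sign_mul,
    Units.val_mul, Int.cast_mul]
  linear_combination (-((Equiv.Perm.sign σ : ℤ) : ℝ) * T (fun i => v (σ (τ i)))) *
    sign_mul_sign_cast τ

/-- A permutation of `Fin n`, extended to `Fin (n + 1)` with the fixed point `0`. -/
def liftPerm {n : ℕ} (e : Equiv.Perm (Fin n)) : Equiv.Perm (Fin (n + 1)) :=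
  Equiv.Perm.decomposeFin.symm (0, e)

@[simp] theorem liftPerm_zero {n : ℕ} (e : Equiv.Perm (Fin n)) : liftPerm e 0 = 0 := by
  simp [liftPerm]

@[simp] theorem liftPerm_succ {n : ℕ} (e : Equiv.Perm (Fin n)) (i : Fin n) :
    liftPerm e i.succ = (e i).succ := by
  simp [liftPerm]

@[simp] theorem sign_liftPerm {n : ℕ} (e : Equiv.Perm (Fin n)) :
    Equiv.Perm.sign (liftPerm e) = Equiv.Perm.sign e := by
  simp [liftPerm, Equiv.Perm.decomposeFin.symm_sign]

theorem liftPerm_injective {n : ℕ} : Function.Injective (liftPerm (n := n)) := by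
  intro e e' h
  have := Equiv.Perm.decomposeFin.symm.injective h
  simpa using this

theorem cons_liftPerm {n : ℕ} (u : W) (v : Fin n → W) (e : Equiv.Perm (Fin n)) :
    (fun i => (Fin.cons u v : Fin (n + 1) → W) (liftPerm e i)) =
      (Fin.cons u (fun i => v (e i)) : Fin (n + 1) → W) := by
  funext i
  refine Fin.cases ?_ (fun i => ?_) i <;> simp

/-- Coset decomposition with respect to the stabiliser of `0`: a permutation `σ` is `τ i * liftPerm
e` with `i = σ 0`, for any choice of representatives `τ i`. -/
theorem sum_perm_left {n : ℕ} (τ : Fin (n + 1) → Equiv.Perm (Fin (n + 1))) (hτ : ∀ i, τ i 0 = i)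
    (F : Equiv.Perm (Fin (n + 1)) → ℝ) :
    ∑ σ, F σ = ∑ i, ∑ e : Equiv.Perm (Fin n), F (τ i * liftPerm e) := by
  rw [← Fintype.sum_prod_type']
  symm
  refine Fintype.sum_bijective (fun p : Fin (n + 1) × Equiv.Perm (Fin n) => τ p.1 * liftPerm p.2)
    ((Fintype.bijective_iff_injective_and_card _).2 ⟨?_, ?_⟩) _ _ fun _ => rfl
  · rintro ⟨i, e⟩ ⟨i', e'⟩ h
    have h0 := congrArg (fun σ : Equiv.Perm (Fin (n + 1)) => σ 0) h
    simp only [Equiv.Perm.coe_mul, Function.comp_apply, liftPerm_zero, hτ] at h0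
    subst h0
    simp only [mul_right_inj] at h
    rw [liftPerm_injective h]
  · simp [Fintype.card_perm, Nat.factorial_succ]

/-- The representatives are the inverse cycles `cycleRange`, of sign `(-1)^i`. This is the shape of
the formula for the exterior derivative, to which it is matched when Chern–Weil forms are shown to
be closed. -/
theorem altSum_succ {n : ℕ} (T : (Fin (n + 1) → W) → ℝ) (v : Fin (n + 1) → W) :
    altSum T v = ∑ i : Fin (n + 1), (-1 : ℝ) ^ (i : ℕ) *
      altSum (fun w => T (Fin.cons (v i) w)) (i.removeNth v) := by
  rw [altSum, sum_perm_left (fun i => i.cycleRange.symm) (fun i => by simp)]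
  refine Finset.sum_congr rfl fun i _ => ?_
  rw [altSum, Finset.mul_sum]
  refine Finset.sum_congr rfl fun e _ => ?_
  have h1 : (fun j => v ((i.cycleRange.symm * liftPerm e) j)) =
      (Fin.cons (v i) (fun j => i.removeNth v (e j)) : Fin (n + 1) → W) := by
    funext j
    refine Fin.cases ?_ (fun j => ?_) j <;> simp [Fin.removeNth]
  rw [h1, Equiv.Perm.sign_mul, sign_liftPerm, Equiv.Perm.sign_symm, Fin.sign_cycleRange]
  push_cast
  ring

/-- Here the terms are grouped by the slot of `T` that receives `u`. That slot is `σ⁻¹ 0`, which is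
why the sum is first reindexed by inversion. -/
theorem altSum_cons {n : ℕ} (τ : Fin (n + 1) → Equiv.Perm (Fin (n + 1))) (hτ : ∀ i, τ i 0 = i)
    (T : (Fin (n + 1) → W) → ℝ) (u : W) (v : Fin n → W) :
    altSum T (Fin.cons u v) = ∑ i, ((Equiv.Perm.sign (τ i) : ℤ) : ℝ) *
      altSum (fun w => T (fun p => (Fin.cons u w : Fin (n + 1) → W) ((τ i).symm p))) v := by
  rw [altSum, ← Equiv.sum_comp (Equiv.inv _), sum_perm_left τ hτ]
  refine Finset.sum_congr rfl fun i _ => ?_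
  rw [altSum, Finset.mul_sum, ← Equiv.sum_comp (Equiv.inv _)]
  refine Finset.sum_congr rfl fun e _ => ?_
  have h0 : ∀ e : Equiv.Perm (Fin n), (liftPerm e)⁻¹ = liftPerm e⁻¹ := by
    intro e
    rw [inv_eq_iff_mul_eq_one]
    ext p
    refine Fin.cases ?_ (fun j => ?_) p <;> simp
  have h1 : (fun p => (Fin.cons u v : Fin (n + 1) → W) ((Equiv.inv _ (τ i * liftPerm (Equiv.inv _ e))) p)) =
      (fun p => (Fin.cons u (fun j => v (e j)) : Fin (n + 1) → W) ((τ i).symm p)) := by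
    funext p
    rw [← cons_liftPerm]
    simp [h0]
  rw [h1]
  simp
  ring

/-- When the permutations under which `T` changes by their sign act transitively on the slots, every
slot for `u` contributes the same as slot `0`. -/
theorem altSum_cons_of_transitive {n : ℕ} (T : (Fin (n + 1) → W) → ℝ)
    (hT : ∀ i, ∃ τ : Equiv.Perm (Fin (n + 1)), τ 0 = i ∧
      ∀ w : Fin (n + 1) → W, T (fun p => w (τ p)) = ((Equiv.Perm.sign τ : ℤ) : ℝ) * T w)
    (u : W) (v : Fin n → W) :
    altSum T (Fin.cons u v) = ((n : ℝ) + 1) * altSum (fun w => T (Fin.cons u w)) v := by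
  choose τ hτ h using hT
  rw [altSum_cons τ hτ]
  have : ∀ i, ((Equiv.Perm.sign (τ i) : ℤ) : ℝ) *
      altSum (fun w => T (fun p => (Fin.cons u w : Fin (n + 1) → W) ((τ i).symm p))) v =
      altSum (fun w => T (Fin.cons u w)) v := by
    intro i
    rw [← altSum_smul]
    congr 1
    funext w
    rw [← h]
    simp
  simp [this]

/-- Variant with a distinguished slot `0`: the other `n` slots are all equivalent to the last one.
The rotation that carries the last slot to `0` has sign `(-1)^n`, so the evenness of `n` removes a
sign. -/
theorem altSum_cons_of_transitive_last {n : ℕ} (hn : Even n) (T : (Fin (n + 1) → W) → ℝ)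
    (hT : ∀ i : Fin (n + 1), i ≠ 0 → ∃ τ : Equiv.Perm (Fin (n + 1)), τ (Fin.last n) = i ∧
      ∀ w : Fin (n + 1) → W, T (fun p => w (τ p)) = ((Equiv.Perm.sign τ : ℤ) : ℝ) * T w)
    (u : W) (v : Fin n → W) :
    altSum T (Fin.cons u v) = altSum (fun w => T (Fin.cons u w)) v +
      (n : ℝ) * altSum (fun w => T (Fin.snoc (α := fun _ => W) w u)) v := by
  have hT' : ∀ i : Fin n, ∃ τ : Equiv.Perm (Fin (n + 1)), τ (Fin.last n) = i.succ ∧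
      ∀ w : Fin (n + 1) → W, T (fun p => w (τ p)) = ((Equiv.Perm.sign τ : ℤ) : ℝ) * T w :=
    fun i => hT i.succ (Fin.succ_ne_zero i)
  choose τ hτ h using hT'
  have hrot : (finRotate (n + 1)) (Fin.last n) = 0 := finRotate_last
  rw [altSum_cons (fun i => Fin.cases 1 (fun i => τ i * (finRotate (n + 1))⁻¹) i), Fin.sum_univ_succ]
  · have : ∀ i, ((Equiv.Perm.sign (τ i * (finRotate (n + 1))⁻¹) : ℤ) : ℝ) *
        altSum (fun w => T (fun p => (Fin.cons u w : Fin (n + 1) → W)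
          ((τ i * (finRotate (n + 1))⁻¹).symm p))) v =
        altSum (fun w => T (Fin.snoc (α := fun _ => W) w u)) v := by
      intro i
      rw [← altSum_smul]
      congr 1
      funext w
      rw [Equiv.Perm.sign_mul, Equiv.Perm.sign_inv, sign_finRotate,
        Nat.add_sub_cancel, hn.neg_one_pow, mul_one, ← h]
      congr 1
      rw [Fin.snoc_eq_cons_rotate]
      funext p
      change (Fin.cons u w : Fin (n + 1) → W) ((τ i * (finRotate (n + 1))⁻¹)⁻¹ (τ i p)) = _
      simp
    simp only [Fin.cases_zero, Fin.cases_succ, this]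
    simp
    rfl
  · intro i
    refine Fin.cases rfl (fun i => ?_) i
    simp only [Fin.cases_succ, Equiv.Perm.coe_mul, Function.comp_apply]
    rw [Equiv.Perm.inv_eq_iff_eq.2 hrot.symm, hτ]

/-! ### Symmetries of a product of two-forms -/

section Blocks

variable {n : ℕ} {ι E X : Type*} [DecidableEq ι] [AddCommGroup E]
  {l r : ι → Fin n} {q : (Fin n → W) → X} {g : X → (ι → E) → ℝ} {F : W → W → E}

/-- The slots `l i`, `r i` form the block of the `i`-th factor `F`, and `q` collects what depends on
the remaining slots. Exchanging two blocks is an even permutation and `g` is symmetric; exchanging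
the slots within a block is odd and `F` is antisymmetric. These moves connect any two slots that lie
in blocks. -/
theorem exists_perm_of_blocks (hl : Function.Injective l) (hr : Function.Injective r)
    (hlr : ∀ i j, l i ≠ r j)
    (hq : ∀ (w : Fin n → W) (τ : Equiv.Perm (Fin n)),
      (∀ p, (∀ i, p ≠ l i ∧ p ≠ r i) → τ p = p) → q (fun i => w (τ i)) = q w)
    (hsymm : ∀ x (σ : Equiv.Perm ι) e, g x (fun i => e (σ i)) = g x e)
    (hneg : ∀ x a e, g x (Function.update e a (-e a)) = - g x e)
    (hF : ∀ u v, F u v = - F v u) {p p' : Fin n} (hp : ∃ a, p = l a ∨ p = r a)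
    (hp' : ∃ b, p' = l b ∨ p' = r b) :
    ∃ τ : Equiv.Perm (Fin n), τ p = p' ∧ ∀ w : Fin n → W,
      g (q fun i => w (τ i)) (fun i => F (w (τ (l i))) (w (τ (r i)))) =
        ((Equiv.Perm.sign τ : ℤ) : ℝ) * g (q w) (fun i => F (w (l i)) (w (r i))) := by
  let Good : Equiv.Perm (Fin n) → Prop := fun τ => ∀ w : Fin n → W,
      g (q fun i => w (τ i)) (fun i => F (w (τ (l i))) (w (τ (r i)))) =
        ((Equiv.Perm.sign τ : ℤ) : ℝ) * g (q w) (fun i => F (w (l i)) (w (r i)))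
  have hmul : ∀ σ τ, Good σ → Good τ → Good (σ * τ) := by
    intro σ τ hσ hτ w
    have := hτ (fun i => w (σ i))
    simp only [Equiv.Perm.coe_mul, Function.comp_apply, Equiv.Perm.sign_mul, Units.val_mul,
      Int.cast_mul]
    rw [this, hσ w]
    ring
  have hswap : ∀ a b, ∃ τ, Good τ ∧ τ (l a) = l b ∧ τ (r a) = r b := by
    intro a b
    by_cases hab : a = b
    · subst hab
      exact ⟨1, fun w => by simp, rfl, rfl⟩
    have e1 : ∀ i, (Equiv.swap (l a) (l b) * Equiv.swap (r a) (r b)) (l i) = l (Equiv.swap a b i) := by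
      intro i
      rw [Equiv.Perm.mul_apply, Equiv.swap_apply_of_ne_of_ne (hlr _ _) (hlr _ _), hl.swap_apply]
    have e2 : ∀ i, (Equiv.swap (l a) (l b) * Equiv.swap (r a) (r b)) (r i) = r (Equiv.swap a b i) := by
      intro i
      rw [Equiv.Perm.mul_apply, hr.swap_apply,
        Equiv.swap_apply_of_ne_of_ne (hlr _ _).symm (hlr _ _).symm]
    refine ⟨Equiv.swap (l a) (l b) * Equiv.swap (r a) (r b), fun w => ?_, ?_, ?_⟩
    · simp only [e1, e2]
      rw [hq w _ fun p hp => by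
        rw [Equiv.Perm.mul_apply, Equiv.swap_apply_of_ne_of_ne (hp a).2 (hp b).2,
          Equiv.swap_apply_of_ne_of_ne (hp a).1 (hp b).1]]
      rw [hsymm (q w) (Equiv.swap a b) (fun i => F (w (l i)) (w (r i)))]
      simp [Equiv.Perm.sign_swap (hl.ne hab), Equiv.Perm.sign_swap (hr.ne hab)]
    · rw [e1, Equiv.swap_apply_left]
    · rw [e2, Equiv.swap_apply_left]
  have hflip : ∀ a, Good (Equiv.swap (l a) (r a)) := by
    intro a w
    rw [hq w _ fun p hp => Equiv.swap_apply_of_ne_of_ne (hp a).1 (hp a).2,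
      Equiv.Perm.sign_swap (hlr a a)]
    have : (fun i => F (w (Equiv.swap (l a) (r a) (l i))) (w (Equiv.swap (l a) (r a) (r i)))) =
        Function.update (fun i => F (w (l i)) (w (r i))) a (- F (w (l a)) (w (r a))) := by
      funext i
      by_cases h : i = a
      · subst h
        simp [hF (w (r i))]
      · rw [Function.update_of_ne h, Equiv.swap_apply_of_ne_of_ne (hl.ne h) (hlr _ _),
          Equiv.swap_apply_of_ne_of_ne (hlr _ _).symm (hr.ne h)]
    rw [this, hneg (q w) a (fun i => F (w (l i)) (w (r i)))]
    simp
  obtain ⟨a, ha⟩ := hp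
  obtain ⟨b, hb⟩ := hp'
  obtain ⟨τ, h1, h2, h3⟩ := hswap a b
  rcases ha with rfl | rfl <;> rcases hb with rfl | rfl
  · exact ⟨τ, h2, h1⟩
  · exact ⟨Equiv.swap (l b) (r b) * τ, by simp [h2], hmul _ _ (hflip b) h1⟩
  · exact ⟨Equiv.swap (l b) (r b) * τ, by simp [h3], hmul _ _ (hflip b) h1⟩
  · exact ⟨τ, h3, h1⟩

end Blocks

/-! ### Contraction of `f(F, …, F)` with two vectors -/

section Contraction

variable {E : Type*} [NormedAddCommGroup E] [NormedSpace ℝ E]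
  {G : Type*} [TopologicalSpace G] [ChartedSpace E G] [Group G]

theorem InvariantPolynomial.map_update_neg {k : ℕ} (f : InvariantPolynomial E G k) (a : Fin k)
    (e : Fin k → E) : f.toMap (Function.update e a (- e a)) = - f.toMap e := by
  have := f.toMap.map_update_smul e a (-1) (e a)
  simpa using this

/-- `f(F, …, F)`, without alternation. -/
def polyTensor {k : ℕ} (f : InvariantPolynomial E G k) (F : W → W → E) (w : Fin (2 * k) → W) : ℝ :=
  f.toMap (fun i => F (w ⟨2 * i, by omega⟩) (w ⟨2 * i + 1, by omega⟩))

/-- All `2j + 2` slots are equivalent, so `u` may be placed in the first one. -/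
theorem altSum_polyTensor_cons {j : ℕ} (f : InvariantPolynomial E G (j + 1)) {F : W → W → E}
    (hF : ∀ u v, F u v = - F v u) (u : W) (v : Fin (2 * j + 1) → W) :
    altSum (d := 2 * j + 1 + 1) (polyTensor f F) (Fin.cons u v) =
      2 * ((j : ℝ) + 1) * altSum (fun w : Fin (2 * j + 1) → W => f.toMap (Fin.cons (F u (w 0))
        (fun i : Fin j => F (w ⟨2 * i + 1, by omega⟩) (w ⟨2 * i + 2, by omega⟩)) :
          Fin (j + 1) → E)) v := by
  rw [altSum_cons_of_transitive (n := 2 * j + 1) (polyTensor f F)]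
  · have : (((2 * j + 1 : ℕ) : ℝ) + 1) = 2 * ((j : ℝ) + 1) := by push_cast; ring
    rw [this]
    congr 2
    funext w
    rw [polyTensor]
    congr 1
    funext i
    refine Fin.cases ?_ (fun i => ?_) i
    · rfl
    · rfl
  · intro p
    obtain ⟨τ, h1, h2⟩ := exists_perm_of_blocks (n := 2 * j + 1 + 1) (ι := Fin (j + 1)) (X := Unit)
      (l := fun i => ⟨2 * i, by omega⟩) (r := fun i => ⟨2 * i + 1, by omega⟩)
      (q := fun _ : Fin (2 * j + 1 + 1) → W => ()) (g := fun _ e => f.toMap e) (F := F)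
      (fun a b h => by simpa [Fin.ext_iff] using h) (fun a b h => by simpa [Fin.ext_iff] using h)
      (fun a b h => by simp only [Fin.mk.injEq] at h; omega) (fun _ _ _ => rfl)
      (fun _ σ e => f.symmetric σ e) (fun _ a e => f.map_update_neg a e) hF (p := 0) (p' := p)
      ⟨0, Or.inl rfl⟩ (by
        rcases Nat.even_or_odd' (p : ℕ) with ⟨c, hc | hc⟩
        · exact ⟨⟨c, by omega⟩, Or.inl (Fin.ext hc)⟩
        · exact ⟨⟨c, by omega⟩, Or.inr (Fin.ext hc)⟩)
    exact ⟨τ, h1, h2⟩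

theorem InvariantPolynomial.map_cons_perm {j : ℕ} (f : InvariantPolynomial E G (j + 1)) (x : E)
    (e : Fin j → E) (σ : Equiv.Perm (Fin j)) :
    f.toMap (Fin.cons x (fun i => e (σ i)) : Fin (j + 1) → E) =
      f.toMap (Fin.cons x e : Fin (j + 1) → E) := by
  rw [← cons_liftPerm, f.symmetric]

theorem InvariantPolynomial.map_cons_eq_snoc {j : ℕ} (f : InvariantPolynomial E G (j + 1)) (x : E)
    (e : Fin j → E) :
    f.toMap (Fin.cons x e : Fin (j + 1) → E) = f.toMap (Fin.snoc (α := fun _ => E) e x) := by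
  rw [Fin.snoc_eq_cons_rotate, f.symmetric]

/-- The second vector either joins `u` in its block, which gives `F u u'`, or lands in one of the
`2j` slots of the other blocks, all equivalent to the last one. -/
theorem altSum_polyTensor_cons_cons {j : ℕ} (f : InvariantPolynomial E G (j + 1)) {F : W → W → E}
    (hF : ∀ u v, F u v = - F v u) (u u' : W) (v : Fin (2 * j) → W) :
    altSum (fun w : Fin (2 * j + 1) → W => f.toMap (Fin.cons (F u (w 0))
        (fun i : Fin j => F (w ⟨2 * i + 1, by omega⟩) (w ⟨2 * i + 2, by omega⟩)) :
          Fin (j + 1) → E)) (Fin.cons u' v) =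
      altSum (fun w : Fin (2 * j) → W => f.toMap (Fin.snoc (α := fun _ => E)
        (fun i : Fin j => F (w ⟨2 * i, by omega⟩) (w ⟨2 * i + 1, by omega⟩)) (F u u'))) v +
      2 * j * altSum (fun w : Fin (2 * j) → W => f.toMap (Fin.cons
        (F u ((Fin.snoc w u' : Fin (2 * j + 1) → W) 0))
        (fun i : Fin j => F ((Fin.snoc w u' : Fin (2 * j + 1) → W) ⟨2 * i + 1, by omega⟩)
          ((Fin.snoc w u' : Fin (2 * j + 1) → W) ⟨2 * i + 2, by omega⟩)) : Fin (j + 1) → E)) v := by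
  rw [altSum_cons_of_transitive_last (n := 2 * j) (even_two_mul j)]
  · congr 1
    · congr 1
      funext w
      rw [f.map_cons_eq_snoc]
      rfl
    · push_cast
      rfl
  · intro p hp
    have h0 : (p : ℕ) ≠ 0 := fun h => hp (Fin.ext h)
    obtain ⟨τ, h1, h2⟩ := exists_perm_of_blocks (n := 2 * j + 1) (ι := Fin j) (X := W)
      (l := fun i => ⟨2 * i + 1, by omega⟩) (r := fun i => ⟨2 * i + 2, by omega⟩)
      (q := fun w : Fin (2 * j + 1) → W => w 0)
      (g := fun x e => f.toMap (Fin.cons (F u x) e : Fin (j + 1) → E)) (F := F)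
      (fun a b h => by simpa [Fin.ext_iff] using h) (fun a b h => by simpa [Fin.ext_iff] using h)
      (fun a b h => by simp only [Fin.mk.injEq] at h; omega)
      (fun w τ h => by
        change w (τ 0) = w 0
        rw [h 0 fun i => ⟨fun h => by simp [Fin.ext_iff] at h, fun h => by simp [Fin.ext_iff] at h⟩])
      (fun x σ e => f.map_cons_perm _ e σ) (fun x a e => by
        have := f.map_update_neg a.succ (Fin.cons (F u x) e : Fin (j + 1) → E)
        rwa [Fin.cons_succ, ← Fin.cons_update] at this) hF (p := Fin.last (2 * j)) (p' := p)
      ⟨⟨j - 1, by omega⟩, Or.inr (Fin.ext (by simp; omega))⟩ (by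
        rcases Nat.even_or_odd' (p : ℕ) with ⟨c, hc | hc⟩
        · exact ⟨⟨c - 1, by omega⟩, Or.inr (Fin.ext (by simp; omega))⟩
        · exact ⟨⟨c, by omega⟩, Or.inl (Fin.ext hc)⟩)
    exact ⟨τ, h1, h2⟩

/-- Turning `F(u, ·)` and `F(·, u')` around costs two signs, which cancel. The remaining sign comes
from exchanging the two free vectors that are paired with `u` and `u'`. -/
theorem altSum_snoc_eq_wedgeConnDot {j : ℕ} (f : InvariantPolynomial E G (j + 1)) {F : W → W → E}
    (hF : ∀ u v, F u v = - F v u) (u u' : W) (v : Fin (2 * j) → W) :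
    2 * (j : ℝ) * altSum (fun w : Fin (2 * j) → W => f.toMap (Fin.cons
        (F u ((Fin.snoc w u' : Fin (2 * j + 1) → W) 0))
        (fun i : Fin j => F ((Fin.snoc w u' : Fin (2 * j + 1) → W) ⟨2 * i + 1, by omega⟩)
          ((Fin.snoc w u' : Fin (2 * j + 1) → W) ⟨2 * i + 2, by omega⟩)) : Fin (j + 1) → E)) v =
      - (2 ^ j * ((j : ℝ) * wedgeConnDot j f (fun x => F u' x) F (fun x => F x u) v)) := by
  cases j with
  | zero => simp
  | succ j =>
    let e : Equiv.Perm (Fin (2 * (j + 1))) := Equiv.swap ⟨0, by omega⟩ ⟨2 * j + 1, by omega⟩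
    have hw : wedgeConnDot (j + 1) f (fun x => F u' x) F (fun x => F x u) v = 1 / 2 ^ j *
      altSum (fun w : Fin (2 * (j + 1)) → W => f.toMap (Fin.cons (α := fun _ => E) (F u' (w ⟨0, by omega⟩))
        (Fin.snoc (α := fun _ => E)
          (fun i : Fin j => F (w ⟨2 * i + 1, by omega⟩) (w ⟨2 * i + 2, by omega⟩))
          (F (w ⟨2 * j + 1, by omega⟩) u)))) v := rfl
    have key : altSum (fun w : Fin (2 * (j + 1)) → W => f.toMap (Fin.cons
        (F u ((Fin.snoc w u' : Fin (2 * (j + 1) + 1) → W) 0))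
        (fun i : Fin (j + 1) => F ((Fin.snoc w u' : Fin (2 * (j + 1) + 1) → W) ⟨2 * i + 1, by omega⟩)
          ((Fin.snoc w u' : Fin (2 * (j + 1) + 1) → W) ⟨2 * i + 2, by omega⟩)) : Fin (j + 1 + 1) → E)) v =
      - altSum (fun w : Fin (2 * (j + 1)) → W => f.toMap (Fin.cons (α := fun _ => E) (F u' (w ⟨0, by omega⟩))
        (Fin.snoc (α := fun _ => E)
          (fun i : Fin j => F (w ⟨2 * i + 1, by omega⟩) (w ⟨2 * i + 2, by omega⟩))
          (F (w ⟨2 * j + 1, by omega⟩) u)))) v := by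
      have hs : ((Equiv.Perm.sign e : ℤ) : ℝ) = -1 := by
        rw [Equiv.Perm.sign_swap (by simp [Fin.ext_iff])]; simp
      rw [← neg_one_mul, ← hs, ← altSum_comp_perm e]
      congr 1
      funext w
      rw [← f.symmetric (Equiv.swap 0 (Fin.last (j + 1)))]
      have hl : (Fin.last (j + 1)) ≠ 0 := by simp [Fin.ext_iff]
      -- Changing the sign of two entries does not change the value of `f`.
      have h2 : ∀ X Y : Fin (j + 1 + 1) → E, Y 0 = - X 0 → Y (Fin.last (j + 1)) = - X (Fin.last (j + 1)) →
          (∀ i : Fin j, Y i.castSucc.succ = X i.castSucc.succ) → f.toMap Y = f.toMap X := by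
        intro X Y h0 h1 hi
        have : Y = Function.update (Function.update X 0 (- X 0)) (Fin.last (j + 1))
            (- (Function.update X 0 (- X 0)) (Fin.last (j + 1))) := by
          funext i
          refine Fin.cases ?_ (fun i => Fin.lastCases ?_ (fun i => ?_) i) i
          · rw [Function.update_of_ne hl.symm, Function.update_self, h0]
          · rw [Fin.succ_last, Function.update_self, Function.update_of_ne hl, h1]
          · have h3 : i.castSucc.succ ≠ Fin.last (j + 1) := by
              simp only [ne_eq, Fin.ext_iff, Fin.val_succ, Fin.val_castSucc, Fin.val_last]; omega
            rw [Function.update_of_ne h3, Function.update_of_ne (Fin.succ_ne_zero _), hi]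
        rw [this, f.map_update_neg, f.map_update_neg, neg_neg]
      have e0 : e ⟨0, by omega⟩ = ⟨2 * j + 1, by omega⟩ := Equiv.swap_apply_left _ _
      have e1 : e ⟨2 * j + 1, by omega⟩ = ⟨0, by omega⟩ := Equiv.swap_apply_right _ _
      have sn : ∀ (i : ℕ) (hi : i < 2 * (j + 1)),
          (Fin.snoc w u' : Fin (2 * (j + 1) + 1) → W) ⟨i, by omega⟩ = w ⟨i, hi⟩ := fun i hi =>
        Fin.snoc_castSucc (α := fun _ => W) u' w ⟨i, hi⟩
      apply h2
      · rw [Equiv.swap_apply_left, ← Fin.succ_last, Fin.cons_succ, Fin.cons_zero]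
        beta_reduce
        rw [e0, ← hF]
        congr 1
        · exact sn (2 * j + 1) (by omega)
        · exact Fin.snoc_last (α := fun _ => W) u' w
      · rw [Equiv.swap_apply_right, Fin.cons_zero, ← Fin.succ_last, Fin.cons_succ, Fin.snoc_last]
        beta_reduce
        rw [e1, ← hF]
        congr 1
      · intro i
        have h3 : i.castSucc.succ ≠ Fin.last (j + 1) := by
          simp only [ne_eq, Fin.ext_iff, Fin.val_succ, Fin.val_castSucc, Fin.val_last]; omega
        rw [Equiv.swap_apply_of_ne_of_ne (Fin.succ_ne_zero _) h3, Fin.cons_succ, Fin.cons_succ,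
          Fin.snoc_castSucc]
        have e2 : ∀ (p : ℕ) (hp : p < 2 * (j + 1)), p ≠ 0 → p ≠ 2 * j + 1 →
            e ⟨p, hp⟩ = ⟨p, hp⟩ := fun p hp h0 h1 =>
          Equiv.swap_apply_of_ne_of_ne (by simpa [Fin.ext_iff] using h0)
            (by simpa [Fin.ext_iff] using h1)
        have := i.isLt
        beta_reduce
        rw [e2 (2 * i + 1) (by omega) (by omega) (by omega),
          e2 (2 * i + 2) (by omega) (by omega) (by omega)]
        congr 1
        · exact sn _ _
        · exact sn _ _
    rw [hw, key]
    push_cast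
    field_simp
    ring

theorem wedgeHiggsDot_eq_altSum {j : ℕ} (f : InvariantPolynomial E G (j + 1)) (F : W → W → E)
    (φ : E) (v : Fin (2 * j) → W) :
    wedgeHiggsDot j f F φ v = 1 / 2 ^ j *
      altSum (fun w : Fin (2 * j) → W => f.toMap (Fin.snoc (α := fun _ => E)
        (fun i : Fin j => F (w ⟨2 * i, by omega⟩) (w ⟨2 * i + 1, by omega⟩)) φ)) v := rfl

theorem wedgeHiggsDot_neg {j : ℕ} (f : InvariantPolynomial E G (j + 1)) (F : W → W → E)
    (φ : E) (v : Fin (2 * j) → W) :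
    wedgeHiggsDot j f F (-φ) v = - wedgeHiggsDot j f F φ v := by
  rw [wedgeHiggsDot_eq_altSum, wedgeHiggsDot_eq_altSum, ← mul_neg, ← altSum_neg]
  congr 2
  funext w
  have := f.map_update_neg (Fin.last j) (Fin.snoc (α := fun _ => E)
        (fun i : Fin j => F (w ⟨2 * i, by omega⟩) (w ⟨2 * i + 1, by omega⟩)) φ)
  rwa [Fin.snoc_last, Fin.update_snoc_last] at this

/-- With `u = ∂_θ` and `u' = ∂_t` the bracket on the right is the integrand of the string potential.
The power of `2` compares the full alternating sum with the normalisation by `1/(p! q!)`; the sign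
reflects the order of `∂_θ` and `∂_t`. -/
theorem altSum_polyTensor_eq_wedge {j : ℕ} (f : InvariantPolynomial E G (j + 1)) {F : W → W → E}
    (hF : ∀ u v, F u v = - F v u) (u u' : W) (v : Fin (2 * j) → W) :
    altSum (d := 2 * j + 1 + 1) (polyTensor f F) (Fin.cons u (Fin.cons u' v : Fin (2 * j + 1) → W)) =
      - (2 ^ (j + 1) * (((j : ℝ) + 1) * ((j : ℝ) * wedgeConnDot j f (fun x => F u' x) F (fun x => F x u) v
        + wedgeHiggsDot j f F (F u' u) v))) := by
  rw [altSum_polyTensor_cons f hF, altSum_polyTensor_cons_cons f hF,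
    altSum_snoc_eq_wedgeConnDot f hF, hF u' u, wedgeHiggsDot_neg, wedgeHiggsDot_eq_altSum]
  field_simp
  ring

theorem wedgeHiggsDot_comp {V : Type*} {j : ℕ} (f : InvariantPolynomial E G (j + 1))
    (F : W → W → E) (φ : E) (L : V → W) (v : Fin (2 * j) → V) :
    wedgeHiggsDot j f F φ (fun i => L (v i)) = wedgeHiggsDot j f (fun x y => F (L x) (L y)) φ v := rfl

theorem wedgeConnDot_comp {V : Type*} {j : ℕ} (f : InvariantPolynomial E G (j + 1)) (β ψ : W → E)
    (F : W → W → E) (L : V → W) (v : Fin (2 * j) → V) :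
    wedgeConnDot j f β F ψ (fun i => L (v i)) =
      wedgeConnDot j f (fun x => β (L x)) (fun x y => F (L x) (L y)) (fun x => ψ (L x)) v := by
  cases j <;> rfl

end Contraction

end Alternation

/-! ### Calculus on a Lie group in the chart at the identity -/

section LieCalculus

variable {E : Type*} [NormedAddCommGroup E] [NormedSpace ℝ E]
  {G : Type*} [TopologicalSpace G] [ChartedSpace E G]
  {W : Type*} [NormedAddCommGroup W] [NormedSpace ℝ W]

variable (E) in
/-- The preferred chart at `1`. -/
def oneChart [One G] (g : G) : E := extChartAt 𝓘(ℝ, E) (1 : G) g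

variable (G) in
/-- The inverse of the preferred chart at `1`. -/
def oneChartSymm [One G] (x : E) : G := (extChartAt 𝓘(ℝ, E) (1 : G)).symm x

variable (E G) in
/-- The coordinates of `1`. -/
def oneCoord [One G] : E := oneChart E (1 : G)

section One
variable [One G]

@[simp] theorem oneChartSymm_oneCoord : oneChartSymm G (oneCoord E G) = 1 :=
  extChartAt_to_inv (I := 𝓘(ℝ, E)) (1 : G)

theorem eventually_oneChartSymm_oneChart : ∀ᶠ g in 𝓝 (1 : G), oneChartSymm G (oneChart E g) = g := by
  filter_upwards [extChartAt_source_mem_nhds (I := 𝓘(ℝ, E)) (1 : G)] with g hg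
  exact (extChartAt 𝓘(ℝ, E) (1 : G)).left_inv hg

theorem eventually_oneChart_oneChartSymm :
    ∀ᶠ x in 𝓝 (oneCoord E G), oneChart E (oneChartSymm G x) = x := by
  filter_upwards [extChartAt_target_mem_nhds (I := 𝓘(ℝ, E)) (1 : G)] with x hx
  exact (extChartAt 𝓘(ℝ, E) (1 : G)).right_inv hx

variable [IsManifold 𝓘(ℝ, E) ∞ G]

theorem contMDiffAt_oneChart : ContMDiffAt 𝓘(ℝ, E) 𝓘(ℝ, E) ∞ (oneChart E : G → E) (1 : G) :=
  contMDiffAt_extChartAt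

theorem contMDiffAt_oneChartSymm :
    ContMDiffAt 𝓘(ℝ, E) 𝓘(ℝ, E) ∞ (oneChartSymm G : E → G) (oneCoord E G) :=
  (contMDiffOn_extChartAt_symm (I := 𝓘(ℝ, E)) (n := ∞) (1 : G)).contMDiffAt
    (extChartAt_target_mem_nhds (I := 𝓘(ℝ, E)) (1 : G))

theorem ContMDiffAt.oneChart_comp {f : W → G} {w : W} (hf : ContMDiffAt 𝓘(ℝ, W) 𝓘(ℝ, E) ∞ f w)
    (h1 : f w = 1) : ContDiffAt ℝ ∞ (fun s => oneChart E (f s)) w := by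
  rw [← contMDiffAt_iff_contDiffAt]
  exact ContMDiffAt.comp_of_eq (g := (oneChart E : G → E)) contMDiffAt_oneChart hf h1

/-- The tangent space at `1` is identified with `E` by the preferred chart at `1`, so at a point
mapped to `1` the manifold derivative is the ordinary derivative in this one chart. -/
theorem mfderiv_eq_fderiv_oneChart {f : W → G} {w : W}
    (hf : ContMDiffAt 𝓘(ℝ, W) 𝓘(ℝ, E) ∞ f w) (h1 : f w = 1) :
    (mfderiv 𝓘(ℝ, W) 𝓘(ℝ, E) f w : W →L[ℝ] E) = fderiv ℝ (fun s => oneChart E (f s)) w := by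
  rw [(hf.mdifferentiableAt (by simp)).mfderiv]
  simp only [writtenInExtChartAt, extChartAt_model_space_eq_id, modelWithCornersSelf_coe,
    Set.range_id, fderivWithin_univ, PartialEquiv.refl_symm, PartialEquiv.refl_coe, h1]
  rfl

end One

variable [Group G] [LieGroup 𝓘(ℝ, E) ∞ G]

variable (E) in
/-- The logarithmic derivative `c⁻¹ dc` of a map into a Lie group. -/
def groupLogDeriv (c : W → G) (w : W) : W →L[ℝ] E :=
  mfderiv 𝓘(ℝ, W) 𝓘(ℝ, E) (fun s => (c w)⁻¹ * c s) w

theorem logDerivative_eq_groupLogDeriv (c : ℝ → G) (θ : ℝ) :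
    logDerivative E c θ = groupLogDeriv E c θ 1 := rfl

/-- The group multiplication in the chart at `1`. -/
def chartMul (G : Type*) [TopologicalSpace G] [ChartedSpace E G] [Group G] (z : E × E) : E :=
  oneChart E (oneChartSymm G z.1 * oneChartSymm G z.2)

theorem contDiffAt_chartMul : ContDiffAt ℝ ∞ (chartMul (E := E) G) (oneCoord E G, oneCoord E G) := by
  refine ContMDiffAt.oneChart_comp ?_ (by simp)
  refine ContMDiffAt.mul ?_ ?_
  · exact ContMDiffAt.comp_of_eq contMDiffAt_oneChartSymm contDiffAt_fst.contMDiffAt rfl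
  · exact ContMDiffAt.comp_of_eq contMDiffAt_oneChartSymm contDiffAt_snd.contMDiffAt rfl

theorem groupLogDeriv_eq_fderiv {c : W → G} {w : W} (hc : ContMDiffAt 𝓘(ℝ, W) 𝓘(ℝ, E) ∞ c w) :
    groupLogDeriv E c w = fderiv ℝ (fun s => oneChart E ((c w)⁻¹ * c s)) w :=
  mfderiv_eq_fderiv_oneChart (contMDiffAt_const.mul hc) (by simp)

theorem Ad_eq_fderiv (g : G) :
    Ad E g = fderiv ℝ (fun x => oneChart E (g * oneChartSymm G x * g⁻¹)) (oneCoord E G) := by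
  have h : ContMDiffAt 𝓘(ℝ, E) 𝓘(ℝ, E) ∞ (fun h : G => g * h * g⁻¹) 1 :=
    (contMDiffAt_const.mul contMDiffAt_id).mul contMDiffAt_const
  rw [Ad, (h.mdifferentiableAt (by simp)).mfderiv]
  simp only [writtenInExtChartAt, modelWithCornersSelf_coe,
    Set.range_id, fderivWithin_univ, mul_one, mul_inv_cancel]
  rfl

theorem Ad_one : Ad E (1 : G) = ContinuousLinearMap.id ℝ E := by
  have : (fun h : G => 1 * h * 1⁻¹) = id := by ext; simp
  rw [Ad, this, mfderiv_id]
  rfl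

theorem mdifferentiableAt_conj (g : G) :
    MDifferentiableAt 𝓘(ℝ, E) 𝓘(ℝ, E) (fun h : G => g * h * g⁻¹) 1 := by
  have : ContMDiffAt 𝓘(ℝ, E) 𝓘(ℝ, E) ∞ (fun h : G => g * h * g⁻¹) 1 :=
    (contMDiffAt_const.mul contMDiffAt_id).mul contMDiffAt_const
  exact this.mdifferentiableAt (by simp)

theorem Ad_mul (g h : G) : Ad E (g * h) = (Ad E g).comp (Ad E h) := by
  have e : (fun x : G => g * h * x * (g * h)⁻¹) =
      (fun x : G => g * x * g⁻¹) ∘ (fun x : G => h * x * h⁻¹) := by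
    ext x; simp [mul_assoc]
  have key : ∀ y : G, y = 1 →
      (mfderiv 𝓘(ℝ, E) 𝓘(ℝ, E) (fun x : G => g * x * g⁻¹) y : E →L[ℝ] E) = Ad E g := by
    rintro _ rfl; rfl
  rw [Ad, e]
  exact (mfderiv_comp_of_eq (y := (1 : G)) (mdifferentiableAt_conj (E := E) g)
    (mdifferentiableAt_conj (E := E) h) (by simp)).trans
    (congrArg (fun L : E →L[ℝ] E => L.comp (Ad E h)) (key _ (by simp)))

theorem Ad_inv_comp (g : G) : (Ad E g⁻¹).comp (Ad E g) = ContinuousLinearMap.id ℝ E := by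
  rw [← Ad_mul, inv_mul_cancel, Ad_one]

theorem Ad_comp_inv (g : G) : (Ad E g).comp (Ad E g⁻¹) = ContinuousLinearMap.id ℝ E := by
  rw [← Ad_mul, mul_inv_cancel, Ad_one]

theorem contMDiffAt_oneChartSymm_comp {X : Type*} [NormedAddCommGroup X] [NormedSpace ℝ X]
    {f : X → E} {x : X} (hf : ContDiffAt ℝ ∞ f x) (hx : f x = oneCoord E G) :
    ContMDiffAt 𝓘(ℝ, X) 𝓘(ℝ, E) ∞ (fun y => oneChartSymm G (f y)) x :=
  ContMDiffAt.comp_of_eq contMDiffAt_oneChartSymm hf.contMDiffAt hx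

/-- `(x, y) ↦ x y x⁻¹` in the chart at `1`. -/
def chartConj (G : Type*) [TopologicalSpace G] [ChartedSpace E G] [Group G] (z : E × E) : E :=
  oneChart E (oneChartSymm G z.1 * oneChartSymm G z.2 * (oneChartSymm G z.1)⁻¹)

theorem contDiffAt_chartConj :
    ContDiffAt ℝ ∞ (chartConj (E := E) G) (oneCoord E G, oneCoord E G) := by
  refine ContMDiffAt.oneChart_comp ?_ (by simp)
  have h1 : ContMDiffAt 𝓘(ℝ, E × E) 𝓘(ℝ, E) ∞ (fun y : E × E => oneChartSymm G y.1) (oneCoord E G, oneCoord E G) :=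
    contMDiffAt_oneChartSymm_comp contDiffAt_fst rfl
  exact (h1.mul (contMDiffAt_oneChartSymm_comp contDiffAt_snd rfl)).mul h1.inv

/-- `(x, y) ↦ x⁻¹ y` in the chart at `1`. -/
def chartDiv (G : Type*) [TopologicalSpace G] [ChartedSpace E G] [Group G] (z : E × E) : E :=
  oneChart E ((oneChartSymm G z.1)⁻¹ * oneChartSymm G z.2)

theorem contDiffAt_chartDiv :
    ContDiffAt ℝ ∞ (chartDiv (E := E) G) (oneCoord E G, oneCoord E G) := by
  refine ContMDiffAt.oneChart_comp ?_ (by simp)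
  exact (contMDiffAt_oneChartSymm_comp (f := fun y : E × E => y.1) contDiffAt_fst rfl).inv.mul
    (contMDiffAt_oneChartSymm_comp contDiffAt_snd rfl)

theorem eventually_differentiableAt {X Y : Type*} [NormedAddCommGroup X] [NormedSpace ℝ X]
    [NormedAddCommGroup Y] [NormedSpace ℝ Y] {f : X → Y} {x : X} (hf : ContDiffAt ℝ ∞ f x) :
    ∀ᶠ y in 𝓝 x, DifferentiableAt ℝ f y := by
  have := (hf.of_le (m := 1) (by exact_mod_cast le_top)).eventually (by simp)
  filter_upwards [this] with y hy using hy.differentiableAt (by simp)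

theorem chartMul_oneCoord_left :
    ∀ᶠ x in 𝓝 (oneCoord E G), chartMul G (oneCoord E G, x) = x := by
  filter_upwards [eventually_oneChart_oneChartSymm (E := E) (G := G)] with x hx
  simp [chartMul, hx]

theorem chartMul_oneCoord_right :
    ∀ᶠ x in 𝓝 (oneCoord E G), chartMul G (x, oneCoord E G) = x := by
  filter_upwards [eventually_oneChart_oneChartSymm (E := E) (G := G)] with x hx
  simp [chartMul, hx]

theorem fderiv_inr {X Y Z : Type*} [NormedAddCommGroup X] [NormedSpace ℝ X]
    [NormedAddCommGroup Y] [NormedSpace ℝ Y] [NormedAddCommGroup Z] [NormedSpace ℝ Z]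
    {f : X × Y → Z} {x : X} {y : Y} (hf : DifferentiableAt ℝ f (x, y)) :
    HasFDerivAt (fun y => f (x, y)) ((fderiv ℝ f (x, y)).comp (ContinuousLinearMap.inr ℝ X Y)) y :=
  hf.hasFDerivAt.comp y (hasFDerivAt_prodMk_right x y)

theorem fderiv_inl {X Y Z : Type*} [NormedAddCommGroup X] [NormedSpace ℝ X]
    [NormedAddCommGroup Y] [NormedSpace ℝ Y] [NormedAddCommGroup Z] [NormedSpace ℝ Z]
    {f : X × Y → Z} {x : X} {y : Y} (hf : DifferentiableAt ℝ f (x, y)) :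
    HasFDerivAt (fun x => f (x, y)) ((fderiv ℝ f (x, y)).comp (ContinuousLinearMap.inl ℝ X Y)) x :=
  hf.hasFDerivAt.comp x (hasFDerivAt_prodMk_left x y)

theorem fderiv_chartMul_inr (ξ : E) :
    fderiv ℝ (chartMul G) (oneCoord E G, oneCoord E G) (0, ξ) = ξ := by
  have h := fderiv_inr (contDiffAt_chartMul.differentiableAt (by simp) :
    DifferentiableAt ℝ (chartMul (E := E) G) (oneCoord E G, oneCoord E G))
  have h2 := (hasFDerivAt_id (𝕜 := ℝ) (oneCoord E G)).congr_of_eventuallyEq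
    (chartMul_oneCoord_left (E := E) (G := G))
  simpa using congrArg (fun L => L ξ) (h.unique h2)

theorem fderiv_chartMul_inl (ξ : E) :
    fderiv ℝ (chartMul G) (oneCoord E G, oneCoord E G) (ξ, 0) = ξ := by
  have h := fderiv_inl (contDiffAt_chartMul.differentiableAt (by simp) :
    DifferentiableAt ℝ (chartMul (E := E) G) (oneCoord E G, oneCoord E G))
  have h2 := (hasFDerivAt_id (𝕜 := ℝ) (oneCoord E G)).congr_of_eventuallyEq
    (chartMul_oneCoord_right (E := E) (G := G))
  simpa using congrArg (fun L => L ξ) (h.unique h2)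

theorem mfderiv_oneChart_one :
    (mfderiv 𝓘(ℝ, E) 𝓘(ℝ, E) (oneChart E : G → E) (1 : G) : E →L[ℝ] E) =
      ContinuousLinearMap.id ℝ E := by
  have h := contMDiffAt_oneChart (E := E) (G := G)
  rw [(h.mdifferentiableAt (by simp)).mfderiv]
  simp only [writtenInExtChartAt, modelWithCornersSelf_coe, Set.range_id, fderivWithin_univ,
    extChartAt_model_space_eq_id, PartialEquiv.refl_coe]
  refine HasFDerivAt.fderiv ?_
  exact (hasFDerivAt_id (𝕜 := ℝ) (oneCoord E G)).congr_of_eventuallyEq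
    (eventually_oneChart_oneChartSymm (E := E) (G := G))

/-- The left invariant field is the derivative of `h ↦ g h` at `1`. In the chart this is the partial
derivative of `chartMul` in the second variable. -/
theorem eventually_mpullback_mulInvariantVectorField (v : E) :
    ∀ᶠ x in 𝓝 (oneCoord E G),
      (VectorField.mpullbackWithin 𝓘(ℝ, E) 𝓘(ℝ, E) (extChartAt 𝓘(ℝ, E) (1 : G)).symm
        (mulInvariantVectorField (I := 𝓘(ℝ, E)) (G := G) v) (Set.range 𝓘(ℝ, E)) x : E) =
      fderiv ℝ (chartMul G) (x, oneCoord E G) (0, v) := by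
  have hd := eventually_differentiableAt (contDiffAt_chartMul (E := E) (G := G))
  have hd' : ∀ᶠ x in 𝓝 (oneCoord E G), DifferentiableAt ℝ (chartMul (E := E) G) (x, oneCoord E G) :=
    (Continuous.prodMk_left (oneCoord E G)).continuousAt.eventually hd
  filter_upwards [extChartAt_target_mem_nhds (I := 𝓘(ℝ, E)) (1 : G), hd',
    chartMul_oneCoord_right (E := E) (G := G)] with x hx hdx hxe
  have := IsManifold.of_le (I := 𝓘(ℝ, E)) (M := G) (m := 1) (n := ∞) (by simp)
  have hinv := isInvertible_mfderivWithin_extChartAt_symm (I := 𝓘(ℝ, E)) (x := (1 : G)) hx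
  rw [VectorField.mpullbackWithin]
  refine hinv.inverse_apply_eq.2 ?_
  simp only [modelWithCornersSelf_coe, Set.range_id, mfderivWithin_univ]
  have hψ : MDifferentiableAt 𝓘(ℝ, E) 𝓘(ℝ, E) (oneChartSymm G : E → G) x :=
    (((contMDiffOn_extChartAt_symm (I := 𝓘(ℝ, E)) (n := ∞) (1 : G)).contMDiffAt
      ((isOpen_extChartAt_target (I := 𝓘(ℝ, E)) (1 : G)).mem_nhds hx))).mdifferentiableAt (by simp)
  have hm := (fderiv_inr hdx)
  have hφ : HasMFDerivAt 𝓘(ℝ, E) 𝓘(ℝ, E) (oneChart E : G → E) (1 : G)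
      (ContinuousLinearMap.id ℝ E) := by
    have := ((contMDiffAt_oneChart (E := E) (G := G)).mdifferentiableAt (by simp)).hasMFDerivAt
    rwa [mfderiv_oneChart_one] at this
  have h2 : HasMFDerivAt 𝓘(ℝ, E) 𝓘(ℝ, E) (fun h : G => chartMul G (x, oneChart E h)) (1 : G)
      (((fderiv ℝ (chartMul G) (x, oneCoord E G)).comp (ContinuousLinearMap.inr ℝ E E)).comp
        (ContinuousLinearMap.id ℝ E)) :=
    HasMFDerivAt.comp (1 : G) (g := fun y => chartMul G (x, y)) hm.hasMFDerivAt hφ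
  have h3 : HasMFDerivAt 𝓘(ℝ, E) 𝓘(ℝ, E)
      (fun h : G => oneChartSymm G (chartMul G (x, oneChart E h))) (1 : G) _ :=
    HasMFDerivAt.comp (1 : G) (g := (oneChartSymm G : E → G))
      (g' := mfderiv 𝓘(ℝ, E) 𝓘(ℝ, E) (oneChartSymm G : E → G) x) (by
        have : chartMul G (x, oneChart E (1 : G)) = x := hxe
        rw [this]; exact hψ.hasMFDerivAt) h2
  have h4 : (fun h : G => oneChartSymm G x * h) =ᶠ[𝓝 (1 : G)]
      (fun h : G => oneChartSymm G (chartMul G (x, oneChart E h))) := by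
    have hs : ∀ᶠ h in 𝓝 (1 : G), oneChartSymm G x * h ∈ (extChartAt 𝓘(ℝ, E) (1 : G)).source := by
      have hc : ContinuousAt (fun h : G => oneChartSymm G x * h) 1 :=
        ((contMDiffAt_const.mul contMDiffAt_id : ContMDiffAt 𝓘(ℝ, E) 𝓘(ℝ, E) ∞
          (fun h : G => oneChartSymm G x * h) 1)).continuousAt
      refine hc.eventually ?_
      simp only [mul_one]
      exact (isOpen_extChartAt_source (I := 𝓘(ℝ, E)) (1 : G)).mem_nhds
        ((extChartAt 𝓘(ℝ, E) (1 : G)).map_target hx)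
    filter_upwards [hs, eventually_oneChartSymm_oneChart (E := E) (G := G)] with h h1 h2
    simp only [chartMul, h2]
    exact ((extChartAt 𝓘(ℝ, E) (1 : G)).left_inv h1).symm
  have h5 := (h3.congr_of_eventuallyEq h4).mfderiv
  exact congrArg (fun L : E →L[ℝ] E => L v) h5

/-- The bracket of the two fields differentiates their chart expressions in the base point, which
leaves the antisymmetrised mixed second derivative of the product. -/
theorem lieBr_eq_fderiv (ξ η : E) :
    lieBr E G ξ η =
      fderiv ℝ (fderiv ℝ (chartMul G)) (oneCoord E G, oneCoord E G) (ξ, 0) (0, η) -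
      fderiv ℝ (fderiv ℝ (chartMul G)) (oneCoord E G, oneCoord E G) (η, 0) (0, ξ) := by
  have h2 : DifferentiableAt ℝ (fderiv ℝ (chartMul (E := E) G)) (oneCoord E G, oneCoord E G) :=
    ((contDiffAt_chartMul (E := E) (G := G)).fderiv_right (m := ∞)
      (by simp)).differentiableAt (by simp)
  have key : ∀ ξ : E, HasFDerivAt (fun x : E => fderiv ℝ (chartMul G) (x, oneCoord E G) (0, ξ))
      ((ContinuousLinearMap.apply ℝ E ((0, ξ) : E × E)).comp
        ((fderiv ℝ (fderiv ℝ (chartMul G)) (oneCoord E G, oneCoord E G)).comp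
          (ContinuousLinearMap.inl ℝ E E))) (oneCoord E G) := fun ξ =>
    (ContinuousLinearMap.apply ℝ E ((0, ξ) : E × E)).hasFDerivAt.comp (oneCoord E G) (fderiv_inl h2)
  have hE := (eventually_mpullback_mulInvariantVectorField (E := E) (G := G) ξ)
  have hF := (eventually_mpullback_mulInvariantVectorField (E := E) (G := G) η)
  have : (mfderiv 𝓘(ℝ, E) 𝓘(ℝ, E) (extChartAt 𝓘(ℝ, E) (1 : G)) (1 : G) : E →L[ℝ] E) =
    ContinuousLinearMap.id ℝ E := mfderiv_oneChart_one
  have h0 : lieBr E G ξ η = 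
    (VectorField.lieBracketWithin (E := E) ℝ
      (VectorField.mpullbackWithin 𝓘(ℝ, E) 𝓘(ℝ, E) (extChartAt 𝓘(ℝ, E) (1 : G)).symm
        (mulInvariantVectorField (I := 𝓘(ℝ, E)) (G := G) ξ) (Set.range 𝓘(ℝ, E)) : E → E)
      (VectorField.mpullbackWithin 𝓘(ℝ, E) 𝓘(ℝ, E) (extChartAt 𝓘(ℝ, E) (1 : G)).symm
        (mulInvariantVectorField (I := 𝓘(ℝ, E)) (G := G) η) (Set.range 𝓘(ℝ, E)) : E → E)
      ((extChartAt 𝓘(ℝ, E) (1 : G)).symm ⁻¹' Set.univ ∩ Set.range 𝓘(ℝ, E)) (oneCoord E G)) := by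
    have key2 : ∀ D : E →L[ℝ] E, D = ContinuousLinearMap.id ℝ E → ∀ v, D.inverse v = v := by
      rintro _ rfl v; simp
    exact key2 _ this _
  rw [h0,
    Filter.EventuallyEq.lieBracketWithin_vectorField_eq_nhds hE hF]
  simp only [Set.preimage_univ, modelWithCornersSelf_coe, Set.range_id, Set.univ_inter,
    VectorField.lieBracketWithin_univ, VectorField.lieBracket]
  rw [(key ξ).fderiv, (key η).fderiv]
  simp [fderiv_chartMul_inr]

theorem minSmoothness_two_le : minSmoothness ℝ 2 ≤ (∞ : WithTop ℕ∞) := by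
  rw [minSmoothness_of_isRCLikeNormedField]
  exact WithTop.coe_le_coe.2 (le_top : (2 : ℕ∞) ≤ ⊤)

theorem hasFDerivAt_chartPartial {f : E × E → E} {x : E} (h2 : ContDiffAt ℝ ∞ f (x, x)) :
    DifferentiableAt ℝ (fderiv ℝ f) (x, x) :=
  (h2.fderiv_right (m := ∞) (by simp)).differentiableAt (by simp)

section Curve

variable {c : W → G}

theorem contDiffAt_oneChart_translate (hc : ContMDiff 𝓘(ℝ, W) 𝓘(ℝ, E) ∞ c) (w₀ : W) :
    ContDiffAt ℝ ∞ (fun s => oneChart E ((c w₀)⁻¹ * c s)) w₀ :=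
  ContMDiffAt.oneChart_comp (contMDiffAt_const.mul hc.contMDiffAt) (by simp)

theorem eventually_oneChartSymm_translate (hc : ContMDiff 𝓘(ℝ, W) 𝓘(ℝ, E) ∞ c) (w₀ : W) :
    ∀ᶠ s in 𝓝 w₀, oneChartSymm G (oneChart E ((c w₀)⁻¹ * c s)) = (c w₀)⁻¹ * c s := by
  have h : ContMDiffAt 𝓘(ℝ, W) 𝓘(ℝ, E) ∞ (fun s => (c w₀)⁻¹ * c s) w₀ :=
    contMDiffAt_const.mul hc.contMDiffAt
  have := h.continuousAt
  rw [ContinuousAt, inv_mul_cancel] at this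
  exact this.eventually (eventually_oneChartSymm_oneChart (E := E) (G := G))

/-- The defining formula translates by `c w`, which varies with the point. Writing `c(w)⁻¹ c(s)` as
`(c(w₀)⁻¹ c(w))⁻¹ (c(w₀)⁻¹ c(s))` fixes the chart curve, and smoothness in `w` becomes visible. -/
theorem eventually_groupLogDeriv_eq (hc : ContMDiff 𝓘(ℝ, W) 𝓘(ℝ, E) ∞ c) (w₀ : W) :
    ∀ᶠ w in 𝓝 w₀, groupLogDeriv E c w =
      ((fderiv ℝ (chartDiv G) (oneChart E ((c w₀)⁻¹ * c w), oneChart E ((c w₀)⁻¹ * c w))).comp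
        (ContinuousLinearMap.inr ℝ E E)).comp
        (fderiv ℝ (fun s => oneChart E ((c w₀)⁻¹ * c s)) w) := by
  have hh := contDiffAt_oneChart_translate hc w₀
  have hd : ∀ᶠ w in 𝓝 w₀, DifferentiableAt ℝ (chartDiv (E := E) G)
      (oneChart E ((c w₀)⁻¹ * c w), oneChart E ((c w₀)⁻¹ * c w)) := by
    refine (hh.continuousAt.prodMk hh.continuousAt).eventually ?_
    simp only [inv_mul_cancel]
    exact eventually_differentiableAt (contDiffAt_chartDiv (E := E) (G := G))
  filter_upwards [(eventually_oneChartSymm_translate hc w₀).eventually_nhds, hd,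
    eventually_differentiableAt hh] with w h1 h2 h3
  rw [groupLogDeriv_eq_fderiv hc.contMDiffAt]
  have e : (fun s => oneChart E ((c w)⁻¹ * c s)) =ᶠ[𝓝 w]
      fun s => chartDiv G (oneChart E ((c w₀)⁻¹ * c w), oneChart E ((c w₀)⁻¹ * c s)) := by
    filter_upwards [h1] with s hs
    simp only [chartDiv, hs, h1.self_of_nhds]
    congr 1
    group
  rw [e.fderiv_eq]
  exact ((fderiv_inr h2).comp w h3.hasFDerivAt).fderiv

theorem contDiff_groupLogDeriv (hc : ContMDiff 𝓘(ℝ, W) 𝓘(ℝ, E) ∞ c) :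
    ContDiff ℝ ∞ (groupLogDeriv E c) := by
  rw [contDiff_iff_contDiffAt]
  intro w₀
  refine ContDiffAt.congr_of_eventuallyEq ?_ (eventually_groupLogDeriv_eq hc w₀)
  have hh := contDiffAt_oneChart_translate hc w₀
  have h1 : ContDiffAt ℝ ∞ (fun w => fderiv ℝ (chartDiv (E := E) G)
      (oneChart E ((c w₀)⁻¹ * c w), oneChart E ((c w₀)⁻¹ * c w))) w₀ := by
    refine ContDiffAt.comp w₀ (g := fderiv ℝ (chartDiv (E := E) G)) ?_ (hh.prodMk hh)
    simp only [inv_mul_cancel]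
    exact (contDiffAt_chartDiv (E := E) (G := G)).fderiv_right (by simp)
  exact (h1.clm_comp contDiffAt_const).clm_comp (hh.fderiv_right (by simp))

/-- The converse expression of `dh`, for the fixed chart curve `h` of `c(w₀)⁻¹ c`, through `c⁻¹ dc`.
Differentiating it once more yields the Maurer–Cartan equation. -/
theorem eventually_fderiv_translate (hc : ContMDiff 𝓘(ℝ, W) 𝓘(ℝ, E) ∞ c) (w₀ : W) :
    ∀ᶠ w in 𝓝 w₀, fderiv ℝ (fun s => oneChart E ((c w₀)⁻¹ * c s)) w =
      ((fderiv ℝ (chartMul G) (oneChart E ((c w₀)⁻¹ * c w), oneCoord E G)).comp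
        (ContinuousLinearMap.inr ℝ E E)).comp (groupLogDeriv E c w) := by
  have hh := contDiffAt_oneChart_translate hc w₀
  have hd : ∀ᶠ w in 𝓝 w₀, DifferentiableAt ℝ (chartMul (E := E) G)
      (oneChart E ((c w₀)⁻¹ * c w), oneCoord E G) := by
    refine (hh.continuousAt.prodMk continuousAt_const).eventually ?_
    simp only [inv_mul_cancel]
    exact eventually_differentiableAt (contDiffAt_chartMul (E := E) (G := G))
  filter_upwards [(eventually_oneChartSymm_translate hc w₀), hd] with w h1 h2
  rw [groupLogDeriv_eq_fderiv hc.contMDiffAt]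
  have e : (fun s => oneChart E ((c w₀)⁻¹ * c s)) =ᶠ[𝓝 w]
      fun s => chartMul G (oneChart E ((c w₀)⁻¹ * c w), oneChart E ((c w)⁻¹ * c s)) := by
    filter_upwards [eventually_oneChartSymm_translate hc w] with s hs
    simp only [chartMul, hs, h1]
    congr 1
    group
  rw [e.fderiv_eq]
  refine (HasFDerivAt.comp w (g := fun y => chartMul G (oneChart E ((c w₀)⁻¹ * c w), y)) ?_
    ((contDiffAt_oneChart_translate hc w).differentiableAt (by simp)).hasFDerivAt).fderiv
  have := fderiv_inr h2
  simp only [inv_mul_cancel]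
  exact this

/-- The Maurer–Cartan equation. -/
theorem fderiv_groupLogDeriv_sub (hc : ContMDiff 𝓘(ℝ, W) 𝓘(ℝ, E) ∞ c) (w u v : W) :
    fderiv ℝ (groupLogDeriv E c) w u v - fderiv ℝ (groupLogDeriv E c) w v u =
      - lieBr E G (groupLogDeriv E c w u) (groupLogDeriv E c w v) := by
  have hh := contDiffAt_oneChart_translate hc w
  set h := fun s => oneChart E ((c w)⁻¹ * c s) with hdef
  have hw : h w = oneCoord E G := by simp [hdef, oneCoord]
  have hl := (contDiff_groupLogDeriv hc).differentiable (by simp) w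
  have hev := eventually_fderiv_translate hc w
  have h2 := hasFDerivAt_chartPartial (contDiffAt_chartMul (E := E) (G := G))
  have hm : HasFDerivAt (fun s => fderiv ℝ (chartMul G) (h s, oneCoord E G))
      ((fderiv ℝ (fderiv ℝ (chartMul G)) (oneCoord E G, oneCoord E G)).comp
        ((ContinuousLinearMap.inl ℝ E E).comp (fderiv ℝ h w))) w := by
    have := fderiv_inl h2
    rw [← hw] at this
    have := HasFDerivAt.comp w (f := h) this (hh.differentiableAt (by simp)).hasFDerivAt
    rw [hw] at this
    exact this
  have hl0 : fderiv ℝ h w = groupLogDeriv E c w := by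
    rw [hev.self_of_nhds]
    ext v
    simp only [inv_mul_cancel]
    exact fderiv_chartMul_inr _
  have hD : ∀ u v, fderiv ℝ (fderiv ℝ h) w u v =
      fderiv ℝ (fderiv ℝ (chartMul G)) (oneCoord E G, oneCoord E G)
        (groupLogDeriv E c w u, 0) (0, groupLogDeriv E c w v) +
      fderiv ℝ (groupLogDeriv E c) w u v := by
    intro u v
    have e1 : HasFDerivAt (fun s => ((fderiv ℝ (chartMul G) (h s, oneCoord E G)).comp
        (ContinuousLinearMap.inr ℝ E E)).comp (groupLogDeriv E c s)) _ w :=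
      (hm.clm_comp (hasFDerivAt_const (ContinuousLinearMap.inr ℝ E E) w)).clm_comp hl.hasFDerivAt
    rw [Filter.EventuallyEq.fderiv_eq hev, e1.fderiv]
    simp [hl0, hw, fderiv_chartMul_inr, add_comm]
  -- The second derivative of `h` is symmetric, so the antisymmetric part of `d(c⁻¹ dc)` is minus
  -- that of the mixed second derivative of the product, which is the bracket.
  have hs := (hh.isSymmSndFDerivAt minSmoothness_two_le).eq u v
  rw [hD, hD] at hs
  rw [lieBr_eq_fderiv, neg_sub, sub_eq_sub_iff_add_eq_add, add_comm, hs]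

end Curve

theorem Ad_oneChartSymm : ∀ᶠ x in 𝓝 (oneCoord E G), Ad E (oneChartSymm G x) =
    (fderiv ℝ (chartConj G) (x, oneCoord E G)).comp (ContinuousLinearMap.inr ℝ E E) := by
  have hd' : ∀ᶠ x in 𝓝 (oneCoord E G), DifferentiableAt ℝ (chartConj (E := E) G) (x, oneCoord E G) :=
    (Continuous.prodMk_left (oneCoord E G)).continuousAt.eventually
      (eventually_differentiableAt (contDiffAt_chartConj (E := E) (G := G)))
  filter_upwards [hd'] with x hx
  rw [Ad_eq_fderiv]
  exact (fderiv_inr hx).fderiv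

theorem contDiffAt_Ad_oneChartSymm :
    ContDiffAt ℝ ∞ (fun x : E => Ad E (oneChartSymm G x)) (oneCoord E G) := by
  refine ContDiffAt.congr_of_eventuallyEq ?_ Ad_oneChartSymm
  refine ContDiffAt.clm_comp ?_ contDiffAt_const
  exact ContDiffAt.comp (oneCoord E G) (g := fderiv ℝ (chartConj (E := E) G))
    (f := fun x => (x, oneCoord E G))
    ((contDiffAt_chartConj (E := E) (G := G)).fderiv_right (by simp))
    (contDiffAt_id.prodMk contDiffAt_const)

/-- The derivative in `y` at `1` of the identity `x y = (x y x⁻¹) x`. -/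
theorem eventually_chartMul_Ad : ∀ᶠ x in 𝓝 (oneCoord E G), ∀ ξ : E,
    fderiv ℝ (chartMul G) (oneCoord E G, x) (Ad E (oneChartSymm G x) ξ, 0) =
      fderiv ℝ (chartMul G) (x, oneCoord E G) (0, ξ) := by
  have hd := eventually_differentiableAt (contDiffAt_chartMul (E := E) (G := G))
  have hd1 : ∀ᶠ x in 𝓝 (oneCoord E G), DifferentiableAt ℝ (chartMul (E := E) G) (x, oneCoord E G) :=
    (Continuous.prodMk_left (oneCoord E G)).continuousAt.eventually hd
  have hd2 : ∀ᶠ x in 𝓝 (oneCoord E G), DifferentiableAt ℝ (chartMul (E := E) G) (oneCoord E G, x) :=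
    (Continuous.prodMk_right (oneCoord E G)).continuousAt.eventually hd
  have hd' : ∀ᶠ x in 𝓝 (oneCoord E G), DifferentiableAt ℝ (chartConj (E := E) G) (x, oneCoord E G) :=
    (Continuous.prodMk_left (oneCoord E G)).continuousAt.eventually
      (eventually_differentiableAt (contDiffAt_chartConj (E := E) (G := G)))
  filter_upwards [hd1, hd2, hd', Ad_oneChartSymm (E := E) (G := G)] with x h1 h2 h3 h4 ξ
  have hx : chartConj G (x, oneCoord E G) = oneCoord E G := by
    simp only [chartConj, oneChartSymm_oneCoord, mul_one, mul_inv_cancel]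
    rfl
  have e : (fun y => chartMul G (x, y)) =ᶠ[𝓝 (oneCoord E G)]
      (fun y => chartMul G (chartConj G (x, y), x)) := by
    have hc : ContMDiffAt 𝓘(ℝ, E) 𝓘(ℝ, E) ∞
        (fun y => oneChartSymm G x * oneChartSymm G y * (oneChartSymm G x)⁻¹) (oneCoord E G) :=
      (contMDiffAt_const.mul contMDiffAt_oneChartSymm).mul contMDiffAt_const
    have hc := hc.continuousAt
    simp only [ContinuousAt, oneChartSymm_oneCoord, mul_one, mul_inv_cancel] at hc
    filter_upwards [hc.eventually (eventually_oneChartSymm_oneChart (E := E) (G := G))] with y hy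
    simp only [chartMul, chartConj, hy]
    simp
  have g1 := (fderiv_inr h1).congr_of_eventuallyEq e.symm
  have g2 : HasFDerivAt (fun y => chartMul G (chartConj G (x, y), x))
      (((fderiv ℝ (chartMul G) (oneCoord E G, x)).comp (ContinuousLinearMap.inl ℝ E E)).comp
      ((fderiv ℝ (chartConj G) (x, oneCoord E G)).comp (ContinuousLinearMap.inr ℝ E E)))
      (oneCoord E G) := by
    refine HasFDerivAt.comp (oneCoord E G) (g := fun z => chartMul G (z, x))
      (f := fun y => chartConj G (x, y)) ?_ (fderiv_inr h3)
    rw [hx]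
    exact fderiv_inl h2
  have := congrArg (fun L => L ξ) (g2.unique g1)
  rw [h4]
  simpa using this

/-- Differentiating `eventually_chartMul_Ad` in `x` at `1` expresses the derivative of `Ad` as a
difference of two mixed second derivatives of the product, namely the bracket. -/
theorem fderiv_Ad_oneChartSymm (u ξ : E) :
    fderiv ℝ (fun x : E => Ad E (oneChartSymm G x)) (oneCoord E G) u ξ = lieBr E G u ξ := by
  have h2 := hasFDerivAt_chartPartial (contDiffAt_chartMul (E := E) (G := G))
  have hA : HasFDerivAt (fun x : E => Ad E (oneChartSymm G x) ξ) _ (oneCoord E G) :=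
    ((contDiffAt_Ad_oneChartSymm (E := E) (G := G)).differentiableAt (by simp)).hasFDerivAt.clm_apply
      (hasFDerivAt_const ξ _)
  have e1 : HasFDerivAt (fun x => fderiv ℝ (chartMul G) (oneCoord E G, x)
      (Ad E (oneChartSymm G x) ξ, 0)) _ (oneCoord E G) :=
    (fderiv_inr h2).clm_apply (hA.prodMk (hasFDerivAt_const (0 : E) _))
  have e2 : HasFDerivAt (fun x => fderiv ℝ (chartMul G) (x, oneCoord E G) (0, ξ)) _ (oneCoord E G) :=
    (fderiv_inl h2).clm_apply (hasFDerivAt_const ((0, ξ) : E × E) _)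
  have e := (e1.congr_of_eventuallyEq ((eventually_chartMul_Ad (E := E) (G := G)).mono
    fun x hx => (hx ξ).symm)).unique e2
  have e := congrArg (fun L => L u) e
  have hs := ((contDiffAt_chartMul (E := E) (G := G)).isSymmSndFDerivAt minSmoothness_two_le).eq (ξ, 0) (0, u)
  simp [fderiv_chartMul_inl, Ad_one] at e
  rw [lieBr_eq_fderiv, ← e, hs]
  abel

/-- The factorisation `Ad (c w) = Ad (c w₀) ∘ Ad (c(w₀)⁻¹ c(w))` reduces both claims to a
neighbourhood of `1`. -/
theorem contDiff_Ad {c : W → G} (hc : ContMDiff 𝓘(ℝ, W) 𝓘(ℝ, E) ∞ c) :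
    ContDiff ℝ ∞ (fun w => Ad E (c w)) ∧ ∀ w u ξ,
      fderiv ℝ (fun w => Ad E (c w)) w u ξ = Ad E (c w) (lieBr E G (groupLogDeriv E c w u) ξ) := by
  have key : ∀ w₀, (fun w => Ad E (c w)) =ᶠ[𝓝 w₀] fun w => (Ad E (c w₀)).comp
      (Ad E (oneChartSymm G (oneChart E ((c w₀)⁻¹ * c w)))) := by
    intro w₀
    filter_upwards [eventually_oneChartSymm_translate hc w₀] with w hw
    rw [hw, ← Ad_mul]
    simp
  have hw : ∀ w₀, oneChart E ((c w₀)⁻¹ * c w₀) = oneCoord E G := by simp [oneCoord]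
  refine ⟨?_, fun w₀ u ξ => ?_⟩
  · rw [contDiff_iff_contDiffAt]
    intro w₀
    refine ContDiffAt.congr_of_eventuallyEq ?_ (key w₀)
    refine contDiffAt_const.clm_comp ?_
    refine ContDiffAt.comp w₀ (g := fun x : E => Ad E (oneChartSymm G x)) ?_
      (contDiffAt_oneChart_translate hc w₀)
    rw [hw]
    exact contDiffAt_Ad_oneChartSymm
  · have h1 := ((contDiffAt_Ad_oneChartSymm (E := E) (G := G)).differentiableAt
      (by simp)).hasFDerivAt
    have h2 := ((contDiffAt_oneChart_translate hc w₀).differentiableAt (by simp)).hasFDerivAt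
    rw [← groupLogDeriv_eq_fderiv hc.contMDiffAt] at h2
    have h3 : HasFDerivAt (fun w => Ad E (oneChartSymm G (oneChart E ((c w₀)⁻¹ * c w)))) _ w₀ :=
      HasFDerivAt.comp w₀ (g := fun x : E => Ad E (oneChartSymm G x)) (by rw [hw]; exact h1) h2
    rw [(key w₀).fderiv_eq, ((hasFDerivAt_const (Ad E (c w₀)) w₀).clm_comp h3).fderiv]
    simp [fderiv_Ad_oneChartSymm]

end LieCalculus

/-! ### Infinitesimal consequences of the adjoint action -/

section LieAlgebra
variable {E : Type*} [NormedAddCommGroup E] [NormedSpace ℝ E]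
  {G : Type*} [TopologicalSpace G] [ChartedSpace E G] [Group G] [LieGroup 𝓘(ℝ, E) ∞ G]

variable (E G) in
/-- The Lie bracket as a continuous bilinear map. -/
def lieBrL : E →L[ℝ] E →L[ℝ] E :=
  let D := fderiv ℝ (fderiv ℝ (chartMul G)) (oneCoord E G, oneCoord E G)
  let b : E →L[ℝ] E →L[ℝ] E :=
    ((ContinuousLinearMap.compL ℝ E (E × E) E).flip (ContinuousLinearMap.inr ℝ E E)).comp
      (D.comp (ContinuousLinearMap.inl ℝ E E))
  b - b.flip

theorem lieBr_eq_lieBrL (ξ η : E) : lieBr E G ξ η = lieBrL E G ξ η := by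
  rw [lieBr_eq_fderiv]
  simp [lieBrL]

theorem lieBrL_swap (ξ η : E) : lieBrL E G ξ η = - lieBrL E G η ξ := by
  simp [lieBrL]

theorem hasFDerivAt_Ad_oneChartSymm : HasFDerivAt (fun x : E => Ad E (oneChartSymm G x))
    (lieBrL E G) (oneCoord E G) := by
  have h := ((contDiffAt_Ad_oneChartSymm (E := E) (G := G)).differentiableAt (by simp)).hasFDerivAt
  have e : lieBrL E G = fderiv ℝ (fun x : E => Ad E (oneChartSymm G x)) (oneCoord E G) := by
    ext u ξ
    rw [fderiv_Ad_oneChartSymm, lieBr_eq_lieBrL]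
  rw [e]
  exact h

/-- The derivative in `x` at `1` of `Ad (g x g⁻¹) = Ad g ∘ Ad x ∘ Ad g⁻¹`, applied to `Ad g η`. -/
theorem Ad_lieBrL (g : G) (ξ η : E) :
    Ad E g (lieBrL E G ξ η) = lieBrL E G (Ad E g ξ) (Ad E g η) := by
  have hA := hasFDerivAt_Ad_oneChartSymm (E := E) (G := G)
  have hc : ContMDiffAt 𝓘(ℝ, E) 𝓘(ℝ, E) ∞
      (fun y => g * oneChartSymm G y * g⁻¹) (oneCoord E G) :=
    (contMDiffAt_const.mul contMDiffAt_oneChartSymm).mul contMDiffAt_const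
  have h1 : g * oneChartSymm G (oneCoord E G) * g⁻¹ = 1 := by
    rw [oneChartSymm_oneCoord, mul_one, mul_inv_cancel]
  have hk := ((ContMDiffAt.oneChart_comp hc h1).differentiableAt (by simp)).hasFDerivAt
  rw [← Ad_eq_fderiv] at hk
  have e1 : HasFDerivAt (fun x => Ad E (oneChartSymm G (oneChart E (g * oneChartSymm G x * g⁻¹))))
      ((lieBrL E G).comp (Ad E g)) (oneCoord E G) := by
    refine HasFDerivAt.comp (oneCoord E G) (g := fun x => Ad E (oneChartSymm G x)) ?_ hk
    rw [h1]; exact hA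
  have e2 := ((hasFDerivAt_const (Ad E g) (oneCoord E G)).clm_comp hA).clm_comp
    (hasFDerivAt_const (Ad E g⁻¹) (oneCoord E G))
  have hcc := hc.continuousAt
  rw [ContinuousAt, h1] at hcc
  have e3 : (fun x => Ad E (oneChartSymm G (oneChart E (g * oneChartSymm G x * g⁻¹)))) =ᶠ[𝓝 (oneCoord E G)]
      fun x => ((Ad E g).comp (Ad E (oneChartSymm G x))).comp (Ad E g⁻¹) := by
    filter_upwards [hcc.eventually (eventually_oneChartSymm_oneChart (E := E) (G := G))] with x hx
    rw [hx, Ad_mul, Ad_mul]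
  have e := congrArg (fun L => L ξ (Ad E g η)) (e1.unique (e2.congr_of_eventuallyEq e3))
  have hi : Ad E g⁻¹ (Ad E g η) = η := congrArg (fun L => L η) (Ad_inv_comp (E := E) g)
  simp [hi] at e
  exact e.symm

/-- The derivative at `x = 1` of `Ad x [ξ, η] = [Ad x ξ, Ad x η]`; this is the Jacobi identity. -/
theorem lieBrL_leibniz (u ξ η : E) : lieBrL E G u (lieBrL E G ξ η) =
    lieBrL E G (lieBrL E G u ξ) η + lieBrL E G ξ (lieBrL E G u η) := by
  have hA := hasFDerivAt_Ad_oneChartSymm (E := E) (G := G)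
  have hA' : ∀ ξ : E, HasFDerivAt (fun x : E => Ad E (oneChartSymm G x) ξ) _ (oneCoord E G) :=
    fun ξ => hA.clm_apply (hasFDerivAt_const ξ _)
  have e1 := hA' (lieBrL E G ξ η)
  simp only [Ad_lieBrL] at e1
  have e2 := ((hasFDerivAt_const (lieBrL E G) (oneCoord E G)).clm_apply (hA' ξ)).clm_apply (hA' η)
  have e := congrArg (fun L => L u) (e1.unique e2)
  simp [Ad_one] at e
  rw [e, add_comm]

/-- The derivative at `1` of the constant function `x ↦ f(Ad x v₁, …, Ad x v_k)`. -/
theorem InvariantPolynomial.sum_lieBrL {k : ℕ} (f : InvariantPolynomial E G k) (u : E)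
    (v : Fin k → E) :
    ∑ i, f.toMap (Function.update v i (lieBrL E G u (v i))) = 0 := by
  have hA := hasFDerivAt_Ad_oneChartSymm (E := E) (G := G)
  have hv : HasFDerivAt (fun x : E => fun i => Ad E (oneChartSymm G x) (v i)) _ (oneCoord E G) :=
    hasFDerivAt_pi.2 fun i => hA.clm_apply (hasFDerivAt_const (v i) _)
  have e1 := (f.toMap.hasFDerivAt _).comp (oneCoord E G) hv
  have e2 : HasFDerivAt (fun x : E => f.toMap (fun i => Ad E (oneChartSymm G x) (v i)))
      (0 : E →L[ℝ] ℝ) (oneCoord E G) := by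
    simp only [f.invariant]
    exact hasFDerivAt_const _ _
  have e := congrArg (fun L => L u) (e1.unique e2)
  simpa [Ad_one, ContinuousMultilinearMap.linearDeriv_apply] using e

end LieAlgebra

/-! ### Curvature and the Bianchi identity -/

section Forms

variable {E : Type*} [NormedAddCommGroup E] [NormedSpace ℝ E]
  {G : Type*} [TopologicalSpace G] [ChartedSpace E G] [Group G] [LieGroup 𝓘(ℝ, E) ∞ G]
  {W : Type*} [NormedAddCommGroup W] [NormedSpace ℝ W]
  {V : Type*} [NormedAddCommGroup V] [NormedSpace ℝ V]

/-- A map into the alternating forms on a finite dimensional space is smooth if its evaluations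
are. -/
theorem contDiffAt_alternating_of_apply [FiniteDimensional ℝ W] {d : ℕ} {α : V → W [⋀^Fin d]→L[ℝ] ℝ}
    {x : V} (h : ∀ v, ContDiffAt ℝ ∞ (fun y => α y v) x) : ContDiffAt ℝ ∞ α x := by
  let b := Module.finBasis ℝ W
  let L : (W [⋀^Fin d]→L[ℝ] ℝ) →ₗ[ℝ] ((Fin d → Fin (Module.finrank ℝ W)) → ℝ) :=
    { toFun := fun η r => η (fun i => b (r i))
      map_add' := fun _ _ => rfl
      map_smul' := fun _ _ => rfl }
  have hL : LinearMap.ker L = ⊥ := by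
    rw [LinearMap.ker_eq_bot]
    intro η η' hη
    have : η.toAlternatingMap = η'.toAlternatingMap :=
      AlternatingMap.coe_multilinearMap_injective
        (Module.Basis.ext_multilinear (fun _ => b) fun r => congrFun hη r)
    ext v
    exact congrArg (fun (ζ : W [⋀^Fin d]→ₗ[ℝ] ℝ) => ζ v) this
  -- Evaluation on tuples of basis vectors is injective, hence has a linear left inverse, which is
  -- continuous because its domain is finite-dimensional.
  obtain ⟨R, hR⟩ := L.exists_leftInverse_of_injective hL
  have e : α = fun y => R.toContinuousLinearMap (L (α y)) := by
    funext y
    exact (congrArg (fun T : _ →ₗ[ℝ] _ => T (α y)) hR).symm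
  rw [e]
  exact R.toContinuousLinearMap.contDiff.contDiffAt.comp x
    (contDiffAt_pi.2 fun r => h fun i => b (r i))

theorem contDiff_alternating_of_apply [FiniteDimensional ℝ W] {d : ℕ} {α : V → W [⋀^Fin d]→L[ℝ] ℝ}
    (h : ∀ v, ContDiff ℝ ∞ (fun y => α y v)) : ContDiff ℝ ∞ α :=
  contDiff_iff_contDiffAt.2 fun _ => contDiffAt_alternating_of_apply fun v => (h v).contDiffAt

theorem ContDiff.alternating_apply_const {d : ℕ} {α : V → W [⋀^Fin d]→L[ℝ] ℝ}
    (h : ContDiff ℝ ∞ α) (v : Fin d → W) : ContDiff ℝ ∞ (fun y => α y v) :=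
  (ContinuousAlternatingMap.apply ℝ W ℝ v).contDiff.comp h

/-! ### Curvature -/

variable (G) in
/-- The curvature `da + ½[a, a]` of a `𝔤`-valued `1`-form `a`. -/
def curv (a : W → W →L[ℝ] E) (w : W) : W →L[ℝ] W →L[ℝ] E :=
  fderiv ℝ a w - (fderiv ℝ a w).flip + (((lieBrL E G).comp (a w)).flip.comp (a w)).flip

theorem curv_apply (a : W → W →L[ℝ] E) (w u v : W) : curv G a w u v =
    fderiv ℝ a w u v - fderiv ℝ a w v u + lieBrL E G (a w u) (a w v) := by
  simp [curv]

theorem curv_swap (a : W → W →L[ℝ] E) (w u v : W) : curv G a w u v = - curv G a w v u := by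
  rw [curv_apply, curv_apply, lieBrL_swap]; abel

theorem ContDiff.clm_flip' {X Y Z : Type*} [NormedAddCommGroup X] [NormedSpace ℝ X]
    [NormedAddCommGroup Y] [NormedSpace ℝ Y] [NormedAddCommGroup Z] [NormedSpace ℝ Z]
    {g : W → X →L[ℝ] Y →L[ℝ] Z} (hg : ContDiff ℝ ∞ g) : ContDiff ℝ ∞ (fun w => (g w).flip) := by
  exact (ContinuousLinearEquiv.contDiff (F := Y →L[ℝ] X →L[ℝ] Z)
    (LinearIsometryEquiv.toContinuousLinearEquiv (ContinuousLinearMap.flipₗᵢ ℝ X Y Z))).comp hg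

theorem contDiff_curv {a : W → W →L[ℝ] E} (ha : ContDiff ℝ ∞ a) : ContDiff ℝ ∞ (curv G a) := by
  have hd : ContDiff ℝ ∞ (fderiv ℝ a) := ha.fderiv_right (by simp)
  exact (hd.sub hd.clm_flip').add
    ((contDiff_const.clm_comp ha).clm_flip'.clm_comp ha).clm_flip'

/-- The Bianchi identity. -/
theorem bianchi {a : W → W →L[ℝ] E} (ha : ContDiff ℝ ∞ a) (w u v z : W) :
    (fderiv ℝ (curv G a) w u v z + lieBrL E G (a w u) (curv G a w v z)) +
    (fderiv ℝ (curv G a) w v z u + lieBrL E G (a w v) (curv G a w z u)) +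
    (fderiv ℝ (curv G a) w z u v + lieBrL E G (a w z) (curv G a w u v)) = 0 := by
  have hd : ContDiff ℝ ∞ (fderiv ℝ a) := ha.fderiv_right (by simp)
  have key : ∀ u v z, fderiv ℝ (curv G a) w u v z =
      fderiv ℝ (fderiv ℝ a) w u v z - fderiv ℝ (fderiv ℝ a) w u z v +
      (lieBrL E G (fderiv ℝ a w u v) (a w z) + lieBrL E G (a w v) (fderiv ℝ a w u z)) := by
    intro u v z
    have h1 : fderiv ℝ (fun y => curv G a y v z) w u = fderiv ℝ (curv G a) w u v z := by
      have hc : HasFDerivAt (fun y => curv G a y v z) _ w :=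
        ((((contDiff_curv ha).differentiable (by simp)) w).hasFDerivAt.clm_apply
          (hasFDerivAt_const v w)).clm_apply (hasFDerivAt_const z w)
      rw [hc.fderiv]; simp
    rw [← h1]
    simp only [curv_apply]
    have hD := ((hd.differentiable (by simp)) w).hasFDerivAt
    have hA := ((ha.differentiable (by simp)) w).hasFDerivAt
    have e1 : ∀ v z : W, HasFDerivAt (fun y => fderiv ℝ a y v z) _ w := fun v z =>
      (hD.clm_apply (hasFDerivAt_const v w)).clm_apply (hasFDerivAt_const z w)
    have e2 : HasFDerivAt (fun y => lieBrL E G (a y v) (a y z)) _ w :=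
      ((hasFDerivAt_const (lieBrL E G) w).clm_apply (hA.clm_apply (hasFDerivAt_const v w))).clm_apply
        (hA.clm_apply (hasFDerivAt_const z w))
    rw [HasFDerivAt.fderiv (((e1 v z).fun_sub (e1 z v)).fun_add e2)]
    simp
    abel
  -- In the cyclic sum the second derivatives of `a` cancel by symmetry, the terms with one
  -- derivative cancel by antisymmetry of the bracket, and the cubic terms by the Jacobi identity.
  have sy : ∀ u v, fderiv ℝ (fderiv ℝ a) w u v = fderiv ℝ (fderiv ℝ a) w v u := fun u v =>
    (ha.contDiffAt.isSymmSndFDerivAt minSmoothness_two_le).eq u v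
  simp only [key, curv_apply, map_add, map_sub]
  rw [sy v u, sy z u, sy z v]
  have J : lieBrL E G (a w u) (lieBrL E G (a w v) (a w z)) +
      lieBrL E G (a w v) (lieBrL E G (a w z) (a w u)) +
      lieBrL E G (a w z) (lieBrL E G (a w u) (a w v)) = 0 := by
    rw [lieBrL_leibniz (a w u) (a w v) (a w z), lieBrL_swap (lieBrL E G (a w u) (a w v)),
      lieBrL_swap (a w u) (a w z), map_neg]
    abel
  rw [lieBrL_swap (fderiv ℝ a w u v), lieBrL_swap (fderiv ℝ a w v z),
    lieBrL_swap (fderiv ℝ a w z u)]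
  refine Eq.trans ?_ J
  abel

end Forms

/-! ### Chern–Weil forms: closedness, naturality, gauge invariance -/

section CW
variable {E : Type*} [NormedAddCommGroup E] [NormedSpace ℝ E]
  {G : Type*} [TopologicalSpace G] [ChartedSpace E G] [Group G] [LieGroup 𝓘(ℝ, E) ∞ G]
  {W : Type*} [NormedAddCommGroup W] [NormedSpace ℝ W]
  {V : Type*} [NormedAddCommGroup V] [NormedSpace ℝ V]

/-- The entries of `f(F, …, F)` depend linearly on each vector. -/
theorem exists_update_blocks (F : W →L[ℝ] W →L[ℝ] E) {k : ℕ} (v : Fin (2 * k) → W) (p : Fin (2 * k)) :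
    ∃ (a : Fin k) (A : W →L[ℝ] E), ∀ x,
      (fun i : Fin k => F (Function.update v p x ⟨2 * i, by omega⟩)
        (Function.update v p x ⟨2 * i + 1, by omega⟩)) =
      Function.update (fun i : Fin k => F (v ⟨2 * i, by omega⟩) (v ⟨2 * i + 1, by omega⟩)) a (A x) := by
  obtain ⟨p, hp⟩ := p
  rcases Nat.even_or_odd' p with ⟨c, rfl | rfl⟩
  · refine ⟨⟨c, by omega⟩, F.flip (v ⟨2 * c + 1, by omega⟩), fun x => ?_⟩
    funext i
    by_cases hi : i = ⟨c, by omega⟩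
    · subst hi
      rw [Function.update_self, Function.update_self, Function.update_of_ne (by simp [Fin.ext_iff])]
      rfl
    · have : (i : ℕ) ≠ c := fun h => hi (Fin.ext h)
      rw [Function.update_of_ne hi, Function.update_of_ne (by simp only [ne_eq, Fin.mk.injEq]; omega),
        Function.update_of_ne (by simp only [ne_eq, Fin.mk.injEq]; omega)]
  · refine ⟨⟨c, by omega⟩, F (v ⟨2 * c, by omega⟩), fun x => ?_⟩
    funext i
    by_cases hi : i = ⟨c, by omega⟩
    · subst hi
      rw [Function.update_self, Function.update_self, Function.update_of_ne (by simp [Fin.ext_iff])]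
    · have : (i : ℕ) ≠ c := fun h => hi (Fin.ext h)
      rw [Function.update_of_ne hi, Function.update_of_ne (by simp only [ne_eq, Fin.mk.injEq]; omega),
        Function.update_of_ne (by simp only [ne_eq, Fin.mk.injEq]; omega)]

/-- `f(F, …, F)` as a multilinear map, without alternation. -/
def polyMultilinear {k : ℕ} (f : InvariantPolynomial E G k) (F : W →L[ℝ] W →L[ℝ] E) :
    ContinuousMultilinearMap ℝ (fun _ : Fin (2 * k) => W) ℝ where
  toFun := polyTensor f (fun u v => F u v)
  map_update_add' := by
    intro inst v p x y
    rw [Subsingleton.elim inst (instDecidableEqFin (2 * k))]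
    obtain ⟨a, A, h⟩ := exists_update_blocks F v p
    simp only [polyTensor, h, map_add, f.toMap.map_update_add]
  map_update_smul' := by
    intro inst v p c x
    rw [Subsingleton.elim inst (instDecidableEqFin (2 * k))]
    obtain ⟨a, A, h⟩ := exists_update_blocks F v p
    simp only [polyTensor, h, map_smul, f.toMap.map_update_smul]
  cont := by
    refine f.toMap.cont.comp (continuous_pi fun i => ?_)
    exact (F.continuous.comp (continuous_apply _)).clm_apply (continuous_apply _)

/-- The Chern–Weil form `Σ sign(σ) f(F, …, F)`. -/
def cwForm {k : ℕ} (f : InvariantPolynomial E G k) (F : W →L[ℝ] W →L[ℝ] E) :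
    W [⋀^Fin (2 * k)]→L[ℝ] ℝ :=
  ContinuousMultilinearMap.alternatization (polyMultilinear f F)

theorem cwForm_apply {k : ℕ} (f : InvariantPolynomial E G k) (F : W →L[ℝ] W →L[ℝ] E)
    (v : Fin (2 * k) → W) : cwForm f F v = altSum (polyTensor f (fun u v => F u v)) v := by
  rw [cwForm, ContinuousMultilinearMap.alternatization_apply_apply, altSum]
  refine Finset.sum_congr rfl fun σ _ => ?_
  rw [Units.smul_def, zsmul_eq_mul]
  rfl

theorem hasFDerivAt_polyTensor {k : ℕ} (f : InvariantPolynomial E G k) {F : V → W →L[ℝ] W →L[ℝ] E}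
    {x : V} (hF : DifferentiableAt ℝ F x) (w : Fin (2 * k) → W) :
    HasFDerivAt (fun y => polyTensor f (fun u v => F y u v) w)
      ((f.toMap.linearDeriv fun i => F x (w ⟨2 * i, by omega⟩) (w ⟨2 * i + 1, by omega⟩)).comp
        (ContinuousLinearMap.pi fun i : Fin k => ((fderiv ℝ F x).flip (w ⟨2 * i, by omega⟩)).flip
          (w ⟨2 * i + 1, by omega⟩))) x := by
  have hb : HasFDerivAt (fun y => fun i : Fin k => F y (w ⟨2 * i, by omega⟩) (w ⟨2 * i + 1, by omega⟩))
    (ContinuousLinearMap.pi fun i : Fin k => ((fderiv ℝ F x).flip (w ⟨2 * i, by omega⟩)).flip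
          (w ⟨2 * i + 1, by omega⟩)) x := by
    refine hasFDerivAt_pi.2 fun i => ?_
    have := (hF.hasFDerivAt.clm_apply (hasFDerivAt_const (w ⟨2 * i, by omega⟩) x)).clm_apply
      (hasFDerivAt_const (w ⟨2 * i + 1, by omega⟩) x)
    convert this using 1
    ext; simp
  exact (f.toMap.hasFDerivAt _).comp x hb

theorem contDiff_cwForm [FiniteDimensional ℝ W] {k : ℕ} (f : InvariantPolynomial E G k)
    {F : V → W →L[ℝ] W →L[ℝ] E} (hF : ContDiff ℝ ∞ F) : ContDiff ℝ ∞ (fun y => cwForm f (F y)) := by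
  refine contDiff_alternating_of_apply fun v => ?_
  simp only [cwForm_apply, altSum]
  refine ContDiff.sum fun σ _ => contDiff_const.mul ?_
  refine f.toMap.contDiff.comp (contDiff_pi.2 fun i => ?_)
  exact (hF.clm_apply contDiff_const).clm_apply contDiff_const

theorem cwForm_Ad {k : ℕ} (f : InvariantPolynomial E G k) (F F' : W →L[ℝ] W →L[ℝ] E) (g : G)
    (h : ∀ u v, F' u v = Ad E g (F u v)) : cwForm f F' = cwForm f F := by
  ext v
  rw [cwForm_apply, cwForm_apply]
  congr 1
  funext w
  simp only [polyTensor, h]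
  exact f.invariant g _

theorem cwForm_comp {k : ℕ} (f : InvariantPolynomial E G k) (F : W →L[ℝ] W →L[ℝ] E)
    (F' : V →L[ℝ] V →L[ℝ] E) (L : V →L[ℝ] W) (h : ∀ u v, F' u v = F (L u) (L v)) :
    cwForm f F' = (cwForm f F).compContinuousLinearMap L := by
  ext v
  rw [cwForm_apply, ContinuousAlternatingMap.compContinuousLinearMap_apply, cwForm_apply]
  simp only [altSum, polyTensor, h]
  rfl

/-- An alternating sum vanishes if the sum over the cyclic permutations of three entries does. -/
theorem altSum_eq_zero_of_cyclic {d : ℕ} {p q r : Fin d} (hpq : p ≠ q) (hqr : q ≠ r)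
    (T : (Fin d → W) → ℝ)
    (h : ∀ w, T w + T (fun i => w ((Equiv.swap p q * Equiv.swap q r) i)) +
      T (fun i => w ((Equiv.swap p q * Equiv.swap q r) ((Equiv.swap p q * Equiv.swap q r) i))) = 0)
    (v : Fin d → W) : altSum T v = 0 := by
  -- A 3-cycle is even, so the alternating sums of the three terms in `h` coincide.
  set c := Equiv.swap p q * Equiv.swap q r with hc
  have hs : ((Equiv.Perm.sign c : ℤ) : ℝ) = 1 := by
    rw [hc, Equiv.Perm.sign_mul, Equiv.Perm.sign_swap hpq, Equiv.Perm.sign_swap hqr]; simp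
  have e1 := altSum_comp_perm c T v
  have e2 := altSum_comp_perm (c * c) T v
  rw [Equiv.Perm.sign_mul, Units.val_mul, Int.cast_mul, hs, one_mul, one_mul] at e2
  rw [hs, one_mul] at e1
  have e3 : altSum (fun w => T w + T (fun i => w (c i)) + T (fun i => w (c (c i)))) v = 0 := by
    simp only [h]; simp [altSum]
  rw [altSum_add, altSum_add, e1] at e3
  simp only [Equiv.Perm.coe_mul, Function.comp_apply] at e2
  rw [e2] at e3
  linarith

/-- The Chern–Weil forms are closed. -/
theorem extDeriv_cwForm [FiniteDimensional ℝ W] {k : ℕ} (f : InvariantPolynomial E G k)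
    {a : W → W →L[ℝ] E} (ha : ContDiff ℝ ∞ a) (x : W) :
    extDeriv (fun y => cwForm f (curv G a y)) x = 0 := by
  have hF := contDiff_curv (G := G) ha
  ext v
  rw [extDeriv_apply ((contDiff_cwForm f hF).differentiable (by simp) x)]
  have hT : ∀ w : Fin (2 * k) → W, ∀ u, fderiv ℝ (fun y => cwForm f (curv G a y) w) x u =
      altSum (fun w : Fin (2 * k) → W => ∑ l : Fin k, f.toMap (Function.update
        (fun i : Fin k => curv G a x (w ⟨2 * i, by omega⟩) (w ⟨2 * i + 1, by omega⟩)) l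
        (fderiv ℝ (curv G a) x u (w ⟨2 * l, by omega⟩) (w ⟨2 * l + 1, by omega⟩)))) w := by
    intro w u
    simp only [cwForm_apply, altSum]
    have : HasFDerivAt (fun y => ∑ σ : Equiv.Perm (Fin (2 * k)), ((Equiv.Perm.sign σ : ℤ) : ℝ) *
        polyTensor f (fun u v => curv G a y u v) (fun i => w (σ i))) _ x :=
      HasFDerivAt.fun_sum fun σ _ => (hasFDerivAt_polyTensor f (hF.differentiable (by simp) x)
        (fun i => w (σ i))).const_mul _
    rw [this.fderiv]
    simp [ContinuousMultilinearMap.linearDeriv_apply]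
  simp only [hT]
  let S : (Fin (2 * k + 1) → W) → ℝ := fun w => ∑ l : Fin k, f.toMap (Function.update
        (fun i : Fin k => curv G a x (w ⟨2 * i + 1, by omega⟩) (w ⟨2 * i + 2, by omega⟩)) l
        (fderiv ℝ (curv G a) x (w 0) (w ⟨2 * l + 1, by omega⟩) (w ⟨2 * l + 2, by omega⟩)))
  have e1 : altSum S v = 0 := by
    -- By infinitesimal invariance of `f` the ordinary derivative of the curvature may be replaced
    -- by its covariant derivative.
    have h0 : ∀ w, S w = ∑ l : Fin k, f.toMap (Function.update
        (fun i : Fin k => curv G a x (w ⟨2 * i + 1, by omega⟩) (w ⟨2 * i + 2, by omega⟩)) l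
        (fderiv ℝ (curv G a) x (w 0) (w ⟨2 * l + 1, by omega⟩) (w ⟨2 * l + 2, by omega⟩) +
        lieBrL E G (a x (w 0)) (curv G a x (w ⟨2 * l + 1, by omega⟩) (w ⟨2 * l + 2, by omega⟩)))) := by
      intro w
      simp only [f.toMap.map_update_add, Finset.sum_add_distrib]
      rw [f.sum_lieBrL (a x (w 0)) (fun i : Fin k => curv G a x (w ⟨2 * i + 1, by omega⟩)
        (w ⟨2 * i + 2, by omega⟩)), add_zero]
    rw [funext h0, altSum_sum]
    refine Finset.sum_eq_zero fun l _ => ?_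
    have n1 : (0 : Fin (2 * k + 1)) ≠ ⟨2 * l + 1, by omega⟩ := by simp [Fin.ext_iff]
    have n2 : (⟨2 * l + 1, by omega⟩ : Fin (2 * k + 1)) ≠ ⟨2 * l + 2, by omega⟩ := by
      simp [Fin.ext_iff]
    have n3 : (0 : Fin (2 * k + 1)) ≠ ⟨2 * l + 2, by omega⟩ := by simp [Fin.ext_iff]
    -- For each `l`, the three vectors in the differentiated factor are permuted cyclically. The
    -- other factors do not change, and the three terms add up to the Bianchi identity.
    refine altSum_eq_zero_of_cyclic n1 n2 _ (fun w => ?_) v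
    set c := Equiv.swap (0 : Fin (2 * k + 1)) ⟨2 * l + 1, by omega⟩ *
      Equiv.swap ⟨2 * l + 1, by omega⟩ ⟨2 * l + 2, by omega⟩ with hc
    have c0 : c 0 = ⟨2 * l + 1, by omega⟩ := by
      rw [hc, Equiv.Perm.mul_apply, Equiv.swap_apply_of_ne_of_ne n1 n3, Equiv.swap_apply_left]
    have c1 : c ⟨2 * l + 1, by omega⟩ = ⟨2 * l + 2, by omega⟩ := by
      rw [hc, Equiv.Perm.mul_apply, Equiv.swap_apply_left,
        Equiv.swap_apply_of_ne_of_ne n3.symm n2.symm]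
    have c2 : c ⟨2 * l + 2, by omega⟩ = 0 := by
      rw [hc, Equiv.Perm.mul_apply, Equiv.swap_apply_right, Equiv.swap_apply_right]
    have co : ∀ p : Fin (2 * k + 1), (p : ℕ) ≠ 0 → (p : ℕ) ≠ 2 * l + 1 → (p : ℕ) ≠ 2 * l + 2 →
        c p = p := by
      intro p h0 h1 h2
      have g0 : p ≠ 0 := fun h => h0 (by rw [h]; rfl)
      have g1 : p ≠ ⟨2 * l + 1, by omega⟩ := fun h => h1 (by rw [h])
      have g2 : p ≠ ⟨2 * l + 2, by omega⟩ := fun h => h2 (by rw [h])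
      rw [hc, Equiv.Perm.mul_apply, Equiv.swap_apply_of_ne_of_ne g1 g2,
        Equiv.swap_apply_of_ne_of_ne g0 g1]
    have hb : ∀ (B : Fin k → E) (y : E), (∀ i, i ≠ l → B i = curv G a x (w ⟨2 * i + 1, by omega⟩)
        (w ⟨2 * i + 2, by omega⟩)) → Function.update B l y = Function.update
          (fun i : Fin k => curv G a x (w ⟨2 * i + 1, by omega⟩) (w ⟨2 * i + 2, by omega⟩)) l y := by
      intro B y hB
      funext i
      by_cases hi : i = l
      · subst hi; simp
      · rw [Function.update_of_ne hi, Function.update_of_ne hi, hB i hi]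
    have hne : ∀ i : Fin k, i ≠ l → (i : ℕ) ≠ l := fun i hi h => hi (Fin.ext h)
    rw [hb (fun i : Fin k => curv G a x (w (c _)) (w (c _))) _ (fun i hi => by
        have := hne i hi
        rw [co ⟨2 * i + 1, by omega⟩ (by simp) (by simp; omega) (by simp; omega),
          co ⟨2 * i + 2, by omega⟩ (by simp) (by simp; omega) (by simp; omega)]),
      hb (fun i : Fin k => curv G a x (w (c (c _))) (w (c (c _)))) _ (fun i hi => by
        have := hne i hi
        rw [co ⟨2 * i + 1, by omega⟩ (by simp) (by simp; omega) (by simp; omega),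
          co ⟨2 * i + 2, by omega⟩ (by simp) (by simp; omega) (by simp; omega),
          co ⟨2 * i + 1, by omega⟩ (by simp) (by simp; omega) (by simp; omega),
          co ⟨2 * i + 2, by omega⟩ (by simp) (by simp; omega) (by simp; omega)])]
    simp only [c0, c1, c2]
    rw [← f.toMap.map_update_add, ← f.toMap.map_update_add, bianchi ha]
    exact f.toMap.map_coord_zero l (by simp)
  -- Expanding `altSum S v` by the vector in the direction of differentiation reproduces the
  -- exterior derivative term by term.
  rw [altSum_succ] at e1
  change _ = (0 : ℝ)
  rw [← e1]
  refine Finset.sum_congr rfl fun i _ => ?_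
  rw [zsmul_eq_mul, Int.cast_pow, Int.cast_neg, Int.cast_one]
  rfl

/-- The pullback of a `𝔤`-valued `1`-form. -/
def pull (h : V → W) (a : W → W →L[ℝ] E) (y : V) : V →L[ℝ] E := (a (h y)).comp (fderiv ℝ h y)

/-- The only term that is not tensorial contains the second derivative of `h`; being symmetric, it
drops out of the antisymmetrisation. -/
theorem curv_pull {h : V → W} (hh : ContDiff ℝ ∞ h) {a : W → W →L[ℝ] E} (ha : ContDiff ℝ ∞ a)
    (y u v : V) : curv G (pull h a) y u v = curv G a (h y) (fderiv ℝ h y u) (fderiv ℝ h y v) := by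
  have hd : HasFDerivAt (pull h a) _ y := HasFDerivAt.clm_comp
    (((ha.differentiable (by simp)) (h y)).hasFDerivAt.comp y
      ((hh.differentiable (by simp)) y).hasFDerivAt)
    ((((hh.fderiv_right (m := ∞) (by simp)).differentiable (by simp)) y).hasFDerivAt)
  have hs := (hh.contDiffAt (x := y)).isSymmSndFDerivAt minSmoothness_two_le
  rw [curv_apply, curv_apply, hd.fderiv]
  simp [pull, hs.eq u v]

/-- The gauge transform `ad(c⁻¹) a + c⁻¹ dc`. -/
def gaugeTransform (c : W → G) (a : W → W →L[ℝ] E) (w : W) : W →L[ℝ] E :=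
  (Ad E (c w)⁻¹).comp (a w) + groupLogDeriv E c w

theorem Ad_inv_Ad (g : G) (ξ : E) : Ad E g⁻¹ (Ad E g ξ) = ξ :=
  congrArg (fun L => L ξ) (Ad_inv_comp (E := E) g)

/-- The derivative of `Ad (c w) ∘ Ad (c w)⁻¹ = id`. -/
theorem fderiv_Ad_inv {c : W → G} (hc : ContMDiff 𝓘(ℝ, W) 𝓘(ℝ, E) ∞ c) (w u : W) (ξ : E) :
    fderiv ℝ (fun w => Ad E (c w)⁻¹) w u ξ =
      - lieBrL E G (groupLogDeriv E c w u) (Ad E (c w)⁻¹ ξ) := by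
  have h1 := (((contDiff_Ad hc).1.differentiable (by simp)) w).hasFDerivAt
  have h2 := (((contDiff_Ad hc.inv).1.differentiable (by simp)) w).hasFDerivAt
  have h3 := h1.clm_comp h2
  simp only [Ad_comp_inv] at h3
  have h4 := congrArg (fun L => Ad E (c w)⁻¹ (L u ξ))
    (h3.unique (hasFDerivAt_const (ContinuousLinearMap.id ℝ E) w))
  simp [(contDiff_Ad hc).2, Ad_inv_Ad, lieBr_eq_lieBrL] at h4
  exact eq_neg_of_add_eq_zero_left h4

/-- The Maurer–Cartan equation removes the terms quadratic in `c⁻¹ dc`. The derivative of `Ad (c⁻¹)`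
cancels the mixed brackets of `c⁻¹ dc` with the transformed `a`. -/
theorem curv_gaugeTransform {c : W → G} (hc : ContMDiff 𝓘(ℝ, W) 𝓘(ℝ, E) ∞ c) {a : W → W →L[ℝ] E}
    (ha : ContDiff ℝ ∞ a) (w u v : W) :
    curv G (gaugeTransform c a) w u v = Ad E (c w)⁻¹ (curv G a w u v) := by
  have h2 := (((contDiff_Ad hc.inv).1.differentiable (by simp)) w).hasFDerivAt
  have h3 : HasFDerivAt (gaugeTransform c a) _ w := (h2.clm_comp ((ha.differentiable (by simp)) w).hasFDerivAt).add
    (((contDiff_groupLogDeriv hc).differentiable (by simp)) w).hasFDerivAt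
  have hm := fderiv_groupLogDeriv_sub hc w u v
  have hi := fun u ξ => fderiv_Ad_inv hc w u ξ
  simp only [lieBr_eq_lieBrL] at hm
  rw [curv_apply, curv_apply, h3.fderiv]
  have hm' : fderiv ℝ (groupLogDeriv E c) w u v = fderiv ℝ (groupLogDeriv E c) w v u
      - lieBrL E G (groupLogDeriv E c w u) (groupLogDeriv E c w v) := by
    rw [eq_sub_iff_add_eq, ← sub_eq_zero, ← sub_eq_zero.2 hm]; abel
  simp [gaugeTransform, hi, hm', Ad_lieBrL]
  rw [lieBrL_swap (Ad E (c w)⁻¹ (a w u)) (groupLogDeriv E c w v)]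
  abel

end CW

/-! ### Integration over an interval and the homotopy formula -/

section FibreIntegral

variable {X : Type*} [NormedAddCommGroup X] [NormedSpace ℝ X]
  {Y : Type*} [NormedAddCommGroup Y] [NormedSpace ℝ Y]

/-- The derivative of `f` is bounded on the compact product of the interval with a closed ball,
which supplies a constant dominating function. -/
theorem hasFDerivAt_intervalIntegral [FiniteDimensional ℝ X] {f : ℝ × X → ℝ} (hf : ContDiff ℝ ∞ f)
    (a b : ℝ) (x : X) :
    HasFDerivAt (fun x => ∫ t in a..b, f (t, x))
      (∫ t in a..b, (fderiv ℝ f (t, x)).comp (ContinuousLinearMap.inr ℝ ℝ X)) x := by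
  have : ProperSpace X := FiniteDimensional.proper_real X
  have hc : Continuous (fun z : ℝ × X => (fderiv ℝ f z).comp (ContinuousLinearMap.inr ℝ ℝ X)) :=
    (hf.continuous_fderiv (by simp)).clm_comp continuous_const
  obtain ⟨C, hC⟩ := ((isCompact_uIcc (a := a) (b := b)).prod
    (isCompact_closedBall x 1)).exists_bound_of_continuousOn hc.continuousOn
  refine intervalIntegral.hasFDerivAt_integral_of_dominated_of_fderiv_le (bound := fun _ => C)
    (F' := fun x t => (fderiv ℝ f (t, x)).comp (ContinuousLinearMap.inr ℝ ℝ X))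
    (Metric.closedBall_mem_nhds x one_pos) ?_ ?_ ?_ ?_ ?_ ?_
  · exact Eventually.of_forall fun y =>
      (hf.continuous.comp (by fun_prop : Continuous fun t : ℝ => (t, y))).aestronglyMeasurable
  · exact (hf.continuous.comp (by fun_prop : Continuous fun t : ℝ => (t, x))).intervalIntegrable _ _
  · exact (hc.comp (by fun_prop : Continuous fun t : ℝ => (t, x))).aestronglyMeasurable
  · exact Eventually.of_forall fun t ht y hy => hC (t, y) ⟨Set.uIoc_subset_uIcc ht, hy⟩
  · exact intervalIntegrable_const
  · refine Eventually.of_forall fun t _ y _ => ?_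
    exact ((hf.differentiable (by simp)) (t, y)).hasFDerivAt.comp y (hasFDerivAt_prodMk_right t y)

theorem fderiv_intervalIntegral_apply [FiniteDimensional ℝ X] {f : ℝ × X → ℝ} (hf : ContDiff ℝ ∞ f)
    (a b : ℝ) (x u : X) :
    fderiv ℝ (fun x => ∫ t in a..b, f (t, x)) x u = ∫ t in a..b, fderiv ℝ f (t, x) (0, u) := by
  have hc : Continuous (fun z : ℝ × X => (fderiv ℝ f z).comp (ContinuousLinearMap.inr ℝ ℝ X)) :=
    (hf.continuous_fderiv (by simp)).clm_comp continuous_const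
  rw [(hasFDerivAt_intervalIntegral hf a b x).fderiv]
  have := (ContinuousLinearMap.apply ℝ ℝ u).intervalIntegral_comp_comm
    ((hc.comp (by fun_prop : Continuous fun t : ℝ => (t, x))).intervalIntegrable
      (μ := MeasureTheory.volume) a b)
  simpa using this.symm

/-- Induction on the order, for all `f` at once: each directional derivative of the integral is
again an integral of a smooth function. -/
theorem contDiff_intervalIntegral [FiniteDimensional ℝ X] {f : ℝ × X → ℝ} (hf : ContDiff ℝ ∞ f)
    (a b : ℝ) : ContDiff ℝ ∞ (fun x => ∫ t in a..b, f (t, x)) := by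
  refine contDiff_infty.2 fun n => ?_
  induction n generalizing f with
  | zero =>
    refine contDiff_zero.2 ?_
    have hd : Differentiable ℝ (fun x => ∫ t in a..b, f (t, x)) := fun x =>
      (hasFDerivAt_intervalIntegral hf a b x).differentiableAt
    exact hd.continuous
  | succ n ih =>
    push_cast
    refine contDiff_succ_iff_fderiv_apply.2 ⟨fun x =>
      (hasFDerivAt_intervalIntegral hf a b x).differentiableAt, by simp, fun u => ?_⟩
    simp only [fderiv_intervalIntegral_apply hf]
    exact ih (f := fun z => fderiv ℝ f z (0, u))
      ((hf.fderiv_right (m := ∞) (by simp)).clm_apply contDiff_const)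

/-- The pullback of a form. -/
def formPull {d : ℕ} (h : Y → X) (η : X → X [⋀^Fin d]→L[ℝ] ℝ) (y : Y) : Y [⋀^Fin d]→L[ℝ] ℝ :=
  (η (h y)).compContinuousLinearMap (fderiv ℝ h y)

theorem formPull_apply {d : ℕ} (h : Y → X) (η : X → X [⋀^Fin d]→L[ℝ] ℝ) (y : Y) (v : Fin d → Y) :
    formPull h η y v = η (h y) (fun i => fderiv ℝ h y (v i)) := rfl

theorem formPull_slice {d : ℕ} (η : ℝ × X → (ℝ × X) [⋀^Fin d]→L[ℝ] ℝ) (t : ℝ) (x : X)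
    (v : Fin d → X) : formPull (fun x => (t, x)) η x v = η (t, x) (fun i => (0, v i)) := by
  rw [formPull_apply, (hasFDerivAt_prodMk_right t x).fderiv]
  rfl

theorem ContDiffAt.alternating_apply [FiniteDimensional ℝ X] {V : Type*} [NormedAddCommGroup V]
    [NormedSpace ℝ V] {d : ℕ} {α : V → X [⋀^Fin d]→L[ℝ] ℝ} {u : Fin d → V → X} {x : V}
    (hα : ContDiffAt ℝ ∞ α x) (hu : ∀ i, ContDiffAt ℝ ∞ (u i) x) :
    ContDiffAt ℝ ∞ (fun y => α y (fun i => u i y)) x := by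
  let b := Module.finBasis ℝ X
  have e : ∀ y, α y (fun i => u i y) = ∑ r : Fin d → Fin (Module.finrank ℝ X),
      (∏ i, b.repr (u i y) (r i)) • α y (fun i => b (r i)) := by
    intro y
    have h1 : (fun i => u i y) = fun i => ∑ l, b.repr (u i y) l • b l :=
      funext fun i => (b.sum_repr _).symm
    rw [h1]
    have h2 := (α y).toMultilinearMap.map_sum (fun i l => b.repr (u i y) l • b l)
    refine h2.trans (Finset.sum_congr rfl fun r _ => ?_)
    exact (α y).toMultilinearMap.map_smul_univ _ _
  simp only [e]
  refine ContDiffAt.sum fun r _ => ContDiffAt.fun_smul (contDiffAt_prod fun i _ => ?_)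
    ((ContinuousAlternatingMap.apply ℝ X ℝ fun i => b (r i)).contDiff.contDiffAt.comp x hα)
  exact (b.coord (r i)).toContinuousLinearMap.contDiff.contDiffAt.comp x (hu i)

theorem contDiff_formPull [FiniteDimensional ℝ X] [FiniteDimensional ℝ Y] {d : ℕ} {h : Y → X} (hh : ContDiff ℝ ∞ h)
    {η : X → X [⋀^Fin d]→L[ℝ] ℝ} (hη : ContDiff ℝ ∞ η) : ContDiff ℝ ∞ (formPull h η) := by
  refine contDiff_alternating_of_apply fun v => ?_
  refine contDiff_iff_contDiffAt.2 fun y => ((hη.comp hh).contDiffAt).alternating_apply fun i => ?_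
  exact ((hh.fderiv_right (m := ∞) (by simp)).clm_apply contDiff_const).contDiffAt

/-- The contraction of a form on `ℝ × X` with the first coordinate vector. -/
def contractForm {d : ℕ} (η : ℝ × X → (ℝ × X) [⋀^Fin (d + 1)]→L[ℝ] ℝ) (z : ℝ × X) :
    X [⋀^Fin d]→L[ℝ] ℝ :=
  ((η z).curryLeft (1, 0)).compContinuousLinearMap (ContinuousLinearMap.inr ℝ ℝ X)

theorem contDiff_contractForm [FiniteDimensional ℝ X] {d : ℕ}
    {η : ℝ × X → (ℝ × X) [⋀^Fin (d + 1)]→L[ℝ] ℝ} (hη : ContDiff ℝ ∞ η) :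
    ContDiff ℝ ∞ (contractForm η) :=
  contDiff_alternating_of_apply fun _ => hη.alternating_apply_const _

/-- The integral of a form over the fibres of `[a, b] × X → X`. -/
def fibreIntegral {d : ℕ} (a b : ℝ) (η : ℝ × X → (ℝ × X) [⋀^Fin (d + 1)]→L[ℝ] ℝ) (x : X) :
    X [⋀^Fin d]→L[ℝ] ℝ :=
  ∫ t in a..b, contractForm η (t, x)

variable [FiniteDimensional ℝ X] [FiniteDimensional ℝ Y] {d : ℕ}

theorem fibreIntegral_apply {η : ℝ × X → (ℝ × X) [⋀^Fin (d + 1)]→L[ℝ] ℝ} (hη : ContDiff ℝ ∞ η)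
    (a b : ℝ) (x : X) (v : Fin d → X) :
    fibreIntegral a b η x v = ∫ t in a..b, η (t, x) (Fin.cons (1, 0) fun i => (0, v i)) := by
  have := (ContinuousAlternatingMap.apply ℝ X ℝ v).intervalIntegral_comp_comm
    (((contDiff_contractForm hη).continuous.comp
      (by fun_prop : Continuous fun t : ℝ => (t, x))).intervalIntegrable
      (μ := MeasureTheory.volume) a b)
  exact this.symm

theorem fibreIntegral_zero (a b : ℝ) :
    fibreIntegral a b (0 : ℝ × X → (ℝ × X) [⋀^Fin (d + 1)]→L[ℝ] ℝ) = 0 := by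
  ext x v
  have h : ContDiff ℝ ∞ (0 : ℝ × X → (ℝ × X) [⋀^Fin (d + 1)]→L[ℝ] ℝ) := contDiff_const
  rw [fibreIntegral_apply h]
  simp

theorem fibreIntegral_sub {η η' : ℝ × X → (ℝ × X) [⋀^Fin (d + 1)]→L[ℝ] ℝ} (hη : ContDiff ℝ ∞ η)
    (hη' : ContDiff ℝ ∞ η') (a b : ℝ) (x : X) :
    fibreIntegral a b (η - η') x = fibreIntegral a b η x - fibreIntegral a b η' x := by
  have hc : ∀ {ζ : ℝ × X → (ℝ × X) [⋀^Fin (d + 1)]→L[ℝ] ℝ}, ContDiff ℝ ∞ ζ →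
      IntervalIntegrable (fun t => contractForm ζ (t, x)) MeasureTheory.volume a b := fun h =>
    ((contDiff_contractForm h).continuous.comp
      (by fun_prop : Continuous fun t : ℝ => (t, x))).intervalIntegrable a b
  rw [fibreIntegral, fibreIntegral, fibreIntegral, ← intervalIntegral.integral_sub (hc hη) (hc hη')]
  rfl

theorem contDiff_fibreIntegral {η : ℝ × X → (ℝ × X) [⋀^Fin (d + 1)]→L[ℝ] ℝ}
    (hη : ContDiff ℝ ∞ η) (a b : ℝ) : ContDiff ℝ ∞ (fibreIntegral a b η) := by
  refine contDiff_alternating_of_apply fun v => ?_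
  simp only [fibreIntegral_apply hη]
  exact contDiff_intervalIntegral (hη.alternating_apply_const _) a b

theorem fibreIntegral_formPull {h : Y → X} (hh : ContDiff ℝ ∞ h)
    {η : ℝ × X → (ℝ × X) [⋀^Fin (d + 1)]→L[ℝ] ℝ} (hη : ContDiff ℝ ∞ η) (a b : ℝ) :
    fibreIntegral a b (formPull (Prod.map id h) η) = formPull h (fibreIntegral a b η) := by
  have hm : ContDiff ℝ ∞ (Prod.map id h : ℝ × Y → ℝ × X) := contDiff_id.prodMap hh
  ext y v
  rw [fibreIntegral_apply (contDiff_formPull hm hη), formPull_apply, fibreIntegral_apply hη]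
  refine intervalIntegral.integral_congr fun t _ => ?_
  have hd : HasFDerivAt (Prod.map id h : ℝ × Y → ℝ × X)
      ((ContinuousLinearMap.id ℝ ℝ).prodMap (fderiv ℝ h y)) (t, y) :=
    HasFDerivAt.prodMap (t, y) (hasFDerivAt_id t) ((hh.differentiable (by simp)) y).hasFDerivAt
  simp only [formPull_apply, hd.fderiv]
  refine congrArg (η (t, h y)) (funext fun i => ?_)
  refine Fin.cases ?_ (fun i => ?_) i <;> simp

/-- The term that differentiates along the interval is separated from the others; moving `(1, 0)`
into the first slot shifts the index and accounts for the minus sign. Integration turns these into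
the boundary terms and the differential of the fibre integral. -/
theorem extDeriv_cons_apply {η : ℝ × X → (ℝ × X) [⋀^Fin (d + 1)]→L[ℝ] ℝ} (hη : ContDiff ℝ ∞ η)
    (z : ℝ × X) (v : Fin (d + 1) → X) :
    extDeriv η z (Fin.cons (1, 0) fun i => (0, v i)) =
      fderiv ℝ (fun z => η z (fun i => (0, v i))) z (1, 0) -
      ∑ i : Fin (d + 1), (-1) ^ (i : ℕ) * fderiv ℝ
        (fun z => η z (Fin.cons (1, 0) fun l => (0, i.removeNth v l))) z (0, v i) := by
  rw [extDeriv_apply ((hη.differentiable (by simp)) z), Fin.sum_univ_succ]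
  simp only [Fin.val_zero, pow_zero, one_smul, Fin.cons_zero, Fin.cons_succ, Fin.val_succ]
  rw [sub_eq_add_neg, ← Finset.sum_neg_distrib]
  congr 1
  refine Finset.sum_congr rfl fun i _ => ?_
  rw [zsmul_eq_mul, pow_succ]
  push_cast
  rw [mul_neg_one, neg_mul]
  congr 3
  congr 1
  funext z
  congr 1
  funext l
  refine Fin.cases ?_ (fun l => ?_) l <;> simp [Fin.removeNth]

/-- The homotopy formula. -/
theorem extDeriv_fibreIntegral {η : ℝ × X → (ℝ × X) [⋀^Fin (d + 1)]→L[ℝ] ℝ} (hη : ContDiff ℝ ∞ η)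
    (hη' : ContDiff ℝ ∞ (extDeriv η)) (a b : ℝ) (x : X) :
    extDeriv (fibreIntegral a b η) x = formPull (fun x => (b, x)) η x -
      formPull (fun x => (a, x)) η x - fibreIntegral a b (extDeriv η) x := by
  ext v
  simp only [ContinuousAlternatingMap.sub_apply, formPull_slice]
  rw [extDeriv_apply ((contDiff_fibreIntegral hη a b).differentiable (by simp) x),
    fibreIntegral_apply hη']
  simp only [fibreIntegral_apply hη, extDeriv_cons_apply hη]
  have hs : ∀ w : Fin (d + 1) → ℝ × X, ContDiff ℝ ∞ (fun z => η z w) := hη.alternating_apply_const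
  have hc : ∀ (w : Fin (d + 1) → ℝ × X) (u : ℝ × X),
      Continuous fun t : ℝ => fderiv ℝ (fun z => η z w) (t, x) u := fun w u =>
    (((hs w).continuous_fderiv (by simp)).clm_apply continuous_const).comp (by fun_prop)
  have hc' : ∀ i : Fin (d + 1), Continuous fun t : ℝ => (-1 : ℝ) ^ (i : ℕ) * fderiv ℝ
      (fun z => η z (Fin.cons (1, 0) fun l => (0, i.removeNth v l))) (t, x) (0, v i) := fun i =>
    continuous_const.mul (hc _ _)
  -- The fundamental theorem of calculus evaluates the first term; differentiation under the
  -- integral identifies the rest.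
  rw [intervalIntegral.integral_sub ((hc _ _).intervalIntegrable _ _)
    ((continuous_finsetSum _ fun i _ => hc' i).intervalIntegrable _ _),
    intervalIntegral.integral_finsetSum (fun i _ => (hc' i).intervalIntegrable _ _),
    intervalIntegral.integral_eq_sub_of_hasDerivAt (f := fun t => η (t, x) fun i => (0, v i))
      (fun t _ => by
        have := ((hs fun i => (0, v i)).differentiable (by simp) (t, x)).hasFDerivAt.comp_hasDerivAt
          t ((hasDerivAt_id t).prodMk (hasDerivAt_const t x))
        exact this) ((hc _ _).intervalIntegrable _ _)]
  rw [sub_sub_cancel]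
  refine Finset.sum_congr rfl fun i _ => ?_
  rw [fderiv_intervalIntegral_apply (hs _), intervalIntegral.integral_const_mul, zsmul_eq_mul]
  push_cast
  rfl

/-- The homotopy formula in degree `0`. -/
theorem fibreIntegral_extDeriv_zero {η : ℝ × X → (ℝ × X) [⋀^Fin 0]→L[ℝ] ℝ} (hη : ContDiff ℝ ∞ η)
    (hη' : ContDiff ℝ ∞ (extDeriv η)) (a b : ℝ) (x : X) :
    fibreIntegral a b (extDeriv η) x = formPull (fun x => (b, x)) η x -
      formPull (fun x => (a, x)) η x := by
  ext v
  simp only [ContinuousAlternatingMap.sub_apply, formPull_slice]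
  rw [fibreIntegral_apply hη']
  have hs := hη.alternating_apply_const fun i => ((0 : ℝ), v i)
  have hc : Continuous fun t : ℝ => fderiv ℝ (fun z => η z fun i => (0, v i)) (t, x) (1, 0) :=
    ((hs.continuous_fderiv (by simp)).clm_apply continuous_const).comp (by fun_prop)
  rw [← intervalIntegral.integral_eq_sub_of_hasDerivAt (f := fun t => η (t, x) fun i => (0, v i))
      (fun t _ => by
        have := (hs.differentiable (by simp) (t, x)).hasFDerivAt.comp_hasDerivAt
          t ((hasDerivAt_id t).prodMk (hasDerivAt_const t x))
        exact this) (hc.intervalIntegrable _ _)]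
  refine intervalIntegral.integral_congr fun t _ => ?_
  rw [extDeriv_apply ((hη.differentiable (by simp)) _)]
  simp only [Fin.sum_univ_succ, Fin.sum_univ_zero, Fin.val_zero, pow_zero, one_smul, add_zero, Fin.cons_zero]
  congr 3

theorem contDiff_extDeriv {η : X → X [⋀^Fin d]→L[ℝ] ℝ} (hη : ContDiff ℝ ∞ η) :
    ContDiff ℝ ∞ (extDeriv η) := by
  refine contDiff_alternating_of_apply fun v => ?_
  simp only [extDeriv_apply ((hη.differentiable (by simp)) _)]
  exact ContDiff.sum fun i _ => (((hη.alternating_apply_const _).fderiv_right (m := ∞)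
      (by simp)).clm_apply contDiff_const).const_smul _

end FibreIntegral

/-! ### The form `A + Φ dθ` and its change under loops -/

namespace LoopBundle

open Diffeology

variable {m : ℕ} {M : Type*} [TopologicalSpace M] [ChartedSpace (Cartesian m) M]
  {E : Type*} [NormedAddCommGroup E] [NormedSpace ℝ E]
  {G : Type*} [TopologicalSpace G] [ChartedSpace E G] [Group G] [LieGroup 𝓘(ℝ, E) ∞ G]
  {B : Set ℝ} {P : LoopBundle m M E G B}
  {T : Type*} [NormedAddCommGroup T] [NormedSpace ℝ T]
  {H : Type*} [NormedAddCommGroup H] [NormedSpace ℝ H]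
  {H' : Type*} [NormedAddCommGroup H'] [NormedSpace ℝ H']

/-! ### Change of gauge on plots -/

theorem Connection.form_congr (A : P.Connection) {n : ℕ} {p p' : Cartesian n → P.Total}
    (h : p = p') (hp : IsPlot p) (hp' : IsPlot p') : A.form p hp = A.form p' hp' := by
  subst h; rfl

theorem SmoothLoops.contMDiff_apply {n : ℕ} {c : Cartesian n → LoopGroup E G B}
    (hc : SmoothLoops c) (θ : ℝ) : ContMDiff (𝓡 n) 𝓘(ℝ, E) ∞ (fun x => (c x).toFun θ) :=
  ContMDiff.comp (g := fun z : Cartesian n × ℝ => (c z.1).toFun z.2) hc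
    (contMDiff_id.prodMk contMDiff_const)

theorem SmoothLoops.comp {n k : ℕ} {c : Cartesian n → LoopGroup E G B} (hc : SmoothLoops c)
    {h : Cartesian k → Cartesian n} (hh : ContDiff ℝ ∞ h) : SmoothLoops (fun y => c (h y)) :=
  ContMDiff.comp (g := fun z : Cartesian n × ℝ => (c z.1).toFun z.2) hc
    ((hh.contMDiff.comp contMDiff_fst).prodMk contMDiff_snd)

theorem SmoothLoops.const_mul {n : ℕ} {c : Cartesian n → LoopGroup E G B} (hc : SmoothLoops c)
    (g : LoopGroup E G B) : SmoothLoops (fun y => g * c y) :=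
  (g.smooth.comp contMDiff_snd).mul hc

theorem groupLogDeriv_eq_mfderiv_translate {n : ℕ} {c : Cartesian n → G}
    (hc : ContMDiff (𝓡 n) 𝓘(ℝ, E) ∞ c) (x v : Cartesian n) :
    (mfderiv (𝓡 n) 𝓘(ℝ, E) (fun y => (c x)⁻¹ * c (x + y)) 0 v : E) = groupLogDeriv E c x v := by
  have h1 : ContMDiffAt 𝓘(ℝ, Cartesian n) 𝓘(ℝ, E) ∞ (fun y => (c x)⁻¹ * c (x + y)) 0 :=
    (contMDiff_const.mul (hc.comp (contDiff_const.add contDiff_id).contMDiff)).contMDiffAt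
  have h2 := mfderiv_eq_fderiv_oneChart h1 (by simp)
  have h3 := groupLogDeriv_eq_fderiv (hc.contMDiffAt (x := x))
  have h4 := fderiv_comp_add_left (𝕜 := ℝ) (f := fun s => oneChart E ((c x)⁻¹ * c s)) (x := 0) x
  rw [add_zero] at h4
  rw [h3, ← h4]
  exact congrArg (fun L : Cartesian n →L[ℝ] E => L v) h2

theorem groupLogDeriv_comp {V W : Type*} [NormedAddCommGroup V] [NormedSpace ℝ V]
    [NormedAddCommGroup W] [NormedSpace ℝ W] {c : W → G} (hc : ContMDiff 𝓘(ℝ, W) 𝓘(ℝ, E) ∞ c)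
    {h : V → W} (hh : ContDiff ℝ ∞ h) (y : V) :
    groupLogDeriv E (fun y => c (h y)) y = (groupLogDeriv E c (h y)).comp (fderiv ℝ h y) := by
  rw [groupLogDeriv_eq_fderiv (hc.contMDiffAt (x := h y)),
    groupLogDeriv_eq_fderiv (c := fun y => c (h y)) ((hc.comp hh.contMDiff).contMDiffAt (x := y))]
  exact fderiv_comp (g := fun s => oneChart E ((c (h y))⁻¹ * c s)) y
    ((contDiffAt_oneChart_translate hc (h y)).differentiableAt (by simp))
    (hh.differentiable (by simp) y)

/-- The two occurrences of the variable are separated: `(y, y') ↦ p(y) · c(y')` is a plot on twice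
the dimension, and the derivative along the diagonal is the sum of the two partial ones. With `y'`
fixed equivariance applies. With `y` fixed the plot is `q · (c(x)⁻¹ c(x + y))` for `q = p(x) ·
c(x)`, to which the vertical axiom applies. -/
theorem Connection.form_act (A : P.Connection) {n : ℕ} {p : Cartesian n → P.Total} (hp : IsPlot p)
    {c : Cartesian n → LoopGroup E G B} (hc : SmoothLoops c) (x : Cartesian n) (θ : ℝ) :
    A.form (fun y => P.act (p y) (c y)) (P.isPlot_act hp hc) x θ =
      (Ad E ((c x).toFun θ)⁻¹).comp (A.form p hp x θ) +
        groupLogDeriv E (fun y => (c y).toFun θ) x := by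
  let e : Cartesian (n + n) ≃L[ℝ] Cartesian n × Cartesian n := EuclideanSpace.finAddEquivProd
  let a : Cartesian (n + n) →L[ℝ] Cartesian n := (ContinuousLinearMap.fst ℝ _ _).comp e.toContinuousLinearMap
  let b : Cartesian (n + n) →L[ℝ] Cartesian n := (ContinuousLinearMap.snd ℝ _ _).comp e.toContinuousLinearMap
  let i : Cartesian n →L[ℝ] Cartesian (n + n) := e.symm.toContinuousLinearMap.comp
    (ContinuousLinearMap.inl ℝ _ _)
  let k : Cartesian n →L[ℝ] Cartesian (n + n) := e.symm.toContinuousLinearMap.comp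
    (ContinuousLinearMap.inr ℝ _ _)
  have ai : ∀ y, a (i y) = y := fun y => by simp [a, i]
  have ak : ∀ y, a (k y) = 0 := fun y => by simp [a, k]
  have bi : ∀ y, b (i y) = 0 := fun y => by simp [b, i]
  have bk : ∀ y, b (k y) = y := fun y => by simp [b, k]
  have hpa : IsPlot (p ∘ a) := isPlot_reparam hp a.contDiff
  have hcb : SmoothLoops (fun w => c (b w)) := hc.comp b.contDiff
  set Q : Cartesian (n + n) → P.Total := fun w => P.act ((p ∘ a) w) (c (b w)) with hQ
  have pQ : IsPlot Q := P.isPlot_act hpa hcb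
  ext v
  -- the diagonal
  have h1 := A.reparam Q pQ (fun y => i y + k y) (i.contDiff.add k.contDiff) x θ
  have d1 : fderiv ℝ (fun y => i y + k y) x = i + k := (i.hasFDerivAt.add k.hasFDerivAt).fderiv
  rw [d1, A.form_congr (p' := fun y => P.act (p y) (c y)) _ _ (P.isPlot_act hp hc)] at h1
  swap
  · funext y
    simp [hQ, map_add, ai, ak, bi, bk]
  rw [h1]
  -- the first factor
  have h2 := A.reparam Q pQ (fun y => i y + k x) (i.contDiff.add contDiff_const) x θ
  have d2 : fderiv ℝ (fun y => i y + k x) x = i := (i.hasFDerivAt.add_const _).fderiv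
  rw [d2, A.form_congr (p' := fun y => P.act (p y) (c x)) _ _
    (P.isPlot_act hp (c := fun _ => c x) ((c x).smooth.comp contMDiff_snd)),
    A.equivariant p hp (c x) x θ] at h2
  swap
  · funext y
    simp [hQ, map_add, ai, ak, bi, bk]
  -- the second factor
  have h3 := A.reparam Q pQ (fun y => i x + k (x + y))
    (contDiff_const.add (k.contDiff.comp (contDiff_const.add contDiff_id))) 0 θ
  have d3 : fderiv ℝ (fun y => i x + k (x + y)) 0 = k := by
    have : (fun y => i x + k (x + y)) = fun y => k y + (i x + k x) := by
      funext y; rw [map_add]; abel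
    rw [this]
    exact (k.hasFDerivAt.add_const _).fderiv
  have hc' : SmoothLoops (fun y => (c x)⁻¹ * c (x + y)) :=
    (hc.comp (contDiff_const.add contDiff_id)).const_mul _
  rw [d3, add_zero, A.form_congr (p' := fun y => P.act (P.act (p x) (c x)) ((c x)⁻¹ * c (x + y))) _ _
    (P.isPlot_act (p := fun _ => P.act (p x) (c x)) isPlot_const hc')] at h3
  swap
  · funext y
    simp [hQ, map_add, ai, ak, bi, bk, P.act_mul]
  have h4 := A.fundamental (P.act (p x) (c x)) _ hc' (by simp) θ v
  have h5 := groupLogDeriv_eq_mfderiv_translate (hc.contMDiff_apply θ) x v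
  have e2 := congrArg (fun L : Cartesian n →L[ℝ] E => L v) h2
  have e3 := congrArg (fun L : Cartesian n →L[ℝ] E => L v) h3
  simp only [ContinuousLinearMap.comp_apply, add_apply, map_add] at e2 e3 ⊢
  rw [e2, ← e3, h4, ← h5]
  rfl

/-! ### Families of connections and Higgs fields -/

variable (P T) in
/-- A family of pairs of a connection and a Higgs field, smoothly parametrised by `T`. -/
structure SmoothFamily where
  conn : T → P.Connection
  higgs : T → P.HiggsField
  smooth_conn : ∀ {n : ℕ} (p : Cartesian n → P.Total) (hp : IsPlot p),
    ContDiff ℝ ∞ (fun z : T × Cartesian n × ℝ => (conn z.1).form p hp z.2.1 z.2.2)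
  smooth_higgs : ∀ {n : ℕ} (p : Cartesian n → P.Total), IsPlot p →
    ContDiff ℝ ∞ (fun z : T × Cartesian n × ℝ => (higgs z.1).toFun (p z.2.1) z.2.2)

namespace SmoothFamily

/-- The `𝔤`-valued `1`-form `A + Φ dθ` on `ℝ × H`, for a plot `p` and linear maps `τ` and `π` from
`H` to the parameters and to the domain of the plot. -/
def loopForm (Γ : P.SmoothFamily T) {n : ℕ} (p : Cartesian n → P.Total) (hp : IsPlot p)
    (τ : H →L[ℝ] T) (π : H →L[ℝ] Cartesian n) (z : ℝ × H) : ℝ × H →L[ℝ] E :=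
  ((Γ.conn (τ z.2)).form p hp (π z.2) z.1).comp (π.comp (ContinuousLinearMap.snd ℝ ℝ H)) +
    (ContinuousLinearMap.fst ℝ ℝ H).smulRight ((Γ.higgs (τ z.2)).toFun (p (π z.2)) z.1)

variable (Γ : P.SmoothFamily T) {n : ℕ} {p : Cartesian n → P.Total} (hp : IsPlot p)
  (τ : H →L[ℝ] T) (π : H →L[ℝ] Cartesian n)

theorem loopForm_apply (z u : ℝ × H) : Γ.loopForm p hp τ π z u =
    (Γ.conn (τ z.2)).form p hp (π z.2) z.1 (π u.2) +
      u.1 • (Γ.higgs (τ z.2)).toFun (p (π z.2)) z.1 := rfl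

theorem contDiff_loopForm : ContDiff ℝ ∞ (Γ.loopForm p hp τ π) := by
  have hq : ContDiff ℝ ∞ (fun z : ℝ × H => (τ z.2, π z.2, z.1)) :=
    (τ.contDiff.comp contDiff_snd).prodMk ((π.contDiff.comp contDiff_snd).prodMk contDiff_fst)
  exact (((Γ.smooth_conn p hp).comp hq).clm_comp contDiff_const).add
    (contDiff_const.smulRight ((Γ.smooth_higgs p hp).comp hq))

theorem loopForm_periodic (θ : ℝ) (y : H) :
    Γ.loopForm p hp τ π (θ + 2 * Real.pi, y) = Γ.loopForm p hp τ π (θ, y) := by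
  ext u <;> simp [loopForm, (Γ.conn (τ y)).periodic p hp (π y) θ, (Γ.higgs (τ y)).periodic _ θ]

/-- Besides a reparametrisation of the plot, `ι` may act on the parameters. This covers both
naturality in the plot and restriction of a square to its sides. -/
theorem pull_loopForm {T' : Type*} [NormedAddCommGroup T'] [NormedSpace ℝ T']
    (Γ' : P.SmoothFamily T') {k : ℕ} {h : Cartesian k → Cartesian n} (hh : ContDiff ℝ ∞ h)
    (τ' : H' →L[ℝ] T') (π' : H' →L[ℝ] Cartesian k) {ι : H' → H} (hι : ContDiff ℝ ∞ ι)
    (hπ : ∀ y, π (ι y) = h (π' y)) (hconn : ∀ y, Γ'.conn (τ' y) = Γ.conn (τ (ι y)))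
    (hhiggs : ∀ y, Γ'.higgs (τ' y) = Γ.higgs (τ (ι y))) :
    Γ'.loopForm (p ∘ h) (isPlot_reparam hp hh) τ' π' =
      pull (Prod.map id ι) (Γ.loopForm p hp τ π) := by
  funext z
  have hd : HasFDerivAt (Prod.map id ι : ℝ × H' → ℝ × H)
      ((ContinuousLinearMap.id ℝ ℝ).prodMap (fderiv ℝ ι z.2)) z :=
    HasFDerivAt.prodMap z (hasFDerivAt_id z.1) ((hι.differentiable (by simp)) z.2).hasFDerivAt
  have hc : π.comp (fderiv ℝ ι z.2) = (fderiv ℝ h (π' z.2)).comp π' := by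
    have h1 := π.hasFDerivAt.comp z.2 ((hι.differentiable (by simp)) z.2).hasFDerivAt
    have h2 := ((hh.differentiable (by simp)) (π' z.2)).hasFDerivAt.comp z.2 π'.hasFDerivAt
    rw [show π ∘ ι = h ∘ π' from funext hπ] at h1
    exact h1.unique h2
  refine ContinuousLinearMap.ext fun u => ?_
  rw [pull, hd.fderiv, ContinuousLinearMap.comp_apply, loopForm_apply, loopForm_apply, hconn, hhiggs,
    (Γ.conn _).reparam p hp h hh]
  have := congrArg (fun L => L u.2) hc
  simp only [ContinuousLinearMap.comp_apply] at this
  simp [hπ, this]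

/-- The logarithmic derivative of `(θ, y) ↦ c(π y)(θ)` splits into its two partial ones. The part
along `H` is supplied by `Connection.form_act`, the part along the circle by the twisted law of the
Higgs field. -/
theorem loopForm_act {c : Cartesian n → LoopGroup E G B} (hc : SmoothLoops c) :
    Γ.loopForm (fun y => P.act (p y) (c y)) (P.isPlot_act hp hc) τ π =
      gaugeTransform (fun z : ℝ × H => (c (π z.2)).toFun z.1) (Γ.loopForm p hp τ π) := by
  funext z
  have hC : ContMDiff 𝓘(ℝ, ℝ × H) 𝓘(ℝ, E) ∞ (fun z : ℝ × H => (c (π z.2)).toFun z.1) :=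
    ContMDiff.comp (g := fun z : Cartesian n × ℝ => (c z.1).toFun z.2) hc
      ((π.contDiff.comp contDiff_snd).contMDiff.prodMk contDiff_fst.contMDiff)
  obtain ⟨θ, y⟩ := z
  have h1 := groupLogDeriv_comp hC (h := fun s : ℝ => (s, y)) (by fun_prop) θ
  have h2 := groupLogDeriv_comp hC (h := fun y : H => (θ, y)) (by fun_prop) y
  have h3 := groupLogDeriv_comp (SmoothLoops.contMDiff_apply hc θ) π.contDiff y
  rw [(hasFDerivAt_prodMk_left θ y).fderiv] at h1
  rw [(hasFDerivAt_prodMk_right θ y).fderiv] at h2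
  rw [π.fderiv] at h3
  refine ContinuousLinearMap.ext fun u => ?_
  obtain ⟨r, η⟩ := u
  have e : ((r, η) : ℝ × H) = r • ((1 : ℝ), (0 : H)) + (0, η) := by simp
  have e1 := congrArg (fun L : ℝ →L[ℝ] E => L 1) h1
  have e2 := congrArg (fun L : H →L[ℝ] E => L η) (h2.symm.trans h3)
  simp only [ContinuousLinearMap.comp_apply, ContinuousLinearMap.inl_apply,
    ContinuousLinearMap.inr_apply] at e1 e2
  have e3 : groupLogDeriv E (fun z : ℝ × H => (c (π z.2)).toFun z.1) (θ, y) (r, η) =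
      groupLogDeriv E (fun x => (c x).toFun θ) (π y) (π η) +
        r • groupLogDeriv E (c (π y)).toFun θ 1 := by
    rw [e, map_add, map_smul, ← e1, e2, add_comm]
  rw [gaugeTransform, add_apply, e3, loopForm_apply,
    (Γ.conn _).form_act hp hc, (Γ.higgs _).twisted, logDerivative_eq_groupLogDeriv]
  simp only [add_apply, ContinuousLinearMap.comp_apply, loopForm_apply, map_add,
    map_smul, smul_add]
  abel

end SmoothFamily
end LoopBundle

/-! ### Transgression, and its comparison with the string potential -/

namespace LoopBundle

open Diffeology

variable {m : ℕ} {M : Type*} [TopologicalSpace M] [ChartedSpace (Cartesian m) M]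
  {E : Type*} [NormedAddCommGroup E] [NormedSpace ℝ E]
  {G : Type*} [TopologicalSpace G] [ChartedSpace E G] [Group G] [LieGroup 𝓘(ℝ, E) ∞ G]
  {B : Set ℝ} {P : LoopBundle m M E G B}
  {T : Type*} [NormedAddCommGroup T] [NormedSpace ℝ T]
  {H : Type*} [NormedAddCommGroup H] [NormedSpace ℝ H] [FiniteDimensional ℝ H]
  {H' : Type*} [NormedAddCommGroup H'] [NormedSpace ℝ H'] [FiniteDimensional ℝ H']

namespace SmoothFamily

variable (Γ : P.SmoothFamily T) {j : ℕ} (f : InvariantPolynomial E G (j + 1))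
  {n : ℕ} {p : Cartesian n → P.Total} (hp : IsPlot p)
  (τ : H →L[ℝ] T) (π : H →L[ℝ] Cartesian n)

/-- The Chern–Weil form of the loop form, on `ℝ × H`. -/
def chernForm (p : Cartesian n → P.Total) (hp : IsPlot p) (z : ℝ × H) :
    (ℝ × H) [⋀^Fin (2 * j + 1 + 1)]→L[ℝ] ℝ :=
  cwForm f (curv G (Γ.loopForm p hp τ π) z)

/-- The integral of the Chern–Weil form over the circle. -/
def transgression (p : Cartesian n → P.Total) (hp : IsPlot p) : H → H [⋀^Fin (2 * j + 1)]→L[ℝ] ℝ :=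
  fibreIntegral 0 (2 * Real.pi) (Γ.chernForm f τ π p hp)

theorem contDiff_chernForm : ContDiff ℝ ∞ (Γ.chernForm f τ π p hp) :=
  contDiff_cwForm f (contDiff_curv (Γ.contDiff_loopForm hp τ π))

theorem contDiff_transgression : ContDiff ℝ ∞ (Γ.transgression f τ π p hp) :=
  contDiff_fibreIntegral (Γ.contDiff_chernForm f hp τ π) _ _

theorem extDeriv_chernForm : extDeriv (Γ.chernForm f τ π p hp) = 0 :=
  funext fun z => extDeriv_cwForm f (Γ.contDiff_loopForm hp τ π) z

/-- The Chern–Weil form is closed, so the homotopy formula leaves only the boundary terms at `0` and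
`2π`. These agree because the loop form and its derivative are periodic. -/
theorem extDeriv_transgression : extDeriv (Γ.transgression f τ π p hp) = 0 := by
  have hs := Γ.contDiff_chernForm f hp τ π
  funext y
  rw [transgression, extDeriv_fibreIntegral hs (contDiff_extDeriv hs), Γ.extDeriv_chernForm f hp]
  have hper : ∀ z : ℝ × H, fderiv ℝ (Γ.loopForm p hp τ π) (z + (2 * Real.pi, 0)) =
      fderiv ℝ (Γ.loopForm p hp τ π) z := by
    intro z
    have h1 : (fun z => Γ.loopForm p hp τ π (z + (2 * Real.pi, 0))) = Γ.loopForm p hp τ π := by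
      funext z
      have := Γ.loopForm_periodic hp τ π z.1 z.2
      rwa [show ((z.1 + 2 * Real.pi, z.2) : ℝ × H) = z + (2 * Real.pi, 0) by
        ext <;> simp] at this
    rw [← fderiv_comp_add_right, h1]
  have e : Γ.chernForm f τ π p hp (2 * Real.pi, y) = Γ.chernForm f τ π p hp (0, y) := by
    have h2 := hper (0, y)
    have h3 := Γ.loopForm_periodic hp τ π 0 y
    rw [zero_add] at h3
    rw [show ((0, y) : ℝ × H) + (2 * Real.pi, 0) = (2 * Real.pi, y) by ext <;> simp] at h2
    rw [chernForm, chernForm, curv, curv, h2, h3]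
  ext v
  rw [ContinuousAlternatingMap.sub_apply, ContinuousAlternatingMap.sub_apply, formPull_slice,
    formPull_slice, e, fibreIntegral_zero]
  simp

/-- The curvature changes by `Ad (c⁻¹)` at each point, and `f` is invariant. -/
theorem transgression_act {c : Cartesian n → LoopGroup E G B} (hc : SmoothLoops c) :
    Γ.transgression f τ π (fun y => P.act (p y) (c y)) (P.isPlot_act hp hc) =
      Γ.transgression f τ π p hp := by
  have hC : ContMDiff 𝓘(ℝ, ℝ × H) 𝓘(ℝ, E) ∞ (fun z : ℝ × H => (c (π z.2)).toFun z.1) :=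
    ContMDiff.comp (g := fun z : Cartesian n × ℝ => (c z.1).toFun z.2) hc
      ((π.contDiff.comp contDiff_snd).contMDiff.prodMk contDiff_fst.contMDiff)
  rw [transgression, transgression]
  congr 1
  funext z
  rw [chernForm, chernForm, Γ.loopForm_act hp τ π hc]
  exact cwForm_Ad f _ _ _ (curv_gaugeTransform hC (Γ.contDiff_loopForm hp τ π) z)

theorem transgression_pull {T' : Type*} [NormedAddCommGroup T'] [NormedSpace ℝ T']
    (Γ' : P.SmoothFamily T') {k : ℕ} {h : Cartesian k → Cartesian n} (hh : ContDiff ℝ ∞ h)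
    (τ' : H' →L[ℝ] T') (π' : H' →L[ℝ] Cartesian k) {ι : H' → H} (hι : ContDiff ℝ ∞ ι)
    (hπ : ∀ y, π (ι y) = h (π' y)) (hconn : ∀ y, Γ'.conn (τ' y) = Γ.conn (τ (ι y)))
    (hhiggs : ∀ y, Γ'.higgs (τ' y) = Γ.higgs (τ (ι y))) :
    Γ'.transgression f τ' π' (p ∘ h) (isPlot_reparam hp hh) =
      formPull ι (Γ.transgression f τ π p hp) := by
  rw [transgression, transgression, ← fibreIntegral_formPull hι (Γ.contDiff_chernForm f hp τ π)]
  congr 1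
  funext z
  rw [chernForm, Γ.pull_loopForm hp τ π Γ' hh τ' π' hι hπ hconn hhiggs]
  exact cwForm_comp f _ _ _
    (curv_pull (contDiff_id.prodMap hι) (Γ.contDiff_loopForm hp τ π) z)

/-- The path obtained by restriction to `[0, 1]`. -/
def toPath (Γ : P.SmoothFamily ℝ) : P.SmoothPath where
  conn := Γ.conn
  higgs := Γ.higgs
  smooth_conn p hp := (Γ.smooth_conn p hp).contDiffOn
  smooth_higgs p hp := (Γ.smooth_higgs p hp).contDiffOn

/-- The string potential as a form on the domain of a plot. -/
def stringForm (Γ : P.SmoothFamily ℝ) (p : Cartesian n → P.Total) (hp : IsPlot p) (x : Cartesian n) :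
    Cartesian n [⋀^Fin (2 * j)]→L[ℝ] ℝ :=
  (-(1 / 2 ^ (j + 1)) : ℝ) • fibreIntegral 0 1 (Γ.transgression f (ContinuousLinearMap.fst ℝ ℝ (Cartesian n))
    (ContinuousLinearMap.snd ℝ ℝ (Cartesian n)) p hp) x

theorem contDiff_stringForm (Γ : P.SmoothFamily ℝ) : ContDiff ℝ ∞ (Γ.stringForm f p hp) :=
  (contDiff_fibreIntegral (Γ.contDiff_transgression f hp _ _) _ _).const_smul _

theorem stringForm_act (Γ : P.SmoothFamily ℝ) {c : Cartesian n → LoopGroup E G B}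
    (hc : SmoothLoops c) (x : Cartesian n) :
    Γ.stringForm f (fun y => P.act (p y) (c y)) (P.isPlot_act hp hc) x = Γ.stringForm f p hp x := by
  rw [stringForm, stringForm, Γ.transgression_act f hp _ _ hc]

theorem stringForm_comp (Γ : P.SmoothFamily ℝ) {k : ℕ} {h : Cartesian k → Cartesian n}
    (hh : ContDiff ℝ ∞ h) : Γ.stringForm f (p ∘ h) (isPlot_reparam hp hh) =
      formPull h (Γ.stringForm f p hp) := by
  have e := Γ.transgression_pull f hp (ContinuousLinearMap.fst ℝ ℝ (Cartesian n))
    (ContinuousLinearMap.snd ℝ ℝ (Cartesian n)) Γ hh (ContinuousLinearMap.fst ℝ ℝ (Cartesian k))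
    (ContinuousLinearMap.snd ℝ ℝ (Cartesian k)) (ι := Prod.map id h) (contDiff_id.prodMap hh)
    (fun _ => rfl) (fun _ => rfl) (fun _ => rfl)
  funext y
  rw [stringForm, e, fibreIntegral_formPull hh (Γ.contDiff_transgression f hp _ _)]
  rfl

/-! ### Comparison with the string potential -/

section Components

variable (Γ : P.SmoothFamily ℝ)

local notation "fstT" => ContinuousLinearMap.fst ℝ ℝ (Cartesian n)
local notation "sndT" => ContinuousLinearMap.snd ℝ ℝ (Cartesian n)

theorem fderiv_loopForm_apply (z u w : ℝ × ℝ × Cartesian n) :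
    fderiv ℝ (Γ.loopForm p hp fstT sndT) z u w =
      fderiv ℝ (fun z => Γ.loopForm p hp fstT sndT z w) z u := by
  have h := (((Γ.contDiff_loopForm hp fstT sndT).differentiable (by simp) z).hasFDerivAt).clm_apply
    (hasFDerivAt_const w z)
  rw [h.fderiv]
  simp

/-- Differentiation along an affine embedding. -/
theorem fderiv_apply_of_comp {V W Y : Type*} [NormedAddCommGroup V] [NormedSpace ℝ V]
    [NormedAddCommGroup W] [NormedSpace ℝ W] [NormedAddCommGroup Y] [NormedSpace ℝ Y] {g : W → Y}
    {h : V → W} {x : V} {L : V →L[ℝ] W} (hh : HasFDerivAt h L x)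
    (hg : DifferentiableAt ℝ g (h x)) (v : V) :
    fderiv ℝ g (h x) (L v) = fderiv ℝ (fun y => g (h y)) x v :=
  congrArg (fun A => A v) (hg.hasFDerivAt.comp x hh).fderiv.symm

variable (t θ : ℝ) (x v w : Cartesian n)

theorem differentiable_loopForm_apply (w : ℝ × ℝ × Cartesian n) :
    Differentiable ℝ (fun z => Γ.loopForm p hp fstT sndT z w) :=
  ((Γ.contDiff_loopForm hp fstT sndT).clm_apply contDiff_const).differentiable (by simp)

theorem fderiv_loopForm_space (w : ℝ × ℝ × Cartesian n) :
    fderiv ℝ (Γ.loopForm p hp fstT sndT) (θ, t, x) (0, 0, v) w =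
      fderiv ℝ (fun y => Γ.loopForm p hp fstT sndT (θ, t, y) w) x v := by
  rw [fderiv_loopForm_apply]
  have hd : HasFDerivAt (fun y : Cartesian n => ((θ, t, y) : ℝ × ℝ × Cartesian n))
      ((ContinuousLinearMap.inr ℝ ℝ (ℝ × Cartesian n)).comp (ContinuousLinearMap.inr ℝ ℝ (Cartesian n))) x :=
    (hasFDerivAt_prodMk_right θ (t, x)).comp x (hasFDerivAt_prodMk_right t x)
  exact fderiv_apply_of_comp hd (Γ.differentiable_loopForm_apply hp w _) v

theorem fderiv_loopForm_time (w : ℝ × ℝ × Cartesian n) :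
    fderiv ℝ (Γ.loopForm p hp fstT sndT) (θ, t, x) (0, 1, 0) w =
      deriv (fun s => Γ.loopForm p hp fstT sndT (θ, s, x) w) t := by
  rw [fderiv_loopForm_apply]
  have hd : HasFDerivAt (fun s : ℝ => ((θ, s, x) : ℝ × ℝ × Cartesian n))
      ((ContinuousLinearMap.inr ℝ ℝ (ℝ × Cartesian n)).comp (ContinuousLinearMap.inl ℝ ℝ (Cartesian n))) t :=
    (hasFDerivAt_prodMk_right θ (t, x)).comp t (hasFDerivAt_prodMk_left t x)
  exact fderiv_apply_of_comp hd (Γ.differentiable_loopForm_apply hp w _) 1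

theorem fderiv_loopForm_circle (w : ℝ × ℝ × Cartesian n) :
    fderiv ℝ (Γ.loopForm p hp fstT sndT) (θ, t, x) (1, 0, 0) w =
      deriv (fun s => Γ.loopForm p hp fstT sndT (s, t, x) w) θ := by
  rw [fderiv_loopForm_apply]
  exact fderiv_apply_of_comp (hasFDerivAt_prodMk_left θ (t, x))
    (Γ.differentiable_loopForm_apply hp w _) 1

theorem contDiff_form_space (A : P.Connection) (θ : ℝ) : ContDiff ℝ ∞ (fun y => A.form p hp y θ) :=
  (A.smooth p hp).comp (contDiff_id.prodMk contDiff_const)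

theorem fderiv_form_apply (A : P.Connection) :
    fderiv ℝ (fun y => A.form p hp y θ w) x v = fderiv ℝ (fun y => A.form p hp y θ) x v w := by
  have h := (((contDiff_form_space hp A θ).differentiable (by simp) x).hasFDerivAt).clm_apply
    (hasFDerivAt_const w x)
  rw [h.fderiv]
  simp

/-- This and the next lemmas identify the components of the curvature of `A + Φ dθ` as `F`, `∇Φ`,
`φ` and `B`. The loop form vanishes on `∂_t`, so no bracket appears in the last two. -/
theorem curv_loopForm_space_space : curv G (Γ.loopForm p hp fstT sndT) (θ, t, x) (0, 0, v) (0, 0, w) =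
    (Γ.conn t).curvature p hp x θ v w := by
  rw [curv_apply, fderiv_loopForm_space, fderiv_loopForm_space]
  simp only [loopForm_apply, zero_smul, add_zero, ContinuousLinearMap.coe_fst',
    ContinuousLinearMap.coe_snd', fderiv_form_apply, Connection.curvature, lieBr_eq_lieBrL]

theorem curv_loopForm_space_circle :
    curv G (Γ.loopForm p hp fstT sndT) (θ, t, x) (0, 0, v) (1, 0, 0) =
    (Γ.higgs t).covDeriv (Γ.conn t) p hp x θ v := by
  rw [curv_apply, fderiv_loopForm_space, fderiv_loopForm_circle]
  simp only [loopForm_apply, zero_smul, add_zero, ContinuousLinearMap.coe_fst', one_smul, zero_add,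
    ContinuousLinearMap.coe_snd', map_zero, HiggsField.covDeriv, lieBr_eq_lieBrL]
  abel

theorem differentiableAt_higgs (hp : IsPlot p) : DifferentiableAt ℝ (fun s => (Γ.higgs s).toFun (p x) θ) t :=
  DifferentiableAt.comp t (g := fun z : ℝ × Cartesian n × ℝ => (Γ.higgs z.1).toFun (p z.2.1) z.2.2)
    ((Γ.smooth_higgs p hp).differentiable (by simp) _)
    (f := fun s => (s, x, θ)) (by fun_prop)

theorem differentiableAt_conn : DifferentiableAt ℝ (fun s => (Γ.conn s).form p hp x θ) t :=
  DifferentiableAt.comp t (g := fun z : ℝ × Cartesian n × ℝ => (Γ.conn z.1).form p hp z.2.1 z.2.2)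
    ((Γ.smooth_conn p hp).differentiable (by simp) _)
    (f := fun s => (s, x, θ)) (by fun_prop)

theorem curv_loopForm_time_circle :
    curv G (Γ.loopForm p hp fstT sndT) (θ, t, x) (0, 1, 0) (1, 0, 0) =
    deriv (fun s => (Γ.higgs s).toFun (p x) θ) t := by
  rw [curv_apply, fderiv_loopForm_time, fderiv_loopForm_circle]
  simp [loopForm_apply]

theorem curv_loopForm_time_space :
    curv G (Γ.loopForm p hp fstT sndT) (θ, t, x) (0, 1, 0) (0, 0, w) =
    deriv (fun s => (Γ.conn s).form p hp x θ) t w := by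
  rw [curv_apply, fderiv_loopForm_time, fderiv_loopForm_space]
  have hd : DifferentiableAt ℝ (fun s => (Γ.conn s).form p hp x θ) t :=
    Γ.differentiableAt_conn hp t θ x
  have := hd.hasDerivAt.clm_apply (hasDerivAt_const t w)
  simp only [map_zero, add_zero] at this
  simp [loopForm_apply, this.deriv]

theorem derivWithin_Icc_eq_deriv {Y : Type*} [NormedAddCommGroup Y] [NormedSpace ℝ Y] {g : ℝ → Y}
    {t : ℝ} (ht : t ∈ Set.Icc (0 : ℝ) 1) (hg : DifferentiableAt ℝ g t) :
    derivWithin g (Set.Icc 0 1) t = deriv g t :=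
  hg.derivWithin (uniqueDiffOn_Icc_zero_one t ht)

/-- The constant `-(1 / 2 ^ (j + 1))` in `stringForm` cancels the factor that arises when the
Chern–Weil form is contracted with `∂_θ` and then `∂_t`. The factor `k = j + 1` of the string
potential comes from that contraction itself. -/
theorem stringForm_apply (v : Fin (2 * j) → Cartesian n) :
    Γ.stringForm f p hp x v = Γ.toPath.stringPotential f p hp x v := by
  rw [stringForm, ContinuousAlternatingMap.smul_apply,
    fibreIntegral_apply (Γ.contDiff_transgression f hp _ _), SmoothPath.stringPotential,
    smul_eq_mul, ← intervalIntegral.integral_const_mul, ← intervalIntegral.integral_const_mul]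
  refine intervalIntegral.integral_congr fun t ht => ?_
  rw [Set.uIcc_of_le zero_le_one] at ht
  rw [transgression, fibreIntegral_apply (Γ.contDiff_chernForm f hp _ _),
    ← intervalIntegral.integral_const_mul, ← intervalIntegral.integral_const_mul]
  refine intervalIntegral.integral_congr fun θ _ => ?_
  have e : (Fin.cons (1, 0) fun i => (0, (Fin.cons (1, 0) fun i => (0, v i) :
      Fin (2 * j + 1) → ℝ × Cartesian n) i) : Fin (2 * j + 1 + 1) → ℝ × ℝ × Cartesian n) =
      Fin.cons (1, 0, 0) (Fin.cons (0, 1, 0) fun i => (0, 0, v i) :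
        Fin (2 * j + 1) → ℝ × ℝ × Cartesian n) := by
    congr 1
    funext i
    refine Fin.cases ?_ (fun i => ?_) i <;> simp
  rw [e, chernForm, cwForm_apply]
  refine (congrArg _ (altSum_polyTensor_eq_wedge f (curv_swap _ _) _ _ _)).trans ?_
  rw [wedgeConnDot_comp f _ _ _ (fun v : Cartesian n => ((0, 0, v) : ℝ × ℝ × Cartesian n)),
    wedgeHiggsDot_comp f _ _ (fun v : Cartesian n => ((0, 0, v) : ℝ × ℝ × Cartesian n))]
  have hd1 : DifferentiableAt ℝ (fun s => (Γ.conn s).form p hp x θ) t :=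
    Γ.differentiableAt_conn hp t θ x
  have hd2 : DifferentiableAt ℝ (fun s => (Γ.higgs s).toFun (p x) θ) t :=
    Γ.differentiableAt_higgs t θ x hp
  simp only [curv_loopForm_space_space, curv_loopForm_space_circle, curv_loopForm_time_circle,
    curv_loopForm_time_space]
  rw [show Γ.toPath.connDot p hp t x θ = _ from derivWithin_Icc_eq_deriv ht hd1,
    show Γ.toPath.higgsDot t (p x) θ = _ from derivWithin_Icc_eq_deriv ht hd2]
  field_simp
  rfl

end Components

end SmoothFamily
end LoopBundle

/-! ### Homogeneity of the integrand in the velocities -/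

section WedgeLinear

variable {E : Type*} [NormedAddCommGroup E] [NormedSpace ℝ E]
  {G : Type*} [TopologicalSpace G] [ChartedSpace E G] [Group G] {V : Type*}

theorem wedgeHiggsDot_smul {j : ℕ} (f : InvariantPolynomial E G (j + 1)) (F : V → V → E) (r : ℝ)
    (φ : E) (v : Fin (2 * j) → V) :
    wedgeHiggsDot j f F (r • φ) v = r * wedgeHiggsDot j f F φ v := by
  have h : ∀ a : Fin j → E, f.toMap (Fin.snoc (α := fun _ => E) a (r • φ)) =
      r * f.toMap (Fin.snoc (α := fun _ => E) a φ) := fun a =>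
    f.toMap.toMultilinearMap.snoc_smul a r φ
  simp only [wedgeHiggsDot, h, Finset.mul_sum]
  exact Finset.sum_congr rfl fun σ _ => by ring

theorem wedgeConnDot_smul {j : ℕ} (f : InvariantPolynomial E G (j + 1)) (r : ℝ) (β : V → E)
    (F : V → V → E) (ψ : V → E) (v : Fin (2 * j) → V) :
    wedgeConnDot j f (fun x => r • β x) F ψ v = r * wedgeConnDot j f β F ψ v := by
  cases j with
  | zero => simp [wedgeConnDot]
  | succ j =>
    have h : ∀ (a : Fin (j + 1) → E) (b : E), f.toMap (Fin.cons (α := fun _ => E) (r • b) a) =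
        r * f.toMap (Fin.cons (α := fun _ => E) b a) := fun a b =>
      f.toMap.toMultilinearMap.cons_smul a r b
    simp only [wedgeConnDot, h, Finset.mul_sum]
    exact Finset.sum_congr rfl fun σ _ => by ring

end WedgeLinear

/-! ### Reparametrised paths, affine paths and squares -/

namespace LoopBundle

open Diffeology

variable {m : ℕ} {M : Type*} [TopologicalSpace M] [ChartedSpace (Cartesian m) M]
  {E : Type*} [NormedAddCommGroup E] [NormedSpace ℝ E]
  {G : Type*} [TopologicalSpace G] [ChartedSpace E G] [Group G] [LieGroup 𝓘(ℝ, E) ∞ G]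
  {B : Set ℝ} {P : LoopBundle m M E G B}
  {T : Type*} [NormedAddCommGroup T] [NormedSpace ℝ T]

/-! ### Reparametrisation of a path -/

theorem smoothTransition_mem (t : ℝ) : Real.smoothTransition t ∈ Set.Icc (0 : ℝ) 1 :=
  ⟨Real.smoothTransition.nonneg t, Real.smoothTransition.le_one t⟩

namespace SmoothPath

/-- The reparametrisation of a path by `Real.smoothTransition`, which is smooth at all times. -/
def smoothen (γ : P.SmoothPath) : P.SmoothFamily ℝ where
  conn t := γ.conn (Real.smoothTransition t)
  higgs t := γ.higgs (Real.smoothTransition t)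
  smooth_conn p hp := (γ.smooth_conn p hp).comp_contDiff
    (f := fun z : ℝ × Cartesian _ × ℝ => (Real.smoothTransition z.1, z.2))
    ((Real.smoothTransition.contDiff.comp contDiff_fst).prodMk contDiff_snd)
    fun z => ⟨smoothTransition_mem z.1, trivial⟩
  smooth_higgs p hp := (γ.smooth_higgs p hp).comp_contDiff
    (f := fun z : ℝ × Cartesian _ × ℝ => (Real.smoothTransition z.1, z.2))
    ((Real.smoothTransition.contDiff.comp contDiff_fst).prodMk contDiff_snd)
    fun z => ⟨smoothTransition_mem z.1, trivial⟩

variable (γ : P.SmoothPath) {n : ℕ} {p : Cartesian n → P.Total} (hp : IsPlot p)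

theorem derivWithin_comp_smoothTransition {Y : Type*} [NormedAddCommGroup Y] [NormedSpace ℝ Y]
    {g : ℝ → Y} {t : ℝ} (ht : t ∈ Set.Icc (0 : ℝ) 1)
    (hg : DifferentiableWithinAt ℝ g (Set.Icc 0 1) (Real.smoothTransition t)) :
    derivWithin (fun s => g (Real.smoothTransition s)) (Set.Icc 0 1) t =
      deriv Real.smoothTransition t • derivWithin g (Set.Icc 0 1) (Real.smoothTransition t) := by
  have h1 : HasDerivWithinAt Real.smoothTransition (deriv Real.smoothTransition t) (Set.Icc 0 1) t :=
    ((Real.smoothTransition.contDiff (n := 1)).differentiable (by simp) t).hasDerivAt.hasDerivWithinAt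
  exact (hg.hasDerivWithinAt.scomp t h1 (fun s _ => smoothTransition_mem s)).derivWithin
    (uniqueDiffOn_Icc_zero_one t ht)

theorem differentiableWithinAt_conn {t : ℝ} (ht : t ∈ Set.Icc (0 : ℝ) 1) (x : Cartesian n) (θ : ℝ) :
    DifferentiableWithinAt ℝ (fun s => (γ.conn s).form p hp x θ) (Set.Icc 0 1) t := by
  have h := (γ.smooth_conn p hp).differentiableOn (by simp) (t, x, θ) ⟨ht, trivial⟩
  exact DifferentiableWithinAt.comp t
    (g := fun z : ℝ × Cartesian n × ℝ => (γ.conn z.1).form p hp z.2.1 z.2.2)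
    (f := fun s => (s, x, θ)) h (by fun_prop) (fun s hs => ⟨hs, trivial⟩)

theorem differentiableWithinAt_higgs (hp : IsPlot p) {t : ℝ} (ht : t ∈ Set.Icc (0 : ℝ) 1)
    (x : Cartesian n) (θ : ℝ) :
    DifferentiableWithinAt ℝ (fun s => (γ.higgs s).toFun (p x) θ) (Set.Icc 0 1) t := by
  have h := (γ.smooth_higgs p hp).differentiableOn (by simp) (t, x, θ) ⟨ht, trivial⟩
  exact DifferentiableWithinAt.comp t
    (g := fun z : ℝ × Cartesian n × ℝ => (γ.higgs z.1).toFun (p z.2.1) z.2.2)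
    (f := fun s => (s, x, θ)) h (by fun_prop) (fun s hs => ⟨hs, trivial⟩)

/-- Each term of the integrand contains exactly one velocity, `B_t` or `φ_t`, so the chain rule
factor comes out and the time integral is invariant under substitution. -/
theorem stringPotential_smoothen {j : ℕ} (f : InvariantPolynomial E G (j + 1)) (x : Cartesian n)
    (v : Fin (2 * j) → Cartesian n) :
    γ.smoothen.toPath.stringPotential f p hp x v = γ.stringPotential f p hp x v := by
  rw [stringPotential, stringPotential]
  congr 1
  set K : ℝ → ℝ := fun t => ∫ θ in (0 : ℝ)..(2 * Real.pi),
    ((j : ℝ) * wedgeConnDot j f (fun w => γ.connDot p hp t x θ w)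
        ((γ.conn t).curvature p hp x θ) ((γ.higgs t).covDeriv (γ.conn t) p hp x θ) v
      + wedgeHiggsDot j f ((γ.conn t).curvature p hp x θ) (γ.higgsDot t (p x) θ) v) with hK
  have h1 : ∫ t in (0 : ℝ)..1, K t =
      ∫ t in (0 : ℝ)..1, deriv Real.smoothTransition t • K (Real.smoothTransition t) := by
    -- Substitution along a monotone function requires no regularity of `K`.
    rw [intervalIntegral.integral_of_le zero_le_one, intervalIntegral.integral_of_le zero_le_one,
      ← MeasureTheory.integral_Icc_eq_integral_Ioc, ← MeasureTheory.integral_Icc_eq_integral_Ioc,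
      MeasureTheory.integral_Icc_deriv_smul_of_deriv_nonneg
        Real.smoothTransition.continuous.continuousOn
        (fun t _ => ((Real.smoothTransition.contDiff (n := 1)).differentiable (by simp) t).hasDerivAt)
        (fun t _ => Real.smoothTransition.monotone.deriv_nonneg) zero_le_one,
      Real.smoothTransition.zero, Real.smoothTransition.one]
  rw [h1]
  refine intervalIntegral.integral_congr fun t ht => ?_
  rw [Set.uIcc_of_le zero_le_one] at ht
  simp only [hK, smul_eq_mul]
  rw [← intervalIntegral.integral_const_mul]
  refine intervalIntegral.integral_congr fun θ _ => ?_
  have hmem := smoothTransition_mem t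
  have e1 : γ.smoothen.toPath.connDot p hp t x θ =
      deriv Real.smoothTransition t • γ.connDot p hp (Real.smoothTransition t) x θ :=
    derivWithin_comp_smoothTransition ht (γ.differentiableWithinAt_conn hp hmem x θ)
  have e2 : γ.smoothen.toPath.higgsDot t (p x) θ =
      deriv Real.smoothTransition t • γ.higgsDot (Real.smoothTransition t) (p x) θ :=
    derivWithin_comp_smoothTransition ht (γ.differentiableWithinAt_higgs hp hmem x θ)
  simp only [e1, e2, smul_apply, wedgeHiggsDot_smul, wedgeConnDot_smul]
  simp only [SmoothFamily.toPath, smoothen]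
  ring

end SmoothPath

/-! ### Affine combinations -/

/-- The connection `A + r (A₁ - A₀)`. -/
def Connection.shift (A : P.Connection) (r : ℝ) (A₁ A₀ : P.Connection) : P.Connection where
  form p hp x θ := A.form p hp x θ + r • (A₁.form p hp x θ - A₀.form p hp x θ)
  smooth p hp := (A.smooth p hp).add (((A₁.smooth p hp).sub (A₀.smooth p hp)).const_smul r)
  periodic p hp x θ := by
    beta_reduce
    rw [A.periodic p hp x θ, A₁.periodic p hp x θ, A₀.periodic p hp x θ]
  based p hp x θ hθ := by
    rw [A.based p hp x θ hθ, A₁.based p hp x θ hθ, A₀.based p hp x θ hθ, sub_zero, smul_zero, add_zero]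
  reparam p hp h hh y θ := by
    rw [A.reparam p hp h hh, A₁.reparam p hp h hh, A₀.reparam p hp h hh]
    ext v; simp
  equivariant p hp γ x θ := by
    rw [A.equivariant p hp, A₁.equivariant p hp, A₀.equivariant p hp]
    ext v; simp
  fundamental q c hc h0 θ v := by
    have h := A.fundamental q c hc h0 θ v
    have h₁ := A₁.fundamental q c hc h0 θ v
    have h₀ := A₀.fundamental q c hc h0 θ v
    refine Eq.trans ?_ h
    have h' := h₁.trans h₀.symm
    rw [add_apply, smul_apply, sub_apply, h', sub_self, smul_zero, add_zero]

/-- The Higgs field `Φ + r (Φ₁ - Φ₀)`. -/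
def HiggsField.shift (Φ : P.HiggsField) (r : ℝ) (Φ₁ Φ₀ : P.HiggsField) : P.HiggsField where
  toFun q θ := Φ.toFun q θ + r • (Φ₁.toFun q θ - Φ₀.toFun q θ)
  smooth p hp := (Φ.smooth p hp).add (((Φ₁.smooth p hp).sub (Φ₀.smooth p hp)).const_smul r)
  periodic q θ := by
    beta_reduce
    rw [Φ.periodic q θ, Φ₁.periodic q θ, Φ₀.periodic q θ]
  twisted q γ θ := by
    rw [Φ.twisted, Φ₁.twisted, Φ₀.twisted, add_sub_add_right_eq_sub, ← map_sub, map_add, map_smul]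
    abel

namespace SmoothFamily

/-- The constant family. -/
def const (a : P.Connection × P.HiggsField) : P.SmoothFamily T where
  conn _ := a.1
  higgs _ := a.2
  smooth_conn p hp := (a.1.smooth p hp).comp contDiff_snd
  smooth_higgs p hp := (a.2.smooth p hp).comp contDiff_snd

/-- The family `Γ + r (Γ₁ - Γ₀)`. -/
def shift (Γ : P.SmoothFamily T) {r : T → ℝ} (hr : ContDiff ℝ ∞ r) (Γ₁ Γ₀ : P.SmoothFamily T) :
    P.SmoothFamily T where
  conn t := (Γ.conn t).shift (r t) (Γ₁.conn t) (Γ₀.conn t)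
  higgs t := (Γ.higgs t).shift (r t) (Γ₁.higgs t) (Γ₀.higgs t)
  smooth_conn p hp := (Γ.smooth_conn p hp).add ((hr.comp contDiff_fst).smul
    ((Γ₁.smooth_conn p hp).sub (Γ₀.smooth_conn p hp)))
  smooth_higgs p hp := (Γ.smooth_higgs p hp).add ((hr.comp contDiff_fst).smul
    ((Γ₁.smooth_higgs p hp).sub (Γ₀.smooth_higgs p hp)))

/-- The pullback of a family along a map of the parameters. -/
def comp (Γ : P.SmoothFamily T) {T' : Type*} [NormedAddCommGroup T'] [NormedSpace ℝ T']
    {r : T' → T} (hr : ContDiff ℝ ∞ r) : P.SmoothFamily T' where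
  conn t := Γ.conn (r t)
  higgs t := Γ.higgs (r t)
  smooth_conn p hp := (Γ.smooth_conn p hp).comp ((hr.comp contDiff_fst).prodMk contDiff_snd)
  smooth_higgs p hp := (Γ.smooth_higgs p hp).comp ((hr.comp contDiff_fst).prodMk contDiff_snd)

/-- The affine path from `a` to `b`. -/
def line (a b : P.Connection × P.HiggsField) : P.SmoothFamily ℝ :=
  (const a).shift contDiff_id (const b) (const a)

/-- The square `γ₁(s) + t (δ(s) - γ₁(s)) + s (γ₂(t) - b) + s t (b - c)`. -/
def square (γ₁ γ₂ δ : P.SmoothFamily ℝ) (b c : P.Connection × P.HiggsField) :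
    P.SmoothFamily (ℝ × ℝ) :=
  (((γ₁.comp contDiff_fst).shift contDiff_snd (δ.comp contDiff_fst) (γ₁.comp contDiff_fst)).shift
    contDiff_fst (γ₂.comp contDiff_snd) (const b)).shift (contDiff_fst.mul contDiff_snd) (const b)
      (const c)

theorem toPath_line_joins (a b : P.Connection × P.HiggsField) : (line a b).toPath.Joins a b := by
  refine ⟨Prod.ext ?_ ?_, Prod.ext ?_ ?_⟩
  · refine Connection.ext ?_
    funext n p hp x θ
    simp [toPath, line, shift, const, Connection.shift]
  · refine HiggsField.ext ?_
    funext q θ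
    simp [toPath, line, shift, const, HiggsField.shift]
  · refine Connection.ext ?_
    funext n p hp x θ
    simp [toPath, line, shift, const, Connection.shift]
  · refine HiggsField.ext ?_
    funext q θ
    simp [toPath, line, shift, const, HiggsField.shift]

end SmoothFamily

theorem SmoothPath.joins_smoothen {γ : P.SmoothPath} {a b : P.Connection × P.HiggsField}
    (h : γ.Joins a b) : γ.smoothen.toPath.Joins a b := by
  simpa [SmoothPath.Joins, SmoothFamily.toPath, SmoothPath.smoothen] using h

namespace SmoothFamily

section Square
variable {γ₁ γ₂ δ : P.SmoothFamily ℝ} {a b c : P.Connection × P.HiggsField}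

theorem square_conn_form (s t : ℝ) {n : ℕ} (p : Cartesian n → P.Total) (hp : IsPlot p)
    (x : Cartesian n) (θ : ℝ) : ((square γ₁ γ₂ δ b c).conn (s, t)).form p hp x θ =
      (γ₁.conn s).form p hp x θ + t • ((δ.conn s).form p hp x θ - (γ₁.conn s).form p hp x θ) +
      s • ((γ₂.conn t).form p hp x θ - b.1.form p hp x θ) +
      (s * t) • (b.1.form p hp x θ - c.1.form p hp x θ) := rfl

theorem square_higgs_toFun (s t : ℝ) (q : P.Total) (θ : ℝ) :
    ((square γ₁ γ₂ δ b c).higgs (s, t)).toFun q θ =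
      (γ₁.higgs s).toFun q θ + t • ((δ.higgs s).toFun q θ - (γ₁.higgs s).toFun q θ) +
      s • ((γ₂.higgs t).toFun q θ - b.2.toFun q θ) +
      (s * t) • (b.2.toFun q θ - c.2.toFun q θ) := rfl

theorem Joins.conn_zero {γ : P.SmoothFamily ℝ} (h : γ.toPath.Joins a b) : γ.conn 0 = a.1 :=
  congrArg Prod.fst h.1

theorem Joins.conn_one {γ : P.SmoothFamily ℝ} (h : γ.toPath.Joins a b) : γ.conn 1 = b.1 :=
  congrArg Prod.fst h.2

theorem Joins.higgs_zero {γ : P.SmoothFamily ℝ} (h : γ.toPath.Joins a b) : γ.higgs 0 = a.2 :=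
  congrArg Prod.snd h.1

theorem Joins.higgs_one {γ : P.SmoothFamily ℝ} (h : γ.toPath.Joins a b) : γ.higgs 1 = b.2 :=
  congrArg Prod.snd h.2


/-- The square interpolates its boundary: the sides `s = 0`, `s = 1`, `t = 0` and `t = 1` are the
constant `a`, `γ₂`, `γ₁` and `δ`. The bilinear term with `b - c` is the corner correction that makes
the four sides fit. -/
theorem square_zero_left (h₁ : γ₁.toPath.Joins a b) (h : δ.toPath.Joins a c)
    (t : ℝ) : (square γ₁ γ₂ δ b c).conn (0, t) = a.1 ∧
    (square γ₁ γ₂ δ b c).higgs (0, t) = a.2 := by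
  constructor
  · refine Connection.ext ?_
    funext n p hp x θ
    simp [square_conn_form, Joins.conn_zero h₁, Joins.conn_zero h]
  · refine HiggsField.ext ?_
    funext q θ
    simp [square_higgs_toFun, Joins.higgs_zero h₁, Joins.higgs_zero h]

theorem square_one_left (h₁ : γ₁.toPath.Joins a b) (h : δ.toPath.Joins a c)
    (t : ℝ) : (square γ₁ γ₂ δ b c).conn (1, t) = γ₂.conn t ∧
    (square γ₁ γ₂ δ b c).higgs (1, t) = γ₂.higgs t := by
  constructor
  · refine Connection.ext ?_
    funext n p hp x θ
    simp [square_conn_form, Joins.conn_one h₁, Joins.conn_one h, smul_sub]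
    abel
  · refine HiggsField.ext ?_
    funext q θ
    simp [square_higgs_toFun, Joins.higgs_one h₁, Joins.higgs_one h, smul_sub]
    abel

theorem square_zero_right (h₂ : γ₂.toPath.Joins b c)
    (s : ℝ) : (square γ₁ γ₂ δ b c).conn (s, 0) = γ₁.conn s ∧
    (square γ₁ γ₂ δ b c).higgs (s, 0) = γ₁.higgs s := by
  constructor
  · refine Connection.ext ?_
    funext n p hp x θ
    simp [square_conn_form, Joins.conn_zero h₂]
  · refine HiggsField.ext ?_
    funext q θ
    simp [square_higgs_toFun, Joins.higgs_zero h₂]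

theorem square_one_right (h₂ : γ₂.toPath.Joins b c)
    (s : ℝ) : (square γ₁ γ₂ δ b c).conn (s, 1) = δ.conn s ∧
    (square γ₁ γ₂ δ b c).higgs (s, 1) = δ.higgs s := by
  constructor
  · refine Connection.ext ?_
    funext n p hp x θ
    simp [square_conn_form, Joins.conn_one h₂, smul_sub]
    abel
  · refine HiggsField.ext ?_
    funext q θ
    simp [square_higgs_toFun, Joins.higgs_one h₂, smul_sub]
    abel

end Square
end SmoothFamily
end LoopBundle

/-! ### Basic forms and Stokes' theorem on the square -/

namespace LoopBundle

open Diffeology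

variable {m : ℕ} {M : Type*} [TopologicalSpace M] [ChartedSpace (Cartesian m) M]
  {E : Type*} [NormedAddCommGroup E] [NormedSpace ℝ E]
  {G : Type*} [TopologicalSpace G] [ChartedSpace E G] [Group G] [LieGroup 𝓘(ℝ, E) ∞ G]
  {B : Set ℝ} {P : LoopBundle m M E G B}

variable (P) in
/-- A basic `d`-form on the total space, given by its pullbacks to plots: natural under
reparametrisation of plots and invariant under the gauge action. -/
structure BasicForm (d : ℕ) where
  form : ∀ {n : ℕ} (p : Cartesian n → P.Total), IsPlot p → Cartesian n → Cartesian n [⋀^Fin d]→L[ℝ] ℝ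
  smooth : ∀ {n : ℕ} (p : Cartesian n → P.Total) (hp : IsPlot p), ContDiff ℝ ∞ (form p hp)
  reparam : ∀ {n k : ℕ} (p : Cartesian n → P.Total) (hp : IsPlot p) (h : Cartesian k → Cartesian n)
    (hh : ContDiff ℝ ∞ h), form (p ∘ h) (isPlot_reparam hp hh) = formPull h (form p hp)
  act : ∀ {n : ℕ} (p : Cartesian n → P.Total) (hp : IsPlot p) (c : Cartesian n → LoopGroup E G B)
    (hc : SmoothLoops c), form (fun y => P.act (p y) (c y)) (P.isPlot_act hp hc) = form p hp

theorem formPull_smul {X Y : Type*} [NormedAddCommGroup X] [NormedSpace ℝ X]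
    [NormedAddCommGroup Y] [NormedSpace ℝ Y] {d : ℕ} (r : ℝ) (h : Y → X)
    (η : X → X [⋀^Fin d]→L[ℝ] ℝ) : formPull h (r • η) = r • formPull h η := rfl

namespace SmoothFamily

/-- The string potential as a basic form. -/
def stringBasic (Γ : P.SmoothFamily ℝ) {j : ℕ} (f : InvariantPolynomial E G (j + 1)) :
    P.BasicForm (2 * j) where
  form p hp := Γ.stringForm f p hp
  smooth p hp := Γ.contDiff_stringForm f hp
  reparam p hp h hh := Γ.stringForm_comp f hp hh
  act p hp c hc := funext fun x => Γ.stringForm_act f hp hc x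

theorem stringForm_const (a : P.Connection × P.HiggsField) {j : ℕ}
    (f : InvariantPolynomial E G (j + 1)) {n : ℕ} (p : Cartesian n → P.Total) (hp : IsPlot p) :
    (const a).stringForm f p hp = 0 := by
  funext x
  ext v
  rw [stringForm_apply, SmoothPath.stringPotential]
  -- The zero velocity is written as a multiple, so that homogeneity applies.
  have h1 : ∀ t θ, (const a).toPath.connDot p hp t x θ = (0 : ℝ) • (0 : Cartesian n →L[ℝ] E) :=
    fun t θ => (congrFun (derivWithin_fun_const (Set.Icc (0 : ℝ) 1) (a.1.form p hp x θ)) t).trans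
      (smul_zero _).symm
  have h2 : ∀ t θ, (const a).toPath.higgsDot t (p x) θ = (0 : ℝ) • (0 : E) :=
    fun t θ => (congrFun (derivWithin_fun_const (Set.Icc (0 : ℝ) 1) (a.2.toFun (p x) θ)) t).trans
      (smul_zero _).symm
  simp only [h1, h2, smul_apply, wedgeHiggsDot_smul, wedgeConnDot_smul]
  simp

section Square

/-- The parameters of a square. -/
def squareTime (n : ℕ) : ℝ × ℝ × Cartesian n →L[ℝ] ℝ × ℝ :=
  (ContinuousLinearMap.fst ℝ ℝ (ℝ × Cartesian n)).prod
    ((ContinuousLinearMap.fst ℝ ℝ (Cartesian n)).comp (ContinuousLinearMap.snd ℝ ℝ (ℝ × Cartesian n)))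

/-- The projection to the domain of the plot. -/
def squareSpace (n : ℕ) : ℝ × ℝ × Cartesian n →L[ℝ] Cartesian n :=
  (ContinuousLinearMap.snd ℝ ℝ (Cartesian n)).comp (ContinuousLinearMap.snd ℝ ℝ (ℝ × Cartesian n))

variable (Γ : P.SmoothFamily (ℝ × ℝ)) {j : ℕ} (f : InvariantPolynomial E G (j + 1))
  {n : ℕ} (p : Cartesian n → P.Total) (hp : IsPlot p)

/-- The integral over the first parameter of the transgression form of a square. -/
def squareForm : ℝ × Cartesian n → (ℝ × Cartesian n) [⋀^Fin (2 * j)]→L[ℝ] ℝ :=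
  fibreIntegral 0 1 (Γ.transgression f (squareTime n) (squareSpace n)
    p hp)

theorem contDiff_squareForm : ContDiff ℝ ∞ (Γ.squareForm f p hp) :=
  contDiff_fibreIntegral (Γ.contDiff_transgression f hp _ _) _ _

theorem squareForm_comp {k : ℕ} {h : Cartesian k → Cartesian n} (hh : ContDiff ℝ ∞ h) :
    Γ.squareForm f (p ∘ h) (isPlot_reparam hp hh) =
      formPull (Prod.map id h) (Γ.squareForm f p hp) := by
  have hm : ContDiff ℝ ∞ (Prod.map id h : ℝ × Cartesian k → ℝ × Cartesian n) :=
    contDiff_id.prodMap hh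
  rw [squareForm, squareForm, ← fibreIntegral_formPull hm (Γ.contDiff_transgression f hp _ _)]
  congr 1
  exact Γ.transgression_pull f hp _ _ Γ hh _ _ (contDiff_id.prodMap hm)
    (fun _ => rfl) (fun _ => rfl) (fun _ => rfl)

theorem squareForm_act {c : Cartesian n → LoopGroup E G B} (hc : SmoothLoops c) :
    Γ.squareForm f (fun y => P.act (p y) (c y)) (P.isPlot_act hp hc) = Γ.squareForm f p hp := by
  rw [squareForm, squareForm, Γ.transgression_act f hp _ _ hc]

theorem formPull_squareForm (γ : P.SmoothFamily ℝ) (t : ℝ)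
    (h : ∀ s, Γ.conn (s, t) = γ.conn s ∧ Γ.higgs (s, t) = γ.higgs s) :
    formPull (fun x => (t, x)) (Γ.squareForm f p hp) = fibreIntegral 0 1 (γ.transgression f
      (ContinuousLinearMap.fst ℝ ℝ (Cartesian n)) (ContinuousLinearMap.snd ℝ ℝ (Cartesian n)) p hp) := by
  have hm : ContDiff ℝ ∞ (fun x : Cartesian n => (t, x)) := by fun_prop
  rw [squareForm, ← fibreIntegral_formPull hm (Γ.contDiff_transgression f hp _ _)]
  congr 1
  exact (Γ.transgression_pull f hp (squareTime n) (squareSpace n) γ contDiff_id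
    (ContinuousLinearMap.fst ℝ ℝ (Cartesian n)) (ContinuousLinearMap.snd ℝ ℝ (Cartesian n))
    (contDiff_id.prodMap hm)
    (fun _ => rfl) (fun y => (h y.1).1.symm) (fun y => (h y.1).2.symm)).symm

theorem formPull_transgression (γ : P.SmoothFamily ℝ) (s : ℝ)
    (h : ∀ t, Γ.conn (s, t) = γ.conn t ∧ Γ.higgs (s, t) = γ.higgs t) :
    formPull (fun y : ℝ × Cartesian n => (s, y)) (Γ.transgression f (squareTime n) (squareSpace n)
      p hp) = γ.transgression f
      (ContinuousLinearMap.fst ℝ ℝ (Cartesian n)) (ContinuousLinearMap.snd ℝ ℝ (Cartesian n)) p hp :=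
  (Γ.transgression_pull f hp (squareTime n) (squareSpace n) γ contDiff_id
    (ContinuousLinearMap.fst ℝ ℝ (Cartesian n)) (ContinuousLinearMap.snd ℝ ℝ (Cartesian n))
    (ι := fun y => (s, y)) (contDiff_const.prodMk contDiff_id)
    (fun _ => rfl) (fun y => (h y.1).1.symm) (fun y => (h y.1).2.symm)).symm

/-- The transgression form on the square is closed, so the homotopy formula in `s` leaves only the
sides `s = 0` and `s = 1`. -/
theorem extDeriv_squareForm (γ₀ γ₁ : P.SmoothFamily ℝ)
    (h₀ : ∀ t, Γ.conn (0, t) = γ₀.conn t ∧ Γ.higgs (0, t) = γ₀.higgs t)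
    (h₁ : ∀ t, Γ.conn (1, t) = γ₁.conn t ∧ Γ.higgs (1, t) = γ₁.higgs t) :
    extDeriv (Γ.squareForm f p hp) =
      γ₁.transgression f (ContinuousLinearMap.fst ℝ ℝ (Cartesian n))
        (ContinuousLinearMap.snd ℝ ℝ (Cartesian n)) p hp -
      γ₀.transgression f (ContinuousLinearMap.fst ℝ ℝ (Cartesian n))
        (ContinuousLinearMap.snd ℝ ℝ (Cartesian n)) p hp := by
  funext y
  have hs := Γ.contDiff_transgression f hp (squareTime n) (squareSpace n)
  rw [squareForm, extDeriv_fibreIntegral hs (contDiff_extDeriv hs), extDeriv_transgression,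
    fibreIntegral_zero, Γ.formPull_transgression f p hp γ₁ 1 h₁,
    Γ.formPull_transgression f p hp γ₀ 0 h₀]
  simp

/-- The integral of the transgression form over a square, as a basic form. -/
def squareBasic (Γ : P.SmoothFamily (ℝ × ℝ)) {j : ℕ} (f : InvariantPolynomial E G (j + 1 + 1)) :
    P.BasicForm (2 * j + 1) where
  form p hp := (-(1 / 2 ^ (j + 1 + 1)) : ℝ) • fibreIntegral (d := 2 * j + 1) 0 1 (Γ.squareForm f p hp)
  smooth p hp :=
    contDiff_const.smul (contDiff_fibreIntegral (d := 2 * j + 1) (Γ.contDiff_squareForm f p hp) _ _)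
  reparam p hp h hh := by
    rw [Γ.squareForm_comp f p hp hh, formPull_smul, ← fibreIntegral_formPull (d := 2 * j + 1) hh (Γ.contDiff_squareForm f p hp)]
  act p hp c hc := by rw [Γ.squareForm_act f p hp hc]

end Square

variable {γ₁ γ₂ δ : P.SmoothFamily ℝ} {a b c : P.Connection × P.HiggsField} {j : ℕ}

theorem smul_sub_sub_sub {V : Type*} [AddCommGroup V] [Module ℝ V] (r : ℝ) (x y z w : V)
    (hw : r • w = 0) : r • (x - y - (z - w)) = r • x - r • y - r • z := by
  rw [smul_sub, smul_sub, smul_sub, hw, sub_zero]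

/-- The homotopy formula in `t` applied to `squareForm`. The sides `t = 1` and `t = 0` give `δ` and
`γ₁`; its exterior derivative contributes the sides `s = 1` and `s = 0`, that is `γ₂` and a constant
path, whose potential is zero. -/
theorem stringForm_triangle (f : InvariantPolynomial E G (j + 1 + 1)) (h₁ : γ₁.toPath.Joins a b)
    (h₂ : γ₂.toPath.Joins b c) (h : δ.toPath.Joins a c) {n : ℕ} (p : Cartesian n → P.Total)
    (hp : IsPlot p) (x : Cartesian n) :
    δ.stringForm f p hp x - γ₁.stringForm f p hp x - γ₂.stringForm f p hp x =
      extDeriv (((square γ₁ γ₂ δ b c).squareBasic f).form p hp) x := by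
  have hs := (square γ₁ γ₂ δ b c).contDiff_squareForm f p hp
  have e0 := (square γ₁ γ₂ δ b c).formPull_squareForm f p hp γ₁ 0 (square_zero_right h₂)
  have e1 := (square γ₁ γ₂ δ b c).formPull_squareForm f p hp δ 1 (square_one_right h₂)
  have e2 := (square γ₁ γ₂ δ b c).extDeriv_squareForm f p hp (const a) γ₂
    (square_zero_left h₁ h) (square_one_left h₁ h)
  have e3 := congrFun (stringForm_const a f p hp) x
  have e4 := extDeriv_fibreIntegral (d := 2 * j + 1) hs (contDiff_extDeriv hs) 0 1 x
  -- The same equation with the degree written as `2 * (j + 1)`, which unfolds to `2 * j + 1 + 1`.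
  have e5 : extDeriv (fibreIntegral (d := 2 * j + 1) 0 1
      ((square γ₁ γ₂ δ b c).squareForm f p hp)) x =
      formPull (fun x => (1, x)) ((square γ₁ γ₂ δ b c).squareForm f p hp) x -
      formPull (fun x => (0, x)) ((square γ₁ γ₂ δ b c).squareForm f p hp) x -
      fibreIntegral (d := 2 * (j + 1)) 0 1
        (extDeriv ((square γ₁ γ₂ δ b c).squareForm f p hp)) x := e4
  rw [e0, e1, e2, fibreIntegral_sub (γ₂.contDiff_transgression f hp _ _)
    ((const a).contDiff_transgression f hp _ _)] at e5
  refine Eq.trans ?_ ((extDeriv_smul _ _).trans (congrArg _ e5)).symm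
  exact (smul_sub_sub_sub (-(1 / 2 ^ (j + 1 + 1)) : ℝ) _ _ _ _ e3).symm

/-- For `k = 1` the form `squareForm` has degree `0` and has no fibre integral, so the homotopy
formula has no differential term. -/
theorem stringForm_triangle_zero (f : InvariantPolynomial E G (0 + 1)) (h₁ : γ₁.toPath.Joins a b)
    (h₂ : γ₂.toPath.Joins b c) (h : δ.toPath.Joins a c) {n : ℕ} (p : Cartesian n → P.Total)
    (hp : IsPlot p) (x : Cartesian n) :
    δ.stringForm f p hp x - γ₁.stringForm f p hp x - γ₂.stringForm f p hp x = 0 := by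
  have hs := (square γ₁ γ₂ δ b c).contDiff_squareForm f p hp
  have e0 := (square γ₁ γ₂ δ b c).formPull_squareForm f p hp γ₁ 0 (square_zero_right h₂)
  have e1 := (square γ₁ γ₂ δ b c).formPull_squareForm f p hp δ 1 (square_one_right h₂)
  have e2 := (square γ₁ γ₂ δ b c).extDeriv_squareForm f p hp (const a) γ₂
    (square_zero_left h₁ h) (square_one_left h₁ h)
  have e3 := congrFun (stringForm_const a f p hp) x
  have e4 := fibreIntegral_extDeriv_zero hs (contDiff_extDeriv hs) 0 1 x
  rw [e0, e1, e2, fibreIntegral_sub (γ₂.contDiff_transgression f hp _ _)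
    ((const a).contDiff_transgression f hp _ _)] at e4
  refine (smul_sub_sub_sub (-(1 / 2 ^ (0 + 1)) : ℝ) _ _ _ _ e3).symm.trans ?_
  rw [← e4, sub_self, smul_zero]

end SmoothFamily
end LoopBundle

/-! ### Descent of basic forms to the base -/

/-- A smooth map into a neighbourhood of a point that is the identity near the point. -/
theorem exists_smooth_cutoff {n : ℕ} (y₀ : Cartesian n) {V : Set (Cartesian n)} (hV : V ∈ 𝓝 y₀) :
    ∃ h : Cartesian n → Cartesian n, ContDiff ℝ ∞ h ∧ (∀ y, h y ∈ V) ∧ ∀ᶠ y in 𝓝 y₀, h y = y := by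
  obtain ⟨ε, hε, hball⟩ := Metric.mem_nhds_iff.1 hV
  let b : ContDiffBump y₀ := ⟨ε / 2, ε, by positivity, by linarith⟩
  refine ⟨fun y => y₀ + b y • (y - y₀), contDiff_const.add (b.contDiff.smul
    (contDiff_id.sub contDiff_const)), fun y => hball ?_, ?_⟩
  · rw [Metric.mem_ball, dist_eq_norm, add_sub_cancel_left]
    by_cases hy : y ∈ Metric.ball y₀ ε
    · rw [norm_smul, Real.norm_of_nonneg b.nonneg]
      rw [Metric.mem_ball, dist_eq_norm] at hy
      exact lt_of_le_of_lt (mul_le_of_le_one_left (norm_nonneg _) b.le_one) hy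
    · have : b y = 0 := b.zero_of_le_dist (not_lt.1 hy)
      simp [this, hε]
  · filter_upwards [Metric.closedBall_mem_nhds y₀ (half_pos hε)] with y hy
    rw [b.one_of_mem_closedBall hy]
    simp

theorem fderiv_eq_id_of_eventually {n : ℕ} {h : Cartesian n → Cartesian n} {y : Cartesian n}
    (hh : ∀ᶠ z in 𝓝 y, h z = z) : fderiv ℝ h y = ContinuousLinearMap.id ℝ _ := by
  have : h =ᶠ[𝓝 y] id := hh
  rw [this.fderiv_eq, fderiv_id]

theorem formPull_of_eventually_id {n d : ℕ} {h : Cartesian n → Cartesian n} {y : Cartesian n}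
    (hh : ∀ᶠ z in 𝓝 y, h z = z) (η : Cartesian n → Cartesian n [⋀^Fin d]→L[ℝ] ℝ) :
    formPull h η y = η y := by
  rw [formPull, fderiv_eq_id_of_eventually hh, hh.self_of_nhds]
  rfl

namespace LoopBundle

open Diffeology

variable {m : ℕ} {M : Type*} [TopologicalSpace M] [ChartedSpace (Cartesian m) M]
  {E : Type*} [NormedAddCommGroup E] [NormedSpace ℝ E]
  {G : Type*} [TopologicalSpace G] [ChartedSpace E G] [Group G] [LieGroup 𝓘(ℝ, E) ∞ G]
  {B : Set ℝ} {P : LoopBundle m M E G B}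

theorem contMDiff_proj {n : ℕ} {p : Cartesian n → P.Total} (hp : IsPlot p) :
    ContMDiff (𝓡 n) (𝓡 m) ∞ (fun x => P.proj (p x)) :=
  contMDiffOn_univ.1 (P.isPlot_iff.1 hp).1

/-- A smooth map into the domain of a local trivialisation lifts to a plot. -/
theorem exists_plot_lift (P : LoopBundle m M E G B) {n : ℕ} {g : Cartesian n → M} (hg : ContMDiff (𝓡 n) (𝓡 m) ∞ g) {i : P.Index}
    (hi : ∀ y, g y ∈ P.U i) : ∃ q : Cartesian n → P.Total, IsPlot q ∧ ∀ y, P.proj (q y) = g y := by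
  -- The lift has loop coordinate `1` in the trivialisation `i`, so its coordinate in any other one
  -- is the transition function.
  choose q hq _ using fun y => P.bijective i (g y) (hi y) 1
  refine ⟨q, P.isPlot_iff.2 ⟨?_, fun k => ?_⟩, fun y => (hq y).1⟩
  · simp only [(hq _).1]
    exact hg.contMDiffOn
  · have h1 : ContMDiffOn ((𝓡 n).prod 𝓘(ℝ, ℝ)) 𝓘(ℝ, E) ∞
        (fun z : Cartesian n × ℝ => (P.transition k i (g z.1)).toFun z.2)
        ((Set.univ ∩ (fun x => P.proj (q x)) ⁻¹' P.U k) ×ˢ Set.univ) := by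
      refine ContMDiffOn.comp (P.smooth_transition k i)
        (((hg.comp contMDiff_fst).prodMk contMDiff_snd).contMDiffOn) ?_
      rintro ⟨y, θ⟩ ⟨⟨-, hy⟩, -⟩
      simp only [Set.mem_preimage, (hq _).1] at hy
      exact ⟨⟨hy, hi y⟩, trivial⟩
    refine h1.congr ?_
    rintro ⟨y, θ⟩ ⟨⟨-, hy⟩, -⟩
    have h2 := P.coord_transition k i (q y) hy (by rw [(hq y).1]; exact hi y)
    rw [(hq y).1, (hq y).2, mul_one] at h2
    simp only [h2]

/-- Two plots over the same map into the domain of a local trivialisation differ by a map to the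
loop group. -/
theorem exists_loops_of_proj_eq {n : ℕ} {p p' : Cartesian n → P.Total} (hp : IsPlot p)
    (hp' : IsPlot p') (h : ∀ y, P.proj (p y) = P.proj (p' y)) {i : P.Index}
    (hi : ∀ y, P.proj (p y) ∈ P.U i) :
    ∃ c : Cartesian n → LoopGroup E G B, SmoothLoops c ∧ p' = fun y => P.act (p y) (c y) := by
  refine ⟨fun y => (P.coord i (p y))⁻¹ * P.coord i (p' y), ?_, ?_⟩
  · have h1 : ContMDiff ((𝓡 n).prod 𝓘(ℝ, ℝ)) 𝓘(ℝ, E) ∞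
        (fun z : Cartesian n × ℝ => (P.coord i (p z.1)).toFun z.2) := by
      refine contMDiffOn_univ.1 (((P.isPlot_iff.1 hp).2 i).mono ?_)
      exact fun z _ => ⟨⟨trivial, hi z.1⟩, trivial⟩
    have h2 : ContMDiff ((𝓡 n).prod 𝓘(ℝ, ℝ)) 𝓘(ℝ, E) ∞
        (fun z : Cartesian n × ℝ => (P.coord i (p' z.1)).toFun z.2) := by
      refine contMDiffOn_univ.1 (((P.isPlot_iff.1 hp').2 i).mono ?_)
      exact fun z _ => ⟨⟨trivial, by simpa only [Set.mem_preimage, ← h] using hi z.1⟩, trivial⟩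
    exact h1.inv.mul h2
  · funext y
    refine (P.bijective i _ (hi y) (P.coord i (p' y))).unique ⟨(h y).symm, rfl⟩ ⟨P.proj_act _ _, ?_⟩
    rw [P.coord_act i _ _ (hi y), mul_inv_cancel_left]

variable {d : ℕ}

theorem BasicForm.form_congr (α : P.BasicForm d) {n : ℕ} {p p' : Cartesian n → P.Total}
    (h : p = p') (hp : IsPlot p) (hp' : IsPlot p') : α.form p hp = α.form p' hp' := by
  subst h; rfl

/-- A basic form depends only on the projection of the plot to the base. -/
theorem BasicForm.form_eq_of_proj_eq (α : P.BasicForm d) {n : ℕ} {p p' : Cartesian n → P.Total}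
    (hp : IsPlot p) (hp' : IsPlot p') {y₀ : Cartesian n}
    (h : ∀ᶠ y in 𝓝 y₀, P.proj (p y) = P.proj (p' y)) : α.form p hp y₀ = α.form p' hp' y₀ := by
  obtain ⟨i, hi⟩ := P.cover (P.proj (p y₀))
  have hU : ∀ᶠ y in 𝓝 y₀, P.proj (p y) ∈ P.U i :=
    (contMDiff_proj hp).continuous.continuousAt.eventually ((P.isOpen_U i).mem_nhds hi)
  -- Plots are defined on all of `ℝⁿ`. Precomposition with a cutoff map makes the local conditions
  -- global and does not change the form at `y₀`.
  obtain ⟨k, hk, hkV, hk1⟩ := exists_smooth_cutoff y₀ (h.and hU)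
  obtain ⟨c, hc, hpc⟩ := exists_loops_of_proj_eq (isPlot_reparam hp hk) (isPlot_reparam hp' hk)
    (fun y => (hkV y).1) (fun y => (hkV y).2)
  have e1 := congrFun (α.reparam p hp k hk) y₀
  have e2 := congrFun (α.reparam p' hp' k hk) y₀
  rw [formPull_of_eventually_id hk1] at e1 e2
  rw [← e1, ← e2, α.form_congr hpc _ (P.isPlot_act (isPlot_reparam hp hk) hc), α.act _ _ c hc]

variable [IsManifold (𝓡 m) ∞ M]

/-- Near each point, the inverse of a chart lifts to a plot. -/
theorem exists_plot_lift_chart_symm (P : LoopBundle m M E G B) (x₀ : M) {y₀ : Cartesian m}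
    (hy₀ : y₀ ∈ (chartAt (Cartesian m) x₀).target) : ∃ q : Cartesian m → P.Total, IsPlot q ∧
      ∀ᶠ y in 𝓝 y₀, P.proj (q y) = (chartAt (Cartesian m) x₀).symm y := by
  set φ := chartAt (Cartesian m) x₀
  obtain ⟨i, hi⟩ := P.cover (φ.symm y₀)
  have ht : φ.target ∈ 𝓝 y₀ := φ.open_target.mem_nhds hy₀
  have hU : ∀ᶠ y in 𝓝 y₀, φ.symm y ∈ P.U i :=
    (φ.continuousAt_symm hy₀).eventually ((P.isOpen_U i).mem_nhds hi)
  obtain ⟨k, hk, hkV, hk1⟩ := exists_smooth_cutoff y₀ ((eventually_mem_set.2 ht).and hU)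
  have hs : ContMDiff (𝓡 m) (𝓡 m) ∞ (fun y => φ.symm (k y)) :=
    ContMDiffOn.comp_contMDiff (contMDiffOn_chart_symm (I := 𝓡 m) (n := ∞) (x := x₀)) hk.contMDiff
      (fun y => (hkV y).1)
  obtain ⟨q, hq, hqs⟩ := P.exists_plot_lift hs (fun y => (hkV y).2)
  refine ⟨q, hq, hk1.mono fun y hy => ?_⟩
  rw [hqs, hy]

theorem mfderiv_eq_fderiv_chart {n : ℕ} {h : Cartesian n → M} {y : Cartesian n}
    (hh : MDifferentiableAt (𝓡 n) (𝓡 m) h y) :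
    (mfderiv (𝓡 n) (𝓡 m) h y : Cartesian n →L[ℝ] Cartesian m) =
      fderiv ℝ (fun z => chartAt (Cartesian m) (h y) (h z)) y := by
  rw [hh.mfderiv]
  simp only [writtenInExtChartAt, extChartAt_model_space_eq_id, modelWithCornersSelf_coe,
    Set.range_id, fderivWithin_univ]
  rfl

/-- A basic form in terms of the plot over a chart. -/
theorem BasicForm.form_eq_comp_mfderiv (α : P.BasicForm d) {n : ℕ} {p : Cartesian n → P.Total}
    (hp : IsPlot p) (y₀ : Cartesian n) {q : Cartesian m → P.Total} (hq : IsPlot q)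
    (h : ∀ᶠ y in 𝓝 (chartAt (Cartesian m) (P.proj (p y₀)) (P.proj (p y₀))),
      P.proj (q y) = (chartAt (Cartesian m) (P.proj (p y₀))).symm y) :
    α.form p hp y₀ = (α.form q hq (chartAt (Cartesian m) (P.proj (p y₀)) (P.proj (p y₀)))).compContinuousLinearMap
      (mfderiv (𝓡 n) (𝓡 m) (fun y => P.proj (p y)) y₀ : Cartesian n →L[ℝ] Cartesian m) := by
  set φ := chartAt (Cartesian m) (P.proj (p y₀)) with hφ
  have hpc := contMDiff_proj hp
  have hs : ∀ᶠ y in 𝓝 y₀, P.proj (p y) ∈ φ.source :=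
    hpc.continuous.continuousAt.eventually (φ.open_source.mem_nhds (mem_chart_source _ _))
  obtain ⟨k, hk, hkV, hk1⟩ := exists_smooth_cutoff y₀ hs
  have hg : ContDiff ℝ ∞ (fun y => φ (P.proj (p (k y)))) := by
    rw [← contMDiff_iff_contDiff]
    exact ContMDiffOn.comp_contMDiff (contMDiffOn_chart (I := 𝓡 m) (n := ∞) (x := P.proj (p y₀)))
      (hpc.comp hk.contMDiff) hkV
  have hk0 : k y₀ = y₀ := hk1.self_of_nhds
  have e1 := congrFun (α.reparam p hp k hk) y₀
  rw [formPull_of_eventually_id hk1] at e1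
  have e2 := congrFun (α.reparam q hq _ hg) y₀
  -- Both plots project to the same map near `y₀`; the second one factors through the chart.
  have e3 : α.form (p ∘ k) (isPlot_reparam hp hk) y₀ =
      α.form (q ∘ fun y => φ (P.proj (p (k y)))) (isPlot_reparam hq hg) y₀ := by
    refine α.form_eq_of_proj_eq _ _ ?_
    have ht : Tendsto (fun y => φ (P.proj (p (k y)))) (𝓝 y₀) (𝓝 (φ (P.proj (p y₀)))) := by
      have := hg.continuous.tendsto y₀
      rwa [hk0] at this
    filter_upwards [ht.eventually h] with y hy
    simp only [Function.comp_apply]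
    rw [hy, φ.left_inv (hkV y)]
  have e4 : fderiv ℝ (fun y => φ (P.proj (p (k y)))) y₀ =
      (mfderiv (𝓡 n) (𝓡 m) (fun y => P.proj (p y)) y₀ : Cartesian n →L[ℝ] Cartesian m) := by
    rw [mfderiv_eq_fderiv_chart (hpc.mdifferentiableAt (by simp))]
    refine Filter.EventuallyEq.fderiv_eq ?_
    filter_upwards [hk1] with y hy
    rw [hy]
  rw [← e1, e3, e2, formPull, e4]
  simp only [hk0]
  rfl

theorem pullback_congr {n : ℕ} (ρ : DiffForm m M d) {g h : Cartesian n → M} {y : Cartesian n}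
    (e : g =ᶠ[𝓝 y] h) : ρ.pullback g y = ρ.pullback h y := by
  have e1 : (mfderiv (𝓡 n) (𝓡 m) g y : Cartesian n →L[ℝ] Cartesian m) = mfderiv (𝓡 n) (𝓡 m) h y :=
    e.mfderiv_eq
  have e2 : (ρ.toFun (g y) : Cartesian m [⋀^Fin d]→L[ℝ] ℝ) = ρ.toFun (h y) :=
    congrArg (show M → Cartesian m [⋀^Fin d]→L[ℝ] ℝ from ρ.toFun) e.eq_of_nhds
  exact congrArg₂ (fun (α : Cartesian m [⋀^Fin d]→L[ℝ] ℝ) L => α.compContinuousLinearMap L) e2 e1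

/-- The plot over the chart at `x`. -/
def chartPlot (P : LoopBundle m M E G B) (x : M) : Cartesian m → P.Total :=
  (P.exists_plot_lift_chart_symm x (mem_chart_target (Cartesian m) x)).choose

theorem isPlot_chartPlot (x : M) : IsPlot (P.chartPlot x) :=
  (P.exists_plot_lift_chart_symm x (mem_chart_target (Cartesian m) x)).choose_spec.1

theorem proj_chartPlot (x : M) : ∀ᶠ y in 𝓝 (chartAt (Cartesian m) x x),
    P.proj (P.chartPlot x y) = (chartAt (Cartesian m) x).symm y :=
  (P.exists_plot_lift_chart_symm x (mem_chart_target (Cartesian m) x)).choose_spec.2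

/-- The form on the base defined by a basic form. -/
def BasicForm.descend (α : P.BasicForm d) : DiffForm m M d where
  toFun x := α.form (P.chartPlot x) (isPlot_chartPlot x) (chartAt (Cartesian m) x x)
  smooth x₀ := by
    intro y₀ hy₀
    obtain ⟨q, hq, hqs⟩ := P.exists_plot_lift_chart_symm x₀ hy₀
    refine ContDiffAt.contDiffWithinAt ?_
    refine ((α.smooth q hq).contDiffAt (x := y₀)).congr_of_eventuallyEq ?_
    filter_upwards [hqs.eventually_nhds] with y hy
    -- The chosen plots `chartPlot` need not depend smoothly on the point, but near `y₀` all of them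
    -- give the value computed from the single plot `q`.
    rw [α.form_eq_comp_mfderiv hq y (isPlot_chartPlot _) (proj_chartPlot _)]
    have e1 : (mfderiv (𝓡 m) (𝓡 m) (fun y => P.proj (q y)) y : Cartesian m →L[ℝ] Cartesian m) =
        mfderiv (𝓡 m) (𝓡 m) (chartAt (Cartesian m) x₀).symm y :=
      Filter.EventuallyEq.mfderiv_eq hy
    rw [e1, hy.self_of_nhds]
    rfl

theorem BasicForm.pullback_descend (α : P.BasicForm d) {n : ℕ} {p : Cartesian n → P.Total}
    (hp : IsPlot p) (y : Cartesian n) :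
    α.descend.pullback (fun y => P.proj (p y)) y = α.form p hp y :=
  (α.form_eq_comp_mfderiv hp y (isPlot_chartPlot _) (proj_chartPlot _)).symm

/-- At its centre the plot `chartPlot x` projects to `x`, with the identity as derivative in the
chart, so pullback along it recovers the form at `x`. -/
theorem diffForm_ext_of_pullback {ρ η : DiffForm m M d}
    (h : ∀ (p : Cartesian m → P.Total), IsPlot p → ∀ y,
      ρ.pullback (fun y => P.proj (p y)) y = η.pullback (fun y => P.proj (p y)) y) : ρ = η := by
  ext1
  funext x
  have key : ∀ ζ : DiffForm m M d, ζ.pullback (fun y => P.proj (P.chartPlot x y))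
      (chartAt (Cartesian m) x x) = (ζ.toFun x : Cartesian m [⋀^Fin d]→L[ℝ] ℝ) := by
    intro ζ
    have hx : P.proj (P.chartPlot x (chartAt (Cartesian m) x x)) = x := by
      rw [(proj_chartPlot x).self_of_nhds, (chartAt (Cartesian m) x).left_inv (mem_chart_source _ x)]
    have e1 : (mfderiv (𝓡 m) (𝓡 m) (fun y => P.proj (P.chartPlot x y)) (chartAt (Cartesian m) x x) :
        Cartesian m →L[ℝ] Cartesian m) = ContinuousLinearMap.id ℝ _ := by
      rw [mfderiv_eq_fderiv_chart ((contMDiff_proj (isPlot_chartPlot x)).mdifferentiableAt (by simp)), hx]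
      refine fderiv_eq_id_of_eventually ?_
      filter_upwards [proj_chartPlot (P := P) x, (chartAt (Cartesian m) x).open_target.mem_nhds
        (mem_chart_target (Cartesian m) x)] with y hy hy'
      rw [hy, (chartAt (Cartesian m) x).right_inv hy']
    have e2 : (ζ.toFun (P.proj (P.chartPlot x (chartAt (Cartesian m) x x))) :
        Cartesian m [⋀^Fin d]→L[ℝ] ℝ) = ζ.toFun x :=
      congrArg (show M → Cartesian m [⋀^Fin d]→L[ℝ] ℝ from ζ.toFun) hx
    exact congrArg₂ (fun (α : Cartesian m [⋀^Fin d]→L[ℝ] ℝ) L => α.compContinuousLinearMap L) e2 e1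
  exact (key ρ).symm.trans ((h _ (isPlot_chartPlot x) _).trans (key η))

/-- A form on the base is exact if its pullback is the exterior derivative of a basic form. -/
theorem isExact_of_pullback_eq_extDeriv (β : P.BasicForm d) (ρ : DiffForm m M (d + 1))
    (h : ∀ (p : Cartesian m → P.Total) (hp : IsPlot p) (y : Cartesian m),
      ρ.pullback (fun y => P.proj (p y)) y = extDeriv (β.form p hp) y) : ρ.IsExact := by
  refine ⟨β.descend, fun x₀ y₀ hy₀ => ?_⟩
  obtain ⟨q, hq, hqs⟩ := P.exists_plot_lift_chart_symm x₀ hy₀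
  have e1 : ρ.pullback (fun y => P.proj (q y)) y₀ = ρ.pullback (chartAt (Cartesian m) x₀).symm y₀ :=
    pullback_congr ρ hqs
  rw [← e1, h q hq]
  refine Filter.EventuallyEq.extDeriv_eq ?_
  filter_upwards [hqs.eventually_nhds] with y hy
  rw [← β.pullback_descend hq]
  exact pullback_congr _ hy

end LoopBundle

/-! ### Differences of exact forms -/

namespace DiffForm

variable {m : ℕ} {M : Type*} [TopologicalSpace M] [ChartedSpace (Cartesian m) M] {d : ℕ}

theorem sub_toFun (ρ η : DiffForm m M d) (x : M) : (ρ - η).toFun x = ρ.toFun x - η.toFun x := rfl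

theorem zero_toFun (x : M) : (0 : DiffForm m M d).toFun x = 0 := rfl

theorem pullback_sub (ρ η : DiffForm m M d) {n : ℕ} (h : Cartesian n → M) (y : Cartesian n) :
    (ρ - η).pullback h y = ρ.pullback h y - η.pullback h y := rfl

/-- The only closure property used: the required combinations of exact forms are all written with
`0` and subtraction. -/
theorem IsExact.sub {ρ η : DiffForm m M d} (hρ : ρ.IsExact) (hη : η.IsExact) :
    (ρ - η).IsExact := by
  cases d with
  | zero =>
    have h1 : ρ = 0 := hρ
    have h2 : η = 0 := hη
    subst h1 h2
    refine DiffForm.ext (funext fun x => ?_)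
    exact sub_zero _
  | succ d =>
    obtain ⟨ρ', h1⟩ := hρ
    obtain ⟨η', h2⟩ := hη
    refine ⟨ρ' - η', fun x₀ y hy => ?_⟩
    have hd : ∀ ζ : DiffForm m M d, DifferentiableAt ℝ
        (ζ.pullback (chartAt (Cartesian m) x₀).symm) y := fun ζ =>
      ((ζ.smooth x₀).contDiffAt ((chartAt (Cartesian m) x₀).open_target.mem_nhds hy)).differentiableAt
        (by simp)
    have e : (ρ' - η').pullback (chartAt (Cartesian m) x₀).symm =
        ρ'.pullback (chartAt (Cartesian m) x₀).symm +
          (-1 : ℝ) • η'.pullback (chartAt (Cartesian m) x₀).symm := by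
      funext z
      ext v
      exact (fun u w => by ring : ∀ u w : ℝ, u - w = u + (-1) * w) _ _
    rw [e, extDeriv_add (hd ρ') ((hd η').const_smul _), extDeriv_smul, ← h1 x₀ y hy, ← h2 x₀ y hy,
      pullback_sub]
    ext v
    exact (fun u w => by ring : ∀ u w : ℝ, u - w = u + (-1) * w) _ _

end DiffForm

/-! ### The triangle relation on the base and its consequences -/

namespace LoopBundle

open Diffeology

variable {m : ℕ} {M : Type*} [TopologicalSpace M] [ChartedSpace (Cartesian m) M]
  [IsManifold (𝓡 m) ∞ M]
  {E : Type*} [NormedAddCommGroup E] [NormedSpace ℝ E]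
  {G : Type*} [TopologicalSpace G] [ChartedSpace E G] [Group G] [LieGroup 𝓘(ℝ, E) ∞ G]
  {B : Set ℝ} {P : LoopBundle m M E G B} {j : ℕ} {f : InvariantPolynomial E G (j + 1)}
  {a b c : P.Connection × P.HiggsField}

namespace SmoothPath

/-- This passes to the reparametrised path, whose string potential is a basic form given by fibre
integrals. -/
theorem isStringPotential_iff {γ : P.SmoothPath} {ρ : DiffForm m M (2 * j)} :
    γ.IsStringPotential f ρ ↔ ∀ {n : ℕ} (p : Cartesian n → P.Total) (hp : IsPlot p) (x : Cartesian n),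
      ρ.pullback (fun y => P.proj (p y)) x = γ.smoothen.stringForm f p hp x := by
  constructor
  · intro h n p hp x
    ext v
    rw [h p hp x v, SmoothFamily.stringForm_apply, stringPotential_smoothen]
  · intro h n p hp x v
    rw [h p hp x, SmoothFamily.stringForm_apply, stringPotential_smoothen]

theorem existsUnique_isStringPotential (f : InvariantPolynomial E G (j + 1)) (γ : P.SmoothPath) :
    ∃! ρ : DiffForm m M (2 * j), γ.IsStringPotential f ρ := by
  refine ⟨(γ.smoothen.stringBasic f).descend, isStringPotential_iff.2 fun p hp x =>
    (γ.smoothen.stringBasic f).pullback_descend hp x, fun η hη => ?_⟩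
  refine diffForm_ext_of_pullback (P := P) fun p hp y => ?_
  rw [isStringPotential_iff.1 hη p hp]
  exact ((γ.smoothen.stringBasic f).pullback_descend hp y).symm

/-- Path independence, symmetry and transitivity are all instances of this relation. -/
theorem isExact_triangle {γ₁ γ₂ δ : P.SmoothPath} (h₁ : γ₁.Joins a b) (h₂ : γ₂.Joins b c)
    (h : δ.Joins a c) {ρ₁ ρ₂ ρ : DiffForm m M (2 * j)} (hρ₁ : γ₁.IsStringPotential f ρ₁)
    (hρ₂ : γ₂.IsStringPotential f ρ₂) (hρ : δ.IsStringPotential f ρ) : (ρ - ρ₁ - ρ₂).IsExact := by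
  rw [isStringPotential_iff] at hρ₁ hρ₂ hρ
  cases j with
  | zero =>
    refine diffForm_ext_of_pullback (P := P) fun p hp y => ?_
    rw [DiffForm.pullback_sub, DiffForm.pullback_sub, hρ₁ p hp, hρ₂ p hp, hρ p hp,
      SmoothFamily.stringForm_triangle_zero f (joins_smoothen h₁) (joins_smoothen h₂)
        (joins_smoothen h)]
    rfl
  | succ j =>
    refine isExact_of_pullback_eq_extDeriv (d := 2 * j + 1)
      ((SmoothFamily.square γ₁.smoothen γ₂.smoothen δ.smoothen b c).squareBasic f) _
      fun p hp y => ?_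
    rw [← SmoothFamily.stringForm_triangle f (joins_smoothen h₁) (joins_smoothen h₂)
        (joins_smoothen h), ← hρ₁ p hp, ← hρ₂ p hp, ← hρ p hp]
    rfl

theorem joins_const (a : P.Connection × P.HiggsField) :
    (SmoothFamily.const (T := ℝ) a).toPath.Joins a a := ⟨rfl, rfl⟩

theorem isStringPotential_const (a : P.Connection × P.HiggsField) :
    (SmoothFamily.const (T := ℝ) a).toPath.IsStringPotential f 0 := by
  intro n p hp x v
  rw [← SmoothFamily.stringForm_apply, SmoothFamily.stringForm_const]
  rfl

/-- The triangle whose second side is constant at `b`. -/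
theorem isExact_sub {γ₀ γ₁ : P.SmoothPath} (h₀ : γ₀.Joins a b) (h₁ : γ₁.Joins a b)
    {ρ₀ ρ₁ : DiffForm m M (2 * j)} (hρ₀ : γ₀.IsStringPotential f ρ₀)
    (hρ₁ : γ₁.IsStringPotential f ρ₁) : (ρ₁ - ρ₀).IsExact := by
  have e : ρ₁ - ρ₀ - 0 = ρ₁ - ρ₀ := DiffForm.ext (funext fun x => sub_zero _)
  exact e ▸ isExact_triangle h₀ (joins_const b) h₁ hρ₀ (isStringPotential_const b) hρ₁

theorem HasExactPotential.of_joins {γ₀ γ₁ : P.SmoothPath} (h₀ : γ₀.Joins a b) (h₁ : γ₁.Joins a b)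
    (h : γ₀.HasExactPotential f) : γ₁.HasExactPotential f := by
  obtain ⟨ρ₀, hρ₀, he⟩ := h
  obtain ⟨ρ₁, hρ₁, -⟩ := existsUnique_isStringPotential f γ₁
  have e : ρ₀ - (ρ₀ - ρ₁) = ρ₁ := DiffForm.ext (funext fun x => sub_sub_cancel _ _)
  exact ⟨ρ₁, hρ₁, e ▸ he.sub (isExact_sub h₁ h₀ hρ₁ hρ₀)⟩

/-- The form `0 - 0` is the difference of the potentials of a constant path with itself, so degree
`0` needs no separate argument. -/
theorem isExact_zero (P : LoopBundle m M E G B) (a : P.Connection × P.HiggsField)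
    (f : InvariantPolynomial E G (j + 1)) : (0 : DiffForm m M (2 * j)).IsExact := by
  have e : (0 : DiffForm m M (2 * j)) - 0 = 0 := DiffForm.ext (funext fun x => sub_zero _)
  exact e ▸ isExact_sub (joins_const a) (joins_const a) (isStringPotential_const (f := f) a)
    (isStringPotential_const a)

theorem hasExactPotential_const (a : P.Connection × P.HiggsField) :
    (SmoothFamily.const (T := ℝ) a).toPath.HasExactPotential f :=
  ⟨0, isStringPotential_const a, isExact_zero P a f⟩

/-- The triangle with sides `γ`, `γ'` and the constant path at `a`. -/
theorem HasExactPotential.symm {γ γ' : P.SmoothPath} (h : γ.Joins a b) (h' : γ'.Joins b a)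
    (he : γ.HasExactPotential f) : γ'.HasExactPotential f := by
  obtain ⟨ρ, hρ, he⟩ := he
  obtain ⟨ρ', hρ', -⟩ := existsUnique_isStringPotential f γ'
  have h0 := isExact_triangle h h' (joins_const a) hρ hρ' (isStringPotential_const a)
  have e : (0 - ρ) - (0 - ρ - ρ') = ρ' := DiffForm.ext (funext fun x => sub_sub_cancel _ _)
  exact ⟨ρ', hρ', e ▸ ((isExact_zero P a f).sub he).sub h0⟩

theorem HasExactPotential.trans {γ₁ γ₂ δ : P.SmoothPath} (h₁ : γ₁.Joins a b) (h₂ : γ₂.Joins b c)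
    (h : δ.Joins a c) (he₁ : γ₁.HasExactPotential f) (he₂ : γ₂.HasExactPotential f) :
    δ.HasExactPotential f := by
  obtain ⟨ρ₁, hρ₁, he₁⟩ := he₁
  obtain ⟨ρ₂, hρ₂, he₂⟩ := he₂
  obtain ⟨ρ, hρ, -⟩ := existsUnique_isStringPotential f δ
  have h0 := isExact_triangle h₁ h₂ h hρ₁ hρ₂ hρ
  have e : ρ₁ - ((0 - ρ₂) - (ρ - ρ₁ - ρ₂)) = ρ := by
    refine DiffForm.ext (funext fun x => ?_)
    simp only [DiffForm.sub_toFun, DiffForm.zero_toFun]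
    abel
  exact ⟨ρ, hρ, e ▸ he₁.sub (((isExact_zero P a f).sub he₂).sub h0)⟩

end SmoothPath

theorem equivalence_stringEquivalent {ι : Type*} (f : ι → Σ j : ℕ, InvariantPolynomial E G (j + 1)) :
    Equivalence (StringEquivalent (P := P) f) where
  refl a := ⟨_, SmoothPath.joins_const a, fun _ => SmoothPath.hasExactPotential_const a⟩
  symm := fun {a b} ⟨_, h, he⟩ => ⟨_, SmoothFamily.toPath_line_joins b a, fun i =>
    (he i).symm h (SmoothFamily.toPath_line_joins b a)⟩
  trans := fun {a _ c} ⟨_, h₁, he₁⟩ ⟨_, h₂, he₂⟩ => ⟨_, SmoothFamily.toPath_line_joins a c, fun i =>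
    (he₁ i).trans h₁ h₂ (SmoothFamily.toPath_line_joins a c) (he₂ i)⟩

end LoopBundle

end

theorem mainTheorem7 {m : ℕ} {M : Type*} [TopologicalSpace M] [ChartedSpace (Cartesian m) M]
    [IsManifold (𝓡 m) ∞ M] [T2Space M] [ParacompactSpace M]
    {E : Type*} [NormedAddCommGroup E] [NormedSpace ℝ E] [FiniteDimensional ℝ E]
    {G : Type*} [TopologicalSpace G] [ChartedSpace E G] [Group G] [LieGroup 𝓘(ℝ, E) ∞ G]
    {B : Set ℝ} (P : LoopBundle m M E G B) :
    -- the string potential of a path descends to a unique form on `M`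
    (∀ {j : ℕ} (f : InvariantPolynomial E G (j + 1)) (γ : P.SmoothPath),
      ∃! ρ : DiffForm m M (2 * j), γ.IsStringPotential f ρ) ∧
    -- for two paths with the same endpoints, the difference of the string potentials is exact
    (∀ {j : ℕ} (f : InvariantPolynomial E G (j + 1)) (γ₀ γ₁ : P.SmoothPath)
      (a b : P.Connection × P.HiggsField), γ₀.Joins a b → γ₁.Joins a b →
      ∀ ρ₀ ρ₁ : DiffForm m M (2 * j),
        γ₀.IsStringPotential f ρ₀ → γ₁.IsStringPotential f ρ₁ → (ρ₁ - ρ₀).IsExact) ∧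
    -- any two pairs are joined by a path, their equivalence does not depend on the path, and
    -- it is an equivalence relation
    (∀ a b : P.Connection × P.HiggsField, ∃ γ : P.SmoothPath, γ.Joins a b) ∧
    (∀ {ι : Type*} (f : ι → Σ j : ℕ, InvariantPolynomial E G (j + 1)),
      (∀ (a b : P.Connection × P.HiggsField) (γ : P.SmoothPath), γ.Joins a b →
        (LoopBundle.StringEquivalent f a b ↔ ∀ i, γ.HasExactPotential (f i).2)) ∧
      Equivalence (LoopBundle.StringEquivalent (P := P) f)) :=
  ⟨fun f γ => γ.existsUnique_isStringPotential f,
    fun _ _ _ _ _ h₀ h₁ _ _ hρ₀ hρ₁ => LoopBundle.SmoothPath.isExact_sub h₀ h₁ hρ₀ hρ₁,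
    fun a b => ⟨_, LoopBundle.SmoothFamily.toPath_line_joins a b⟩,
    fun f => ⟨fun _ _ γ h => ⟨fun ⟨_, h', he⟩ i => (he i).of_joins h' h, fun he => ⟨γ, h, he⟩⟩,
      LoopBundle.equivalence_stringEquivalent f⟩⟩
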